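/- Let $D>0$, let $V:\mathbb R\to\mathbb R$ be continuously differentiable and bounded below, let $x:[0,\infty)\to\mathbb R$ be continuous (the observed path), and let $p_0$ be a probability density on $\mathbb R$ (the prior). For a time step $\varepsilon>0$ consider repeated Bayesian updates at the times $t_i=i\varepsilon$, $i=1,2,\dots$, of a hidden state that moves by a Wiener process with diffusion constant $D$ and is observed with likelihood $p(x(t_i)\mid q_i)\propto e^{-\varepsilon V(q_i-x(t_i))}$. Put all factors that do not depend on the states (Gaussian prefactor, constant of the likelihood, evidence) into one constant $M>0$ per step. The (unnormalized) posterior density after $N$ updates is then given by $p^{\varepsilon}_{0}=p_0$ and $$p^{\varepsilon}_{i}(q')=M\int_{\mathbb R}\exp\Big[-\varepsilon\Big\{\frac1{2D}\Big(\frac{q'-q}{\varepsilon}\Big)^2+V(q'-x(t_i))\Big\}\Big]\,p^{\varepsilon}_{i-1}(q)\,dq,\qquad i=1,\dots,N .$$ With $M=(2\pi D\varepsilon)^{-1/2}$ there is a function $p(q,t)=p(q,t\mid x)$, $q\in\mathbb R$, $t>0$, with the following properties. 1. (Continuous-time limit.) For all $t>0$ and $q\in\mathbb R$, $p^{t/N}_{N}(q)\to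 p(q,t)$ as $N\to\infty$. 2. ($p$ is the posterior density up to a factor independent of $q$.) For every $t>0$, $p(\cdot,t)$ is positive and integrable, and for every choice of constants $M_\varepsilon>0$ the exact normalized Bayesian posterior density after $N$ updates with time step $\varepsilon=t/N$, Wiener transition densities $(2\pi D\varepsilon)^{-1/2}e^{-(q'-q)^2/(2D\varepsilon)}$ and likelihood $M_\varepsilon e^{-\varepsilon V(q-x(t_i))}$ (in each step divided by the evidence) converges at every $q$ to $p(q,t)/\int p(y,t)\,dy$ as $N\to\infty$. 3. (Normalization.) For all $t>0$, $q'\in\mathbb R$ and every function $\varepsilon\mapsto M_\varepsilon\in\mathbb R$, the short-time evolution equation $$p(q',t+\varepsilon)=M_\varepsilon\int_{\mathbb R}\exp\Big[-\varepsilon\Big\{\frac1{2D}\Big(\frac{q'-q}{\varepsilon}\Big)^2+V(q-x(t))\Big\}\Big]\,p(q,t)\,dq+o(\varepsilon)\qquad(\varepsilon\downarrow0)$$ holds if and only if $M_\varepsilon\sqrt{2\pi D\varepsilon}=1+o(\varepsilon)$; in particular it holds for $M_\varepsilon=(2\pi D\varepsilon)^{-1/2}$. 4. (Imaginary-time Schrödinger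 equation.) For every $t>0$, $p(\cdot,t)$ is twice continuously differentiable, $p(q,\cdot)$ is differentiable at $t$ for every $q$, and $$-\frac{\partial p}{\partial t}(q,t)=\Big\{-\frac D2\frac{\partial^2}{\partial q^2}+V(q-x(t))\Big\}\,p(q,t)\qquad(q\in\mathbb R,\ t>0).$$ -/

import Mathlib

open MeasureTheory Filter Topology Asymptotics

/-- Transition density `p(q' | q)` over a time `ε` of the Wiener process with diffusion constant `D`. -/
noncomputable def wienerTransition (D ε q' q : ℝ) : ℝ :=
  (Real.sqrt (2 * Real.pi * D * ε))⁻¹ * Real.exp (-(q' - q) ^ 2 / (2 * D * ε))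

/-- Likelihood `p(y | q) = M exp(-ε V(q - y))` of the observation `y` in the state `q`. -/
noncomputable def likelihood (V : ℝ → ℝ) (M ε y q : ℝ) : ℝ :=
  M * Real.exp (-ε * V (q - y))

/-- Law of total probability: the density after one transition of the Wiener process. -/
noncomputable def predict (D ε : ℝ) (f : ℝ → ℝ) (q' : ℝ) : ℝ :=
  ∫ q, wienerTransition D ε q' q * f q

/-- The probability density `p(y)` of the observation `y` (the evidence). -/
noncomputable def evidence (D : ℝ) (V : ℝ → ℝ) (M ε y : ℝ) (f : ℝ → ℝ) : ℝ :=
  ∫ q, likelihood V M ε y q * predict D ε f q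

/-- The exact normalized Bayesian posterior after `n` updates with time step `ε`, the `i`-th of
which uses the observation `x (i ε)`:
`p_{i}(q') = ∫ p(x_i | q') / p(x_i) * p(q' | q) * p_{i-1}(q) dq`. -/
noncomputable def bayesPosterior (D : ℝ) (V x p₀ : ℝ → ℝ) (M ε : ℝ) : ℕ → ℝ → ℝ
  | 0 => p₀
  | n + 1 => fun q' =>
      likelihood V M ε (x ((n + 1 : ℕ) * ε)) q' /
          evidence D V M ε (x ((n + 1 : ℕ) * ε)) (bayesPosterior D V x p₀ M ε n) *
        predict D ε (bayesPosterior D V x p₀ M ε n) q'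

/-- The discretized path integral `∫ K(q, q₀) p₀(q₀) dq₀` with `n` time steps of length `ε`, where
`K(q_n, q₀) = M ^ n ∫ dq₁ ⋯ dq_{n-1} exp(-ε ∑ᵢ (((qᵢ - qᵢ₋₁) / ε)² / (2D) + V(qᵢ - x(iε))))`,
written as an iterated integral. All factors that do not depend on the states are in `M`. -/
noncomputable def pathPosterior (D : ℝ) (V x p₀ : ℝ → ℝ) (M ε : ℝ) : ℕ → ℝ → ℝ
  | 0 => p₀
  | n + 1 => fun q' =>
      M * ∫ q, Real.exp (-ε * (1 / (2 * D) * ((q' - q) / ε) ^ 2 + V (q' - x ((n + 1 : ℕ) * ε)))) *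
        pathPosterior D V x p₀ M ε n q

/-- The short-time evolution of a density `f` over a time `ε`, the potential being evaluated at the
starting point of the step:
`M ∫ exp(-ε [((q' - q) / ε)² / (2D) + V(q - y)]) f(q) dq`. -/
noncomputable def shortTimeStep (D : ℝ) (V : ℝ → ℝ) (M ε y : ℝ) (f : ℝ → ℝ) (q' : ℝ) : ℝ :=
  M * ∫ q, Real.exp (-ε * (1 / (2 * D) * ((q' - q) / ε) ^ 2 + V (q - y))) * f q

/-!
Each Bayesian update is a step of the heat flow `heat D ε` followed by multiplication by
`exp(-ε V(q - x(t)))`. After subtracting a lower bound `c` from `V`, which costs a factor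
`exp(-c t)`, the potential `U(t, q) = V(q - x(t)) - c` is nonnegative, and the updates form a
Trotter splitting (`splitStep`) for `∂p/∂t = (D / 2) ∂²p/∂q² - U p`.

*Convergence.* Suppose first that `U` is bounded and uniformly continuous. The mild (Duhamel)
equation then has a solution by Picard iteration (`exists_mild_solution`), and the local error of
the splitting is `o(ε)`, which gives convergence (`tendsto_splitStep_of_bounded`). In general `U` is
only continuous. It is modified outside a large square so as to become bounded and uniformly
continuous, and the prior is replaced by a bounded continuous function which is close to it in `L¹`.
The scheme changes little, uniformly in the number of steps: `cosh` is an eigenfunction of the heat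
semigroup, so for a prior bounded by `C` the effect of a change of `U` outside `|q| ≤ R` is at most
`C exp(D t / 2) cosh q / cosh R` (`abs_splitStep_sub_le_cosh`). Hence the schemes for `U` converge,
and the limit is a locally uniform limit of mild solutions for bounded potentials (`exists_limit`).

*Regularity.* The absorption rate `U p` is integrable over space-time, because the heat flow
preserves mass and hence no more than the initial mass can be absorbed. This gives the mild equation
for `p` (`IsApproxLimit.mild`) although `U` may grow arbitrarily fast. Near a point of space-time, a
cutoff splits the Duhamel term into a heat potential with a source away from the point, which is
smooth, and one with a continuous, compactly supported source. The spatial derivative of the heat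
kernel is integrable in space-time, which gives one derivative of `p`; then the source is
differentiable, which gives the second (`IsApproxLimit.exists_spatial_deriv`). Since the second
derivative is continuous, dividing the mild equation by the length of a short time step yields a
continuous right time derivative, hence a derivative and the Schrödinger equation
(`IsApproxLimit.hasDerivAt_time`).

*Normalization.* The exact posterior is the scheme divided by its integral, whatever the constants
in the likelihood; the integrals converge by domination by the heat flow of the prior. Positivity of
the limit comes from paths confined to a bounded interval (`limit_splitStep_pos`). A step of the
short-time evolution with the Gaussian prefactor agrees with `p` up to `o(ε)`
(`IsApproxLimit.isLittleO_shortTime`), so by positivity any other prefactor does so exactly when its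
relative deviation is `o(ε)` (`isLittleO_sub_mul_iff`).
-/

/-! ### The heat kernel -/

/-- The heat kernel of `D/2 ∂²` on space-time: the centred Gaussian density of variance `D σ` for
`σ > 0`, extended by zero to `σ ≤ 0`. -/
noncomputable def heatKernel (D σ z : ℝ) : ℝ :=
  if 0 < σ then (Real.sqrt (2 * Real.pi * D * σ))⁻¹ * Real.exp (-z ^ 2 / (2 * D * σ)) else 0

/-- The spatial derivative of `heatKernel`. -/
noncomputable def heatKernelDeriv (D σ z : ℝ) : ℝ := -z / (D * σ) * heatKernel D σ z

/-- The second spatial derivative of `heatKernel`. -/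
noncomputable def heatKernelDeriv2 (D σ z : ℝ) : ℝ :=
  (z ^ 2 / (D * σ) ^ 2 - 1 / (D * σ)) * heatKernel D σ z

lemma heatKernel_of_pos {D σ : ℝ} (hσ : 0 < σ) (z : ℝ) : heatKernel D σ z =
    (Real.sqrt (2 * Real.pi * D * σ))⁻¹ * Real.exp (-z ^ 2 / (2 * D * σ)) := if_pos hσ

lemma heatKernel_of_nonpos {D σ : ℝ} (hσ : σ ≤ 0) (z : ℝ) : heatKernel D σ z = 0 :=
  if_neg hσ.not_gt

lemma heatKernel_nonneg (D σ z : ℝ) : 0 ≤ heatKernel D σ z := by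
  unfold heatKernel
  split_ifs <;> positivity

lemma heatKernel_pos {D σ : ℝ} (hD : 0 < D) (hσ : 0 < σ) (z : ℝ) : 0 < heatKernel D σ z := by
  rw [heatKernel_of_pos hσ]
  positivity

lemma heatKernel_neg (D σ z : ℝ) : heatKernel D σ (-z) = heatKernel D σ z := by
  simp [heatKernel]

lemma heatKernel_le {D σ : ℝ} (hD : 0 < D) (z : ℝ) :
    heatKernel D σ z ≤ (Real.sqrt (2 * Real.pi * D * σ))⁻¹ := by
  unfold heatKernel
  split_ifs with h
  · refine mul_le_of_le_one_right (by positivity) (Real.exp_le_one_iff.2 ?_)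
    exact div_nonpos_of_nonpos_of_nonneg (by nlinarith [sq_nonneg z]) (by positivity)
  · positivity

@[fun_prop]
lemma measurable_heatKernel (D : ℝ) : Measurable (fun a : ℝ × ℝ => heatKernel D a.1 a.2) := by
  unfold heatKernel
  refine Measurable.ite (measurableSet_lt measurable_const measurable_fst) ?_ measurable_const
  fun_prop

@[fun_prop]
lemma measurable_heatKernelDeriv (D : ℝ) :
    Measurable (fun a : ℝ × ℝ => heatKernelDeriv D a.1 a.2) := by
  unfold heatKernelDeriv
  fun_prop

@[fun_prop]
lemma measurable_heatKernelDeriv2 (D : ℝ) :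
    Measurable (fun a : ℝ × ℝ => heatKernelDeriv2 D a.1 a.2) := by
  unfold heatKernelDeriv2
  fun_prop

lemma hasDerivAt_heatKernel {D : ℝ} (hD : 0 < D) (σ z : ℝ) :
    HasDerivAt (heatKernel D σ) (heatKernelDeriv D σ z) z := by
  rcases le_or_gt σ 0 with hσ | hσ
  · have : heatKernel D σ = fun _ => 0 := by ext y; exact heatKernel_of_nonpos hσ y
    simp only [heatKernelDeriv, this, mul_zero]
    exact hasDerivAt_const z 0
  · have h1 : HasDerivAt (fun y : ℝ => -y ^ 2 / (2 * D * σ)) (-z / (D * σ)) z := by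
      refine (((hasDerivAt_pow 2 z).neg).div_const (2 * D * σ)).congr_deriv ?_
      push_cast
      field_simp
    have h2 := (h1.exp).const_mul (Real.sqrt (2 * Real.pi * D * σ))⁻¹
    have : heatKernel D σ = fun y => (Real.sqrt (2 * Real.pi * D * σ))⁻¹ *
      Real.exp (-y ^ 2 / (2 * D * σ)) := by ext y; exact heatKernel_of_pos hσ y
    rw [heatKernelDeriv, this]
    refine h2.congr_deriv ?_
    ring

lemma hasDerivAt_heatKernelDeriv {D : ℝ} (hD : 0 < D) (σ z : ℝ) :
    HasDerivAt (heatKernelDeriv D σ) (heatKernelDeriv2 D σ z) z := by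
  have h1 : HasDerivAt (fun y : ℝ => -y / (D * σ)) (-1 / (D * σ)) z :=
    ((hasDerivAt_id z).neg).div_const (D * σ)
  have h2 := h1.mul (hasDerivAt_heatKernel hD σ z)
  have h3 : heatKernelDeriv D σ = (fun y : ℝ => -y / (D * σ)) * heatKernel D σ := rfl
  rw [h3]
  refine h2.congr_deriv ?_
  rw [heatKernelDeriv, heatKernelDeriv2]
  ring

lemma heatKernel_sub_eq_gaussianPDFReal {D σ : ℝ} (hσ : 0 < σ) (hD : 0 < D) (q y : ℝ) :
    heatKernel D σ (q - y) = ProbabilityTheory.gaussianPDFReal q (D * σ).toNNReal y := by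
  rw [heatKernel_of_pos hσ, ProbabilityTheory.gaussianPDFReal,
    Real.coe_toNNReal _ (by positivity)]
  rw [show 2 * Real.pi * (D * σ) = 2 * Real.pi * D * σ by ring,
    show 2 * (D * σ) = 2 * D * σ by ring, show (y - q) ^ 2 = (q - y) ^ 2 by ring]

lemma integrable_heatKernel_sub {D : ℝ} (hD : 0 < D) (σ q : ℝ) :
    Integrable (fun y => heatKernel D σ (q - y)) := by
  rcases le_or_gt σ 0 with hσ | hσ
  · simp [heatKernel_of_nonpos hσ]
  · simp only [heatKernel_sub_eq_gaussianPDFReal hσ hD]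
    exact ProbabilityTheory.integrable_gaussianPDFReal _ _

lemma integral_heatKernel_sub {D σ : ℝ} (hD : 0 < D) (hσ : 0 < σ) (q : ℝ) :
    ∫ y, heatKernel D σ (q - y) = 1 := by
  simp only [heatKernel_sub_eq_gaussianPDFReal hσ hD]
  exact ProbabilityTheory.integral_gaussianPDFReal_eq_one _ (by simp; positivity)

lemma integrable_heatKernel {D : ℝ} (hD : 0 < D) (σ : ℝ) : Integrable (heatKernel D σ) := by
  simpa [heatKernel_neg] using integrable_heatKernel_sub hD σ 0

lemma integral_heatKernel {D σ : ℝ} (hD : 0 < D) (hσ : 0 < σ) : ∫ z, heatKernel D σ z = 1 := by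
  simpa [heatKernel_neg] using integral_heatKernel_sub hD hσ 0

lemma pow_mul_exp_neg_sq_le {D σ : ℝ} (hD : 0 < D) (hσ : 0 < σ) (n : ℕ) (z : ℝ) :
    z ^ (2 * n) * Real.exp (-z ^ 2 / (2 * D * σ)) ≤ (n.factorial * (2 * D) ^ n) * σ ^ n := by
  have h := Real.pow_div_factorial_le_exp (x := z ^ 2 / (2 * D * σ)) (by positivity) n
  rw [div_le_iff₀ (by positivity), div_pow, div_le_iff₀ (by positivity)] at h
  rw [neg_div, Real.exp_neg, ← div_eq_mul_inv, div_le_iff₀ (Real.exp_pos _), pow_mul]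
  calc (z ^ 2) ^ n ≤ _ := h
    _ = _ := by rw [mul_pow (2 * D) σ]; ring

/-- On a bounded time interval the heat kernel times any even power of `z` is controlled by a
power of `σ`: away from `z = 0` it vanishes to all orders as `σ → 0`. -/
lemma exists_pow_mul_heatKernel_le {D : ℝ} (hD : 0 < D) (T : ℝ) (n : ℕ) :
    ∃ C, 0 ≤ C ∧ ∀ σ, 0 < σ → σ ≤ T → ∀ z, z ^ (2 * n) * heatKernel D σ z * σ ≤ C * σ ^ n := by
  refine ⟨Real.sqrt (2 * Real.pi * D * T) / (2 * Real.pi * D) * (n.factorial * (2 * D) ^ n),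
    by positivity, fun σ hσ hT z => ?_⟩
  have h0 := pow_mul_exp_neg_sq_le hD hσ n z
  have h1 : (Real.sqrt (2 * Real.pi * D * σ))⁻¹ * σ ≤
      Real.sqrt (2 * Real.pi * D * T) / (2 * Real.pi * D) := by
    rw [inv_mul_le_iff₀ (by positivity), mul_div_assoc', le_div_iff₀ (by positivity)]
    have h2 : Real.sqrt (2 * Real.pi * D * σ) * Real.sqrt (2 * Real.pi * D * σ) =
      2 * Real.pi * D * σ := Real.mul_self_sqrt (by positivity)
    have h3 : Real.sqrt (2 * Real.pi * D * σ) ≤ Real.sqrt (2 * Real.pi * D * T) := by gcongr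
    nlinarith [Real.sqrt_nonneg (2 * Real.pi * D * σ)]
  rw [heatKernel_of_pos hσ]
  calc _ = ((Real.sqrt (2 * Real.pi * D * σ))⁻¹ * σ) *
        (z ^ (2 * n) * Real.exp (-z ^ 2 / (2 * D * σ))) := by ring
    _ ≤ (Real.sqrt (2 * Real.pi * D * T) / (2 * Real.pi * D)) *
        ((n.factorial * (2 * D) ^ n) * σ ^ n) := by
        apply mul_le_mul h1 h0 _ (by positivity)
        rw [pow_mul]; positivity
    _ = _ := by ring

lemma exists_heatKernel_le_div_pow {D : ℝ} (hD : 0 < D) (T : ℝ) :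
    ∃ C, 0 ≤ C ∧ ∀ σ, σ ≤ T → ∀ z, z ≠ 0 → heatKernel D σ z ≤ C * |σ| / z ^ 4 := by
  obtain ⟨C, hC, h⟩ := exists_pow_mul_heatKernel_le hD T 2
  refine ⟨C, hC, fun σ hT z hz => ?_⟩
  rcases le_or_gt σ 0 with hσ | hσ
  · rw [heatKernel_of_nonpos hσ]; positivity
  · have := h σ hσ hT z
    rw [le_div_iff₀ (by positivity), abs_of_pos hσ]
    have h2 : (z ^ (2 * 2) * heatKernel D σ z) * σ ≤ (C * σ) * σ := by linarith
    have := le_of_mul_le_mul_right h2 hσ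
    rwa [mul_comm]

/-- Away from the spatial origin the heat kernel and its first two derivatives are `O(σ)`. -/
lemma exists_heatKernel_le_of_le_abs {D δ : ℝ} (hD : 0 < D) (hδ : 0 < δ) (T : ℝ) :
    ∃ C, 0 ≤ C ∧ ∀ σ, σ ≤ T → ∀ z, δ ≤ |z| → |heatKernel D σ z| ≤ C * |σ| ∧
      |heatKernelDeriv D σ z| ≤ C * |σ| ∧ |heatKernelDeriv2 D σ z| ≤ C * |σ| := by
  obtain ⟨C2, hC2, h2⟩ := exists_pow_mul_heatKernel_le hD T 2
  obtain ⟨C3, hC3, h3⟩ := exists_pow_mul_heatKernel_le hD T 3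
  obtain ⟨C4, hC4, h4⟩ := exists_pow_mul_heatKernel_le hD T 4
  have key : ∀ σ, 0 < σ → σ ≤ T → ∀ z, δ ≤ |z| →
      heatKernel D σ z ≤ C2 / δ ^ 4 * σ ∧ z ^ 2 * heatKernel D σ z ≤ C3 / δ ^ 4 * σ ^ 2 ∧
      z ^ 2 * heatKernel D σ z ≤ C4 / δ ^ 6 * σ ^ 3 ∧ heatKernel D σ z ≤ C3 / δ ^ 6 * σ ^ 2 := by
    intro σ hσ hT z hz
    have hz2 : ∀ n, δ ^ (2 * n) ≤ z ^ (2 * n) := fun n => by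
      rw [pow_mul z, ← sq_abs z, ← pow_mul]; gcongr
    have hK := heatKernel_nonneg D σ z
    have gen : ∀ (C : ℝ) (n m : ℕ) (X : ℝ), 0 ≤ X →
        z ^ (2 * n) * X * σ ≤ C * σ ^ (m + 1) → X ≤ C / δ ^ (2 * n) * σ ^ m := by
      intro C n m X hX h
      rw [div_mul_eq_mul_div, le_div_iff₀ (by positivity)]
      have h' : (X * δ ^ (2 * n)) * σ ≤ (C * σ ^ m) * σ := by
        calc _ ≤ (X * z ^ (2 * n)) * σ := 
            mul_le_mul_of_nonneg_right (mul_le_mul_of_nonneg_left (hz2 n) hX) hσ.le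
          _ = z ^ (2 * n) * X * σ := by ring
          _ ≤ _ := h
          _ = _ := by ring
      exact le_of_mul_le_mul_right h' hσ
    have hX : 0 ≤ z ^ 2 * heatKernel D σ z := by positivity
    refine ⟨?_, ?_, ?_, ?_⟩
    · simpa using gen C2 2 1 _ hK (h2 σ hσ hT z)
    · have := h3 σ hσ hT z
      exact gen C3 2 2 _ hX (by ring_nf at this ⊢; exact this)
    · have := h4 σ hσ hT z
      exact gen C4 3 3 _ hX (by ring_nf at this ⊢; exact this)
    · have := h3 σ hσ hT z
      exact gen C3 3 2 _ hK this
  refine ⟨C2 / δ ^ 4 + C3 / δ ^ 4 / (D * δ) + (C4 / δ ^ 6 / D ^ 2 + C3 / δ ^ 6 / D),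
    by positivity, fun σ hT z hz => ?_⟩
  rcases le_or_gt σ 0 with hσ | hσ
  · simp only [heatKernelDeriv, heatKernelDeriv2, heatKernel_of_nonpos hσ, mul_zero, abs_zero]
    have : 0 ≤ (C2 / δ ^ 4 + C3 / δ ^ 4 / (D * δ) + (C4 / δ ^ 6 / D ^ 2 + C3 / δ ^ 6 / D)) * |σ| := by
      positivity
    exact ⟨this, this, this⟩
  obtain ⟨k1, k2, k3, k4⟩ := key σ hσ hT z hz
  have hK := heatKernel_nonneg D σ z
  have hzp : 0 < |z| := hδ.trans_le hz
  rw [abs_of_pos hσ]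
  have e1 : 0 ≤ C2 / δ ^ 4 * σ := by positivity
  have e2 : 0 ≤ C3 / δ ^ 4 / (D * δ) * σ := by positivity
  have e3 : 0 ≤ C4 / δ ^ 6 / D ^ 2 * σ := by positivity
  have e4 : 0 ≤ C3 / δ ^ 6 / D * σ := by positivity
  refine ⟨?_, ?_, ?_⟩
  · rw [abs_of_nonneg hK]; linarith
  · rw [heatKernelDeriv, abs_mul, abs_div, abs_neg, abs_of_nonneg hK, abs_of_pos (by positivity :
      0 < D * σ)]
    have : |z| / (D * σ) * heatKernel D σ z ≤ C3 / δ ^ 4 / (D * δ) * σ := by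
      calc |z| / (D * σ) * heatKernel D σ z = δ * |z| * heatKernel D σ z / (D * δ * σ) := by
            field_simp
        _ ≤ |z| * |z| * heatKernel D σ z / (D * δ * σ) := by gcongr
        _ = z ^ 2 * heatKernel D σ z / (D * δ * σ) := by rw [abs_mul_abs_self]; ring
        _ ≤ C3 / δ ^ 4 * σ ^ 2 / (D * δ * σ) := by gcongr
        _ = _ := by field_simp
    linarith
  · rw [heatKernelDeriv2, sub_mul]
    refine (abs_sub _ _).trans ?_
    rw [abs_of_nonneg (by positivity), abs_of_nonneg (by positivity)]
    have f1 : z ^ 2 / (D * σ) ^ 2 * heatKernel D σ z ≤ C4 / δ ^ 6 / D ^ 2 * σ := by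
      calc _ = z ^ 2 * heatKernel D σ z / (D * σ) ^ 2 := by ring
        _ ≤ C4 / δ ^ 6 * σ ^ 3 / (D * σ) ^ 2 := by gcongr
        _ = _ := by field_simp
    have f2 : 1 / (D * σ) * heatKernel D σ z ≤ C3 / δ ^ 6 / D * σ := by
      calc _ = heatKernel D σ z / (D * σ) := by ring
        _ ≤ C3 / δ ^ 6 * σ ^ 2 / (D * σ) := by gcongr
        _ = _ := by field_simp
    linarith

/-- The heat kernel and its first two spatial derivatives are bounded away from the origin of
space-time, on bounded time intervals. -/
lemma exists_heatKernel_le_of_far {D δ : ℝ} (hD : 0 < D) (hδ : 0 < δ) (T : ℝ) :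
    ∃ C, 0 ≤ C ∧ ∀ σ, |σ| ≤ T → ∀ z, (δ ≤ |σ| ∨ δ ≤ |z|) → |heatKernel D σ z| ≤ C ∧
      |heatKernelDeriv D σ z| ≤ C ∧ |heatKernelDeriv2 D σ z| ≤ C := by
  obtain ⟨C1, hC1, h1⟩ := exists_heatKernel_le_of_le_abs hD one_pos T
  obtain ⟨C2, hC2, h2⟩ := exists_heatKernel_le_of_le_abs hD hδ T
  set A := (Real.sqrt (2 * Real.pi * D * δ))⁻¹ with hA
  have hA0 : 0 ≤ A := by positivity
  set B := 1 / (D * δ) + (1 / (D * δ) ^ 2 + 1 / (D * δ)) with hB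
  refine ⟨C1 * |T| + C2 * |T| + (1 + B) * A, by positivity, fun σ hT z hz => ?_⟩
  have hTT : |σ| ≤ |T| := hT.trans (le_abs_self T)
  have hBA : 0 ≤ B * A := by positivity
  have ht1 : C1 * |σ| ≤ C1 * |T| := by gcongr
  have ht2 : C2 * |σ| ≤ C2 * |T| := by gcongr
  have ht3 : 0 ≤ C1 * |T| := by positivity
  have ht4 : 0 ≤ C2 * |T| := by positivity
  have hσT : σ ≤ T := (le_abs_self σ).trans hT
  by_cases hz2 : δ ≤ |z|
  · obtain ⟨a, b, c⟩ := h2 σ hσT z hz2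
    exact ⟨by linarith, by linarith, by linarith⟩
  by_cases hz1 : 1 ≤ |z|
  · obtain ⟨a, b, c⟩ := h1 σ hσT z hz1
    exact ⟨by linarith, by linarith, by linarith⟩
  have hσδ : δ ≤ |σ| := hz.resolve_right hz2
  rcases le_or_gt σ 0 with hσ | hσ
  · simp only [heatKernelDeriv, heatKernelDeriv2, heatKernel_of_nonpos hσ, mul_zero, abs_zero]
    have : 0 ≤ C1 * |T| + C2 * |T| + (1 + B) * A := by positivity
    exact ⟨this, this, this⟩
  rw [abs_of_pos hσ] at hσδ
  have hK := heatKernel_nonneg D σ z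
  have hKA : heatKernel D σ z ≤ A := by
    refine (heatKernel_le hD z).trans ?_
    rw [hA]
    gcongr
  push Not at hz1
  have hDσ : 1 / (D * σ) ≤ 1 / (D * δ) := by gcongr
  have gen : ∀ c : ℝ, |c| ≤ B → |c * heatKernel D σ z| ≤ B * A := fun c hc => by
    rw [abs_mul, abs_of_nonneg hK]
    gcongr
  have b1 : |-z / (D * σ)| ≤ B := by
    rw [abs_div, abs_neg, abs_of_pos (by positivity : 0 < D * σ)]
    have : |z| / (D * σ) ≤ 1 / (D * σ) := by gcongr
    have : 0 ≤ 1 / (D * δ) ^ 2 + 1 / (D * δ) := by positivity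
    linarith
  have b2 : |z ^ 2 / (D * σ) ^ 2 - 1 / (D * σ)| ≤ B := by
    refine (abs_sub _ _).trans ?_
    rw [abs_of_nonneg (by positivity), abs_of_nonneg (by positivity)]
    have hz2 : z ^ 2 ≤ 1 := by rw [← sq_abs]; nlinarith [abs_nonneg z]
    have : z ^ 2 / (D * σ) ^ 2 ≤ 1 / (D * δ) ^ 2 := by gcongr
    have : 0 ≤ 1 / (D * δ) := by positivity
    linarith
  refine ⟨?_, ?_, ?_⟩
  · rw [abs_of_nonneg hK]; linarith
  · have := gen _ b1
    rw [heatKernelDeriv]; linarith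
  · have := gen _ b2
    rw [heatKernelDeriv2]; linarith

lemma continuousAt_heatKernel {D : ℝ} (hD : 0 < D) {a : ℝ × ℝ} (ha : a ≠ 0) :
    ContinuousAt (fun a : ℝ × ℝ => heatKernel D a.1 a.2) a ∧
    ContinuousAt (fun a : ℝ × ℝ => heatKernelDeriv D a.1 a.2) a ∧
    ContinuousAt (fun a : ℝ × ℝ => heatKernelDeriv2 D a.1 a.2) a := by
  obtain ⟨σ, z⟩ := a
  rcases lt_trichotomy σ 0 with hσ | rfl | hσ
  · have h0 : ∀ᶠ b : ℝ × ℝ in 𝓝 (σ, z), heatKernel D b.1 b.2 = 0 := by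
      have : ∀ᶠ b : ℝ × ℝ in 𝓝 (σ, z), b.1 < 0 :=
        continuous_fst.continuousAt.eventually_lt continuousAt_const hσ
      filter_upwards [this] with b hb using heatKernel_of_nonpos hb.le _
    refine ⟨?_, ?_, ?_⟩ <;>
    refine (continuousAt_const (y := (0 : ℝ))).congr ?_ <;>
    filter_upwards [h0] with b hb <;> simp [heatKernelDeriv, heatKernelDeriv2, hb]
  · have hz : z ≠ 0 := fun h => ha (by simp [h])
    obtain ⟨C, hC, h⟩ := exists_heatKernel_le_of_le_abs hD (half_pos (abs_pos.2 hz)) 1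
    have e1 : ∀ᶠ b : ℝ × ℝ in 𝓝 (0, z), b.1 ≤ 1 ∧ |z| / 2 ≤ |b.2| := by
      have i1 : ∀ᶠ b : ℝ × ℝ in 𝓝 (0, z), b.1 < 1 :=
        continuous_fst.continuousAt.eventually_lt continuousAt_const (by simp)
      have i2 : ∀ᶠ b : ℝ × ℝ in 𝓝 (0, z), |z| / 2 < |b.2| :=
        continuousAt_const.eventually_lt continuous_snd.abs.continuousAt (by simpa using hz)
      exact (i1.and i2).mono fun _ h => ⟨h.1.le, h.2.le⟩
    have lim : Tendsto (fun b : ℝ × ℝ => C * |b.1|) (𝓝 (0, z)) (𝓝 0) := by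
      have : Continuous (fun b : ℝ × ℝ => C * |b.1|) := by fun_prop
      simpa using this.tendsto (0, z)
    have z1 : heatKernel D 0 z = 0 := heatKernel_of_nonpos le_rfl z
    refine ⟨?_, ?_, ?_⟩
    · simp only [ContinuousAt, z1]
      refine squeeze_zero_norm' ?_ lim
      filter_upwards [e1] with b hb using (h b.1 hb.1 b.2 hb.2).1
    · simp only [ContinuousAt, heatKernelDeriv, z1, mul_zero]
      refine squeeze_zero_norm' ?_ lim
      filter_upwards [e1] with b hb using (h b.1 hb.1 b.2 hb.2).2.1
    · simp only [ContinuousAt, heatKernelDeriv2, z1, mul_zero]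
      refine squeeze_zero_norm' ?_ lim
      filter_upwards [e1] with b hb using (h b.1 hb.1 b.2 hb.2).2.2
  · have h0 : ContinuousAt (fun a : ℝ × ℝ => heatKernel D a.1 a.2) (σ, z) := by
      have : ∀ᶠ b : ℝ × ℝ in 𝓝 (σ, z), (Real.sqrt (2 * Real.pi * D * b.1))⁻¹ *
          Real.exp (-b.2 ^ 2 / (2 * D * b.1)) = heatKernel D b.1 b.2 := by
        filter_upwards [continuousAt_const.eventually_lt continuous_fst.continuousAt hσ] with b hb
        exact (heatKernel_of_pos hb _).symm
      refine ContinuousAt.congr ?_ this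
      have hs : Real.sqrt (2 * Real.pi * D * σ) ≠ 0 := by positivity
      have hs' : 2 * D * σ ≠ 0 := by positivity
      fun_prop (disch := assumption)
    have hs : D * σ ≠ 0 := by positivity
    have hs2 : (D * σ) ^ 2 ≠ 0 := by positivity
    refine ⟨h0, ?_, ?_⟩
    · unfold heatKernelDeriv
      refine ContinuousAt.mul ?_ h0
      fun_prop (disch := assumption)
    · unfold heatKernelDeriv2
      refine ContinuousAt.mul ?_ h0
      fun_prop (disch := assumption)

/-! ### The heat semigroup -/

/-- The law of a Wiener process with diffusion constant `D` at time one. -/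
noncomputable def wienerLaw (D : ℝ) : Measure ℝ := ProbabilityTheory.gaussianReal 0 D.toNNReal

instance (D : ℝ) : IsProbabilityMeasure (wienerLaw D) := by
  unfold wienerLaw; infer_instance

/-- The heat semigroup `exp(σ D/2 ∂²)`. Writing it as an average over one fixed Gaussian law makes
it the identity at `σ = 0` and displays its continuity in `σ` and `q`. -/
noncomputable def heat (D σ : ℝ) (h : ℝ → ℝ) (q : ℝ) : ℝ :=
  ∫ z, h (q + Real.sqrt σ * z) ∂(wienerLaw D)

/-- `h` is integrable against the heat kernel at every positive time. -/
def HeatIntegrable (D : ℝ) (h : ℝ → ℝ) : Prop :=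
  ∀ σ > 0, ∀ q, Integrable (fun z => h (q + Real.sqrt σ * z)) (wienerLaw D)

lemma wienerLaw_map_mul_const {D c : ℝ} (hD : 0 < D) (hc : 0 ≤ c) :
    (wienerLaw D).map (fun z => Real.sqrt c * z) =
      ProbabilityTheory.gaussianReal 0 (D * c).toNNReal := by
  rw [wienerLaw, ProbabilityTheory.gaussianReal_map_const_mul]
  congr 1
  · simp
  · ext
    rw [Real.coe_toNNReal _ (by positivity)]
    simp [Real.sq_sqrt hc, hD.le, mul_comm]

lemma wienerLaw_map {D σ : ℝ} (hD : 0 < D) (hσ : 0 ≤ σ) (q : ℝ) :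
    (wienerLaw D).map (fun z => q + Real.sqrt σ * z) =
      ProbabilityTheory.gaussianReal q (D * σ).toNNReal := by
  have : (fun z => q + Real.sqrt σ * z) = (fun y => q + y) ∘ (fun z => Real.sqrt σ * z) := rfl
  rw [this, ← Measure.map_map (by fun_prop) (by fun_prop), wienerLaw_map_mul_const hD hσ,
    ProbabilityTheory.gaussianReal_map_const_add, zero_add]

lemma measurableEmbedding_affine {σ : ℝ} (hσ : 0 < σ) (q : ℝ) :
    MeasurableEmbedding (fun z : ℝ => q + Real.sqrt σ * z) := by
  have : (fun z => q + Real.sqrt σ * z) = (fun y => q + y) ∘ (fun z => Real.sqrt σ * z) := rfl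
  rw [this]
  exact (measurableEmbedding_addLeft q).comp (measurableEmbedding_mulLeft₀ (by positivity))

lemma integrable_affine_iff {D σ : ℝ} (hD : 0 < D) (hσ : 0 < σ) (q : ℝ) (h : ℝ → ℝ) :
    Integrable (fun z => h (q + Real.sqrt σ * z)) (wienerLaw D) ↔
      Integrable h (ProbabilityTheory.gaussianReal q (D * σ).toNNReal) := by
  rw [← wienerLaw_map hD hσ.le q, (measurableEmbedding_affine hσ q).integrable_map_iff]
  rfl

lemma heat_eq_integral_gaussianReal {D σ : ℝ} (hD : 0 < D) (hσ : 0 < σ) (q : ℝ) (h : ℝ → ℝ) :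
    heat D σ h q = ∫ y, h y ∂(ProbabilityTheory.gaussianReal q (D * σ).toNNReal) := by
  rw [← wienerLaw_map hD hσ.le q, (measurableEmbedding_affine hσ q).integral_map]
  rfl

lemma heat_eq_integral {D σ : ℝ} (hD : 0 < D) (hσ : 0 < σ) (q : ℝ) (h : ℝ → ℝ) :
    heat D σ h q = ∫ y, heatKernel D σ (q - y) * h y := by
  rw [heat_eq_integral_gaussianReal hD hσ, ProbabilityTheory.integral_gaussianReal_eq_integral_smul
    (by simp; positivity)]
  simp only [heatKernel_sub_eq_gaussianPDFReal hσ hD, smul_eq_mul]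

lemma integrable_gaussianReal_iff {D σ : ℝ} (hD : 0 < D) (hσ : 0 < σ) (q : ℝ) (h : ℝ → ℝ) :
    Integrable h (ProbabilityTheory.gaussianReal q (D * σ).toNNReal) ↔
      Integrable (fun y => heatKernel D σ (q - y) * h y) := by
  rw [ProbabilityTheory.gaussianReal_of_var_ne_zero _ (by simp; positivity),
    integrable_withDensity_iff_integrable_smul' (ProbabilityTheory.measurable_gaussianPDF _ _)
      (ae_of_all _ fun _ => ProbabilityTheory.gaussianPDF_lt_top)]
  simp only [ProbabilityTheory.toReal_gaussianPDF, heatKernel_sub_eq_gaussianPDFReal hσ hD,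
    smul_eq_mul]

lemma HeatIntegrable.integrable_mul {D σ : ℝ} {h : ℝ → ℝ} (hh : HeatIntegrable D h) (hD : 0 < D)
    (hσ : 0 < σ) (q : ℝ) : Integrable (fun y => heatKernel D σ (q - y) * h y) :=
  (integrable_gaussianReal_iff hD hσ q h).1 ((integrable_affine_iff hD hσ q h).1 (hh σ hσ q))

lemma heatIntegrable_of_integrable {D : ℝ} {h : ℝ → ℝ} (hD : 0 < D) (hh : Integrable h) :
    HeatIntegrable D h := by
  intro σ hσ q
  rw [integrable_affine_iff hD hσ, integrable_gaussianReal_iff hD hσ]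
  refine hh.bdd_mul (c := (Real.sqrt (2 * Real.pi * D * σ))⁻¹) ?_ (ae_of_all _ fun y => ?_)
  · exact (integrable_heatKernel_sub hD σ q).aestronglyMeasurable
  · rw [Real.norm_of_nonneg (heatKernel_nonneg _ _ _)]
    exact heatKernel_le hD _

lemma integrable_affine_of_bounded {D C : ℝ} {h : ℝ → ℝ} (hc : Continuous h) (hb : ∀ y, |h y| ≤ C)
    (σ q : ℝ) : Integrable (fun z => h (q + Real.sqrt σ * z)) (wienerLaw D) := by
  refine Integrable.of_bound (C := C) ?_ (ae_of_all _ fun z => hb _)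
  exact (hc.comp (by fun_prop)).aestronglyMeasurable

lemma heatIntegrable_of_bounded {D C : ℝ} {h : ℝ → ℝ} (hc : Continuous h) (hb : ∀ y, |h y| ≤ C) :
    HeatIntegrable D h := fun σ _ q => integrable_affine_of_bounded hc hb σ q

lemma HeatIntegrable.sub {D : ℝ} {f g : ℝ → ℝ} (hf : HeatIntegrable D f)
    (hg : HeatIntegrable D g) : HeatIntegrable D (fun y => f y - g y) :=
  fun σ hσ q => (hf σ hσ q).sub (hg σ hσ q)

lemma HeatIntegrable.abs {D : ℝ} {f : ℝ → ℝ} (hf : HeatIntegrable D f) :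
    HeatIntegrable D (fun y => |f y|) := fun σ hσ q => (hf σ hσ q).abs

lemma HeatIntegrable.const_mul {D : ℝ} {f : ℝ → ℝ} (hf : HeatIntegrable D f) (c : ℝ) :
    HeatIntegrable D (fun y => c * f y) := fun σ hσ q => (hf σ hσ q).const_mul c

@[simp]
lemma heat_zero (D : ℝ) (h : ℝ → ℝ) : heat D 0 h = h := by
  ext q
  simp [heat]

lemma heat_nonneg {D σ : ℝ} {h : ℝ → ℝ} (hh : ∀ y, 0 ≤ h y) (q : ℝ) : 0 ≤ heat D σ h q :=
  integral_nonneg fun _ => hh _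

lemma heat_mono {D σ : ℝ} {f g : ℝ → ℝ} (hσ : 0 < σ) (hf : HeatIntegrable D f)
    (hg : HeatIntegrable D g) (h : ∀ y, f y ≤ g y) (q : ℝ) : heat D σ f q ≤ heat D σ g q :=
  integral_mono (hf σ hσ q) (hg σ hσ q) fun _ => h _

lemma heat_sub {D σ : ℝ} {f g : ℝ → ℝ} (hσ : 0 < σ) (hf : HeatIntegrable D f)
    (hg : HeatIntegrable D g) (q : ℝ) :
    heat D σ (fun y => f y - g y) q = heat D σ f q - heat D σ g q :=
  integral_sub (hf σ hσ q) (hg σ hσ q)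

lemma heat_const_mul (D σ c : ℝ) (f : ℝ → ℝ) (q : ℝ) :
    heat D σ (fun y => c * f y) q = c * heat D σ f q := integral_const_mul _ _

lemma abs_heat_le (D σ : ℝ) (h : ℝ → ℝ) (q : ℝ) :
    |heat D σ h q| ≤ heat D σ (fun y => |h y|) q := abs_integral_le_integral_abs

lemma abs_heat_le_of_bounded {D σ C : ℝ} {h : ℝ → ℝ} (hb : ∀ y, |h y| ≤ C) (q : ℝ) :
    |heat D σ h q| ≤ C := by
  have := norm_integral_le_of_norm_le_const (μ := wienerLaw D) (C := C)
    (f := fun z => h (q + Real.sqrt σ * z)) (ae_of_all _ fun z => hb _)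
  simpa [heat] using this

lemma abs_heat_le_integral {D σ : ℝ} {h : ℝ → ℝ} (hD : 0 < D) (hσ : 0 < σ) (hh : Integrable h)
    (q : ℝ) : |heat D σ h q| ≤ (Real.sqrt (2 * Real.pi * D * σ))⁻¹ * ∫ y, |h y| := by
  rw [heat_eq_integral hD hσ, ← integral_const_mul]
  refine abs_integral_le_integral_abs.trans ?_
  refine integral_mono ((heatIntegrable_of_integrable hD hh).integrable_mul hD hσ q).abs
    (hh.abs.const_mul _) fun y => ?_
  simp only [abs_mul, abs_of_nonneg (heatKernel_nonneg _ _ _)]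
  gcongr
  exact heatKernel_le hD _

/-- Chapman–Kolmogorov. -/
lemma heat_heat {D s t : ℝ} (hD : 0 < D) (hs : 0 ≤ s) (ht : 0 ≤ t) {h : ℝ → ℝ}
    (hh : HeatIntegrable D h) (q : ℝ) : heat D s (heat D t h) q = heat D (s + t) h q := by
  rcases hs.eq_or_lt with rfl | hs
  · simp
  rcases ht.eq_or_lt with rfl | ht
  · simp
  have hst : 0 < s + t := by positivity
  have hmap : ((wienerLaw D).prod (wienerLaw D)).map
      (fun a : ℝ × ℝ => q + Real.sqrt s * a.1 + Real.sqrt t * a.2) =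
      ProbabilityTheory.gaussianReal q (D * (s + t)).toNNReal := by
    have e : (fun a : ℝ × ℝ => q + Real.sqrt s * a.1 + Real.sqrt t * a.2) =
      (fun a : ℝ × ℝ => a.1 + a.2) ∘
        (Prod.map (fun z => q + Real.sqrt s * z) (fun z => 0 + Real.sqrt t * z)) := by
      ext a; simp
    rw [e, ← Measure.map_map (by fun_prop) (by fun_prop),
      ← Measure.map_prod_map _ _ (by fun_prop) (by fun_prop), wienerLaw_map hD hs.le,
      wienerLaw_map hD ht.le]
    change Measure.conv _ _ = _
    rw [ProbabilityTheory.gaussianReal_conv_gaussianReal, add_zero, mul_add,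
      Real.toNNReal_add (by positivity) (by positivity)]
  have hint : Integrable h (ProbabilityTheory.gaussianReal q (D * (s + t)).toNNReal) :=
    (integrable_affine_iff hD hst q h).1 (hh _ hst q)
  rw [heat_eq_integral_gaussianReal hD hst, ← hmap, integral_map (by fun_prop)
    (by rw [hmap]; exact hint.aestronglyMeasurable), integral_prod]
  · rfl
  · rw [← hmap] at hint
    exact hint.comp_measurable (by fun_prop)

lemma heat_eq_convolution {D σ : ℝ} (hD : 0 < D) (hσ : 0 < σ) (h : ℝ → ℝ) :
    heat D σ h = MeasureTheory.convolution h (heatKernel D σ) (ContinuousLinearMap.mul ℝ ℝ)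
      volume := by
  ext q
  rw [heat_eq_integral hD hσ]
  simp [MeasureTheory.convolution, mul_comm]

lemma integrable_heat {D σ : ℝ} (hD : 0 < D) (hσ : 0 ≤ σ) {h : ℝ → ℝ} (hh : Integrable h) :
    Integrable (heat D σ h) := by
  rcases hσ.eq_or_lt with rfl | hσ
  · simpa
  rw [heat_eq_convolution hD hσ]
  exact hh.integrable_convolution _ (integrable_heatKernel hD σ)

lemma heat_pos {D σ : ℝ} (hD : 0 < D) (hσ : 0 < σ) {h : ℝ → ℝ} (hh : Integrable h)
    (h0 : ∀ y, 0 ≤ h y) (h1 : 0 < ∫ y, h y) (q : ℝ) : 0 < heat D σ h q := by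
  rw [heat_eq_integral hD hσ, integral_pos_iff_support_of_nonneg
    (fun y => mul_nonneg (heatKernel_nonneg _ _ _) (h0 y))
    ((heatIntegrable_of_integrable hD hh).integrable_mul hD hσ q)]
  rw [integral_pos_iff_support_of_nonneg h0 hh] at h1
  convert h1 using 2
  ext y
  simp [(heatKernel_pos hD hσ _).ne']

lemma integrable_exp_affine (D a q : ℝ) :
    Integrable (fun z => Real.exp (q + a * z)) (wienerLaw D) := by
  simp only [Real.exp_add]
  exact (ProbabilityTheory.integrable_exp_mul_gaussianReal a).const_mul _

lemma integral_exp_affine {D : ℝ} (hD : 0 < D) (a q : ℝ) :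
    ∫ z, Real.exp (q + a * z) ∂(wienerLaw D) = Real.exp (D * a ^ 2 / 2) * Real.exp q := by
  simp only [Real.exp_add, integral_const_mul]
  have := congrFun (ProbabilityTheory.mgf_fun_id_gaussianReal (μ := 0) (v := D.toNNReal)) a
  simp only [ProbabilityTheory.mgf] at this
  rw [wienerLaw, this, Real.coe_toNNReal _ hD.le]
  ring_nf

lemma heatIntegrable_cosh (D : ℝ) : HeatIntegrable D Real.cosh := by
  intro σ _ q
  have e : (fun z => Real.cosh (q + Real.sqrt σ * z)) = fun z => (Real.exp (q + Real.sqrt σ * z) +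
      Real.exp (-q + -Real.sqrt σ * z)) / 2 := by
    ext z
    rw [Real.cosh_eq]
    ring_nf
  rw [e]
  exact ((integrable_exp_affine D _ _).add (integrable_exp_affine D _ _)).div_const 2

/-- `cosh` is an eigenfunction of the heat semigroup. -/
lemma heat_cosh {D σ : ℝ} (hD : 0 < D) (hσ : 0 ≤ σ) (q : ℝ) :
    heat D σ Real.cosh q = Real.exp (D * σ / 2) * Real.cosh q := by
  have e : ∀ z, Real.cosh (q + Real.sqrt σ * z) = (Real.exp (q + Real.sqrt σ * z) +
      Real.exp (-q + -Real.sqrt σ * z)) / 2 := by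
    intro z
    rw [Real.cosh_eq]
    ring_nf
  simp only [heat, e]
  rw [integral_div, integral_add (integrable_exp_affine D _ _) (integrable_exp_affine D _ _),
    integral_exp_affine hD, integral_exp_affine hD, Real.cosh_eq, neg_sq, Real.sq_sqrt hσ]
  ring

lemma integrable_sq_wienerLaw (D : ℝ) : Integrable (fun z => z ^ 2) (wienerLaw D) :=
  (ProbabilityTheory.memLp_id_gaussianReal 2).integrable_sq

lemma integrable_id_wienerLaw (D : ℝ) : Integrable (fun z => z) (wienerLaw D) :=
  (ProbabilityTheory.memLp_id_gaussianReal 1).integrable le_rfl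

lemma integral_id_wienerLaw (D : ℝ) : ∫ z, z ∂(wienerLaw D) = 0 :=
  ProbabilityTheory.integral_id_gaussianReal

lemma integral_sq_wienerLaw {D : ℝ} (hD : 0 < D) : ∫ z, z ^ 2 ∂(wienerLaw D) = D := by
  have h := ProbabilityTheory.variance_fun_id_gaussianReal (μ := 0) (v := D.toNNReal)
  rw [ProbabilityTheory.variance_eq_integral (by fun_prop),
    ProbabilityTheory.integral_id_gaussianReal, Real.coe_toNNReal _ hD.le] at h
  simpa [wienerLaw] using h

/-! ### Space-time heat potentials -/

lemma continuous_heatKernelDeriv_right {D : ℝ} (hD : 0 < D) (σ : ℝ) :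
    Continuous (heatKernelDeriv D σ) :=
  continuous_iff_continuousAt.2 fun z => (hasDerivAt_heatKernelDeriv hD σ z).continuousAt

lemma integral_abs_heatKernelDeriv_le {D σ : ℝ} (hD : 0 < D) (hσ : 0 < σ) :
    Integrable (heatKernelDeriv D σ) ∧
    ∫ z, |heatKernelDeriv D σ z| = (∫ z, |z| ∂(wienerLaw D)) / D * σ ^ (-(1 / 2) : ℝ) := by
  have e : ∀ z, |heatKernelDeriv D σ z| = (D * σ)⁻¹ * (heatKernel D σ (0 - z) * |z|) := by
    intro z
    rw [heatKernelDeriv, abs_mul, abs_of_nonneg (heatKernel_nonneg _ _ _), abs_div, abs_neg,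
      abs_of_pos (by positivity : 0 < D * σ), zero_sub, heatKernel_neg]
    ring
  have h1 : HeatIntegrable D (fun z => |z|) := by
    intro s hs q
    exact ((integrable_const q).add ((integrable_id_wienerLaw D).const_mul _)).abs
  have h2 := h1.integrable_mul hD hσ 0
  constructor
  · refine (integrable_norm_iff ?_).1 ?_
    · exact (continuous_heatKernelDeriv_right hD σ).aestronglyMeasurable
    · simp only [Real.norm_eq_abs, e]
      exact h2.const_mul _
  · simp only [e]
    rw [integral_const_mul, ← heat_eq_integral hD hσ, heat]
    simp only [zero_add, abs_mul, abs_of_nonneg (Real.sqrt_nonneg σ)]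
    rw [integral_const_mul, Real.rpow_neg hσ.le, ← Real.sqrt_eq_rpow]
    have : Real.sqrt σ * Real.sqrt σ = σ := Real.mul_self_sqrt hσ.le
    have h3 : Real.sqrt σ ≠ 0 := by positivity
    field_simp
    rw [sq, this]

lemma locallyIntegrable_of_integrableOn_slab {f : ℝ × ℝ → ℝ}
    (h0 : ∀ σ ≤ 0, ∀ z, f (σ, z) = 0)
    (h : ∀ T, 0 < T → IntegrableOn f (Set.Ioc 0 T ×ˢ Set.univ)) : LocallyIntegrable f := by
  rw [locallyIntegrable_iff]
  intro S hS
  obtain ⟨R, hR0, hR⟩ := hS.isBounded.exists_pos_norm_le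
  have h1 : IntegrableOn f (Set.Iic 0 ×ˢ Set.univ) := by
    refine integrableOn_zero.congr_fun ?_ (measurableSet_Iic.prod MeasurableSet.univ)
    rintro ⟨σ, z⟩ ⟨hσ, _⟩
    exact (h0 σ hσ z).symm
  refine (h1.union (h R hR0)).mono_set ?_
  rintro ⟨σ, z⟩ hb
  have : |σ| ≤ R := (norm_fst_le _).trans (hR _ hb)
  rcases le_or_gt σ 0 with hσ | hσ
  · exact Or.inl ⟨hσ, trivial⟩
  · exact Or.inr ⟨⟨hσ, (le_abs_self σ).trans this⟩, trivial⟩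

lemma integrableOn_heatKernel_slab {D : ℝ} (hD : 0 < D) (T : ℝ) :
    IntegrableOn (fun a : ℝ × ℝ => heatKernel D a.1 a.2) (Set.Ioc 0 T ×ˢ Set.univ) := by
  rw [IntegrableOn, Measure.volume_eq_prod, ← Measure.prod_restrict, Measure.restrict_univ,
    integrable_prod_iff (by fun_prop)]
  refine ⟨ae_of_all _ fun σ => integrable_heatKernel hD σ, ?_⟩
  refine (integrableOn_const (C := (1 : ℝ)) (by simp)).congr_fun ?_ measurableSet_Ioc
  intro σ hσ
  simp only [Real.norm_of_nonneg (heatKernel_nonneg _ _ _)]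
  exact (integral_heatKernel hD hσ.1).symm

lemma integrableOn_heatKernelDeriv_slab {D : ℝ} (hD : 0 < D) (T : ℝ) :
    IntegrableOn (fun a : ℝ × ℝ => heatKernelDeriv D a.1 a.2) (Set.Ioc 0 T ×ˢ Set.univ) := by
  rw [IntegrableOn, Measure.volume_eq_prod, ← Measure.prod_restrict, Measure.restrict_univ,
    integrable_prod_iff (by fun_prop)]
  constructor
  · filter_upwards [ae_restrict_mem measurableSet_Ioc] with σ hσ
    exact (integral_abs_heatKernelDeriv_le hD hσ.1).1
  · have := (intervalIntegral.intervalIntegrable_rpow' (a := 0) (b := T)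
      (r := -(1 / 2)) (by norm_num)).1.const_mul ((∫ z, |z| ∂(wienerLaw D)) / D)
    refine IntegrableOn.congr_fun this ?_ measurableSet_Ioc
    intro σ hσ
    exact (integral_abs_heatKernelDeriv_le hD hσ.1).2.symm

lemma locallyIntegrable_heatKernel {D : ℝ} (hD : 0 < D) :
    LocallyIntegrable (fun a : ℝ × ℝ => heatKernel D a.1 a.2) :=
  locallyIntegrable_of_integrableOn_slab (fun _ hσ z => heatKernel_of_nonpos hσ z)
    fun T _ => integrableOn_heatKernel_slab hD T

lemma locallyIntegrable_heatKernelDeriv {D : ℝ} (hD : 0 < D) :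
    LocallyIntegrable (fun a : ℝ × ℝ => heatKernelDeriv D a.1 a.2) :=
  locallyIntegrable_of_integrableOn_slab
    (fun _ hσ z => by simp [heatKernelDeriv, heatKernel_of_nonpos hσ z])
    fun T _ => integrableOn_heatKernelDeriv_slab hD T

lemma locallyIntegrable_norm {k : ℝ × ℝ → ℝ} (hk : LocallyIntegrable k) :
    LocallyIntegrable (fun a => ‖k a‖) := fun x =>
  let ⟨s, hs, h⟩ := hk x
  ⟨s, hs, h.norm⟩

/-- The space-time convolution `k ⋆ F`. -/
noncomputable def spaceTimeConv (k F : ℝ × ℝ → ℝ) (a : ℝ × ℝ) : ℝ := ∫ b, k b * F (a - b)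

lemma spaceTimeConv_eq_convolution (k F : ℝ × ℝ → ℝ) : spaceTimeConv k F =
    MeasureTheory.convolution k F (ContinuousLinearMap.mul ℝ ℝ) volume := rfl

lemma spaceTimeConv_eq_swap (k F : ℝ × ℝ → ℝ) (a : ℝ × ℝ) :
    spaceTimeConv k F a = ∫ b, k (a - b) * F b := by
  rw [spaceTimeConv, ← integral_sub_left_eq_self _ volume a]
  simp

lemma continuous_spaceTimeConv {k F : ℝ × ℝ → ℝ} (hk : LocallyIntegrable k) (hF : Continuous F)
    (hFc : HasCompactSupport F) : Continuous (spaceTimeConv k F) := by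
  rw [spaceTimeConv_eq_convolution]
  exact hFc.continuous_convolution_right _ hk hF

lemma integrable_spaceTimeConv {k F : ℝ × ℝ → ℝ} (hk : LocallyIntegrable k) (hF : Continuous F)
    (hFc : HasCompactSupport F) (a : ℝ × ℝ) : Integrable (fun b => k b * F (a - b)) :=
  (hFc.convolutionExists_right (ContinuousLinearMap.mul ℝ ℝ) hk hF) a

lemma integrable_spaceTimeConv_swap {k F : ℝ × ℝ → ℝ} (hk : LocallyIntegrable k)
    (hF : Continuous F) (hFc : HasCompactSupport F) (a : ℝ × ℝ) :
    Integrable (fun b => k (a - b) * F b) := by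
  simpa using (integrable_spaceTimeConv hk hF hFc a).comp_sub_left a

lemma hasDerivAt_of_forall_sub_eq_integral {f g : ℝ → ℝ} (hg : Continuous g)
    (h : ∀ y, f y - f 0 = ∫ s in (0 : ℝ)..y, g s) (q : ℝ) : HasDerivAt f (g q) q := by
  have e : f = fun y => (∫ s in (0 : ℝ)..y, g s) + f 0 := by
    ext y; rw [← h y]; ring
  rw [e]
  exact ((hg.integral_hasStrictDerivAt 0 q).hasDerivAt).add_const _

/-- The heat potential of a continuous density is differentiable in space: the singularity of
`∂K` is integrable in space-time. -/
lemma hasDerivAt_heatPotential {D : ℝ} (hD : 0 < D) {F : ℝ × ℝ → ℝ} (hF : Continuous F)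
    (hFc : HasCompactSupport F) (t q : ℝ) :
    HasDerivAt (fun y => spaceTimeConv (fun a => heatKernel D a.1 a.2) F (t, y))
      (spaceTimeConv (fun a => heatKernelDeriv D a.1 a.2) F (t, q)) q := by
  have l0 := locallyIntegrable_heatKernel hD
  have l1 := locallyIntegrable_heatKernelDeriv hD
  refine hasDerivAt_of_forall_sub_eq_integral (g := fun y =>
    spaceTimeConv (fun a => heatKernelDeriv D a.1 a.2) F (t, y))
    ((continuous_spaceTimeConv l1 hF hFc).comp (by fun_prop)) (fun q' => ?_) q
  have hi : Integrable (Function.uncurry fun (y : ℝ) (b : ℝ × ℝ) =>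
      heatKernelDeriv D (t - b.1) (y - b.2) * F b)
      ((volume.restrict (Set.uIoc 0 q')).prod volume) := by
    rw [integrable_prod_iff]
    · refine ⟨ae_of_all _ fun y => integrable_spaceTimeConv_swap l1 hF hFc (t, y), ?_⟩
      have hc : Continuous (fun y => spaceTimeConv (fun a => ‖heatKernelDeriv D a.1 a.2‖)
          (fun a => ‖F a‖) (t, y)) :=
        (continuous_spaceTimeConv (locallyIntegrable_norm l1) hF.norm hFc.norm).comp (by fun_prop)
      have := (hc.intervalIntegrable (μ := volume) 0 q').def'
      simp only [spaceTimeConv_eq_swap, IntegrableOn] at this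
      simpa [Function.uncurry] using this
    · refine Measurable.aestronglyMeasurable ?_
      refine Measurable.mul ?_ (hF.measurable.comp measurable_snd)
      exact (measurable_heatKernelDeriv D).comp
        (f := fun a : ℝ × (ℝ × ℝ) => (t - a.2.1, a.1 - a.2.2)) (by fun_prop)
  simp only [spaceTimeConv_eq_swap, Prod.fst_sub, Prod.snd_sub]
  rw [intervalIntegral_integral_swap hi, ← integral_sub
    (by simpa using integrable_spaceTimeConv_swap l0 hF hFc (t, q'))
    (by simpa using integrable_spaceTimeConv_swap l0 hF hFc (t, 0))]
  refine integral_congr_ae (ae_of_all _ fun b => ?_)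
  simp only [intervalIntegral.integral_mul_const, ← sub_mul]
  congr 1
  rw [intervalIntegral.integral_comp_sub_right (fun y => heatKernelDeriv D (t - b.1) y)]
  exact (intervalIntegral.integral_eq_sub_of_hasDerivAt (fun y _ => hasDerivAt_heatKernel hD _ y)
    ((continuous_heatKernelDeriv_right hD _).intervalIntegrable _ _)).symm

/-- If the density is itself differentiable in space, the derivative may fall on it. -/
lemma hasDerivAt_spaceTimeConv {k F F1 : ℝ × ℝ → ℝ} (hk : LocallyIntegrable k)
    (hkm : Measurable k) (hF : Continuous F) (hFc : HasCompactSupport F) (hF1 : Continuous F1)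
    (hF1c : HasCompactSupport F1) (hd : ∀ r y, HasDerivAt (fun y => F (r, y)) (F1 (r, y)) y)
    (t q : ℝ) :
    HasDerivAt (fun y => spaceTimeConv k F (t, y)) (spaceTimeConv k F1 (t, q)) q := by
  refine hasDerivAt_of_forall_sub_eq_integral (g := fun y => spaceTimeConv k F1 (t, y))
    ((continuous_spaceTimeConv hk hF1 hF1c).comp (by fun_prop)) (fun q' => ?_) q
  have hi : Integrable (Function.uncurry fun (y : ℝ) (b : ℝ × ℝ) => k b * F1 ((t, y) - b))
      ((volume.restrict (Set.uIoc 0 q')).prod volume) := by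
    rw [integrable_prod_iff]
    · refine ⟨ae_of_all _ fun y => integrable_spaceTimeConv hk hF1 hF1c (t, y), ?_⟩
      have hc : Continuous (fun y => spaceTimeConv (fun a => ‖k a‖) (fun a => ‖F1 a‖) (t, y)) :=
        (continuous_spaceTimeConv (locallyIntegrable_norm hk) hF1.norm hF1c.norm).comp (by fun_prop)
      have := (hc.intervalIntegrable (μ := volume) 0 q').def'
      simp only [spaceTimeConv, IntegrableOn] at this
      simpa [Function.uncurry] using this
    · refine Measurable.aestronglyMeasurable ?_
      exact (hkm.comp measurable_snd).mul (hF1.measurable.comp (by fun_prop))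
  simp only [spaceTimeConv]
  rw [intervalIntegral_integral_swap hi, ← integral_sub
    (integrable_spaceTimeConv hk hF hFc (t, q')) (integrable_spaceTimeConv hk hF hFc (t, 0))]
  refine integral_congr_ae (ae_of_all _ fun b => ?_)
  simp only [intervalIntegral.integral_const_mul, ← mul_sub]
  congr 1
  have hd' : ∀ y, HasDerivAt (fun y => F ((t, y) - b)) (F1 ((t, y) - b)) y := fun y =>
    (hd (t - b.1) (y - b.2)).comp_sub_const y b.2
  exact (intervalIntegral.integral_eq_sub_of_hasDerivAt (fun y _ => hd' y)
    ((hF1.comp (by fun_prop)).intervalIntegrable _ _)).symm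

/-- The `i`-th spatial derivative of `heatKernel` for `i = 0, 1, 2`; larger `i` are not used and
repeat the second derivative. -/
noncomputable def heatKernelIter (D : ℝ) : ℕ → ℝ → ℝ → ℝ
  | 0 => heatKernel D
  | 1 => heatKernelDeriv D
  | _ => heatKernelDeriv2 D

lemma hasDerivAt_heatKernelIter {D : ℝ} (hD : 0 < D) {i : ℕ} (hi : i < 2) (σ z : ℝ) :
    HasDerivAt (heatKernelIter D i σ) (heatKernelIter D (i + 1) σ z) z := by
  interval_cases i
  · exact hasDerivAt_heatKernel hD σ z
  · exact hasDerivAt_heatKernelDeriv hD σ z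

lemma measurable_heatKernelIter (D : ℝ) (i : ℕ) :
    Measurable (fun a : ℝ × ℝ => heatKernelIter D i a.1 a.2) := by
  match i with
  | 0 => exact measurable_heatKernel D
  | 1 => exact measurable_heatKernelDeriv D
  | _ + 2 => exact measurable_heatKernelDeriv2 D

lemma continuousAt_heatKernelIter {D : ℝ} (hD : 0 < D) (i : ℕ) {a : ℝ × ℝ} (ha : a ≠ 0) :
    ContinuousAt (fun a : ℝ × ℝ => heatKernelIter D i a.1 a.2) a := by
  match i with
  | 0 => exact (continuousAt_heatKernel hD ha).1
  | 1 => exact (continuousAt_heatKernel hD ha).2.1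
  | _ + 2 => exact (continuousAt_heatKernel hD ha).2.2

lemma exists_heatKernelIter_le_of_far {D δ : ℝ} (hD : 0 < D) (hδ : 0 < δ) (T : ℝ) :
    ∃ C, 0 ≤ C ∧ ∀ i σ, |σ| ≤ T → ∀ z, (δ ≤ |σ| ∨ δ ≤ |z|) → |heatKernelIter D i σ z| ≤ C := by
  obtain ⟨C, hC, h⟩ := exists_heatKernel_le_of_far hD hδ T
  refine ⟨C, hC, fun i σ hσ z hz => ?_⟩
  match i with
  | 0 => exact (h σ hσ z hz).1
  | 1 => exact (h σ hσ z hz).2.1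
  | _ + 2 => exact (h σ hσ z hz).2.2

/-- The heat potential of an integrable density `g` carried by the space-time points
`(r ω, y ω)`, with `i` spatial derivatives on the kernel. -/
noncomputable def farPotential {Ω : Type*} [MeasurableSpace Ω] (D : ℝ) (μ : Measure Ω)
    (r y g : Ω → ℝ) (i : ℕ) (t q : ℝ) : ℝ :=
  ∫ ω, heatKernelIter D i (t - r ω) (q - y ω) * g ω ∂μ

/-- A heat potential is twice continuously differentiable in space near every point which is
separated from the support of its density. -/
lemma farPotential_regular {Ω : Type*} [MeasurableSpace Ω] {D : ℝ} (hD : 0 < D) {μ : Measure Ω}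
    {r y g : Ω → ℝ} (hr : Measurable r) (hy : Measurable y) (hg : Integrable g μ) {t₀ q₀ δ T : ℝ}
    (hδ : 0 < δ) (hrT : ∀ ω, g ω ≠ 0 → |r ω| ≤ T)
    (hfar : ∀ ω, g ω ≠ 0 → 2 * δ ≤ |t₀ - r ω| ∨ 2 * δ ≤ |q₀ - y ω|) {t q : ℝ}
    (ht : |t - t₀| < δ) (hq : |q - q₀| < δ) :
    (∀ i, ContinuousAt (fun a : ℝ × ℝ => farPotential D μ r y g i a.1 a.2) (t, q)) ∧
    ∀ i < 2, HasDerivAt (farPotential D μ r y g i t) (farPotential D μ r y g (i + 1) t q) q := by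
  obtain ⟨C, hC, hb⟩ := exists_heatKernelIter_le_of_far hD hδ (|t₀| + δ + T)
  have hsep : ∀ ω, g ω ≠ 0 → ∀ s z, |s - t₀| < δ → |z - q₀| < δ →
      (δ ≤ |s - r ω| ∨ δ ≤ |z - y ω|) := by
    intro ω hω s z hs hz
    rcases hfar ω hω with h | h
    · left
      have := abs_sub_le t₀ s (r ω)
      rw [abs_sub_comm t₀ s] at this
      linarith
    · right
      have := abs_sub_le q₀ z (y ω)
      rw [abs_sub_comm q₀ z] at this
      linarith
  have hbound : ∀ i ω s z, |s - t₀| < δ → |z - q₀| < δ →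
      ‖heatKernelIter D i (s - r ω) (z - y ω) * g ω‖ ≤ C * ‖g ω‖ := by
    intro i ω s z hs hz
    by_cases hω : g ω = 0
    · simp [hω]
    rw [norm_mul]
    gcongr
    refine hb i _ ?_ _ (hsep ω hω s z hs hz)
    have h1 := abs_sub_le s t₀ (r ω)
    have h2 := abs_sub t₀ (r ω)
    have h3 := hrT ω hω
    linarith
  have hmeas : ∀ i s z, AEStronglyMeasurable
      (fun ω => heatKernelIter D i (s - r ω) (z - y ω) * g ω) μ := by
    intro i s z
    refine (Measurable.aestronglyMeasurable ?_).mul hg.aestronglyMeasurable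
    exact (measurable_heatKernelIter D i).comp (f := fun ω => (s - r ω, z - y ω)) (by fun_prop)
  refine ⟨fun i => ?_, fun i hi => ?_⟩
  · refine continuousAt_of_dominated (bound := fun ω => C * ‖g ω‖)
      (Eventually.of_forall fun a => hmeas i _ _) ?_ (hg.norm.const_mul C)
      (ae_of_all _ fun ω => ?_)
    · have e1 : ∀ᶠ a : ℝ × ℝ in 𝓝 (t, q), |a.1 - t₀| < δ := by
        have : Continuous (fun a : ℝ × ℝ => |a.1 - t₀|) := by fun_prop
        exact this.continuousAt.eventually_lt continuousAt_const ht
      have e2 : ∀ᶠ a : ℝ × ℝ in 𝓝 (t, q), |a.2 - q₀| < δ := by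
        have : Continuous (fun a : ℝ × ℝ => |a.2 - q₀|) := by fun_prop
        exact this.continuousAt.eventually_lt continuousAt_const hq
      filter_upwards [e1, e2] with a h1 h2
      exact ae_of_all _ fun ω => hbound i ω _ _ h1 h2
    · by_cases hω : g ω = 0
      · simp only [hω, mul_zero]
        exact continuousAt_const
      refine ContinuousAt.mul ?_ continuousAt_const
      have hne : (t - r ω, q - y ω) ≠ (0 : ℝ × ℝ) := by
        intro h0
        rw [Prod.mk_eq_zero] at h0
        rcases hsep ω hω t q ht hq with h | h
        · rw [h0.1, abs_zero] at h; linarith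
        · rw [h0.2, abs_zero] at h; linarith
      have hcont : Continuous (fun a : ℝ × ℝ => (a.1 - r ω, a.2 - y ω)) := by fun_prop
      exact ContinuousAt.comp (f := fun a : ℝ × ℝ => (a.1 - r ω, a.2 - y ω)) (x := (t, q))
        (continuousAt_heatKernelIter hD i hne) hcont.continuousAt
  · have hs : {z | |z - q₀| < δ} ∈ 𝓝 q := by
      have : Continuous (fun z : ℝ => |z - q₀|) := by fun_prop
      exact this.continuousAt.eventually_lt continuousAt_const hq
    refine (hasDerivAt_integral_of_dominated_loc_of_deriv_le (bound := fun ω => C * ‖g ω‖) hs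
      (Eventually.of_forall fun z => hmeas i t z) ?_ (hmeas (i + 1) t q)
      (ae_of_all _ fun ω z hz => hbound (i + 1) ω t z ht hz) (hg.norm.const_mul C)
      (ae_of_all _ fun ω z _ => ?_)).2
    · exact (hg.norm.const_mul C).mono' (hmeas i t q) (ae_of_all _ fun ω => hbound i ω t q ht hq)
    · exact ((hasDerivAt_heatKernelIter hD hi (t - r ω) (z - y ω)).comp_sub_const z (y ω)).mul_const _

/-! ### Mild solutions for a bounded potential -/

lemma continuous_heat_param {X : Type*} [TopologicalSpace X] [FirstCountableTopology X] (D : ℝ)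
    {F : X → ℝ → ℝ} {C : ℝ} (hF : Continuous (Function.uncurry F)) (hb : ∀ s y, |F s y| ≤ C)
    {s : X → X} {σ q : X → ℝ} (hs : Continuous s) (hσ : Continuous σ) (hq : Continuous q) :
    Continuous (fun x => heat D (σ x) (F (s x)) (q x)) := by
  unfold heat
  refine continuous_of_dominated (bound := fun _ => C) (fun x => ?_)
    (fun x => ae_of_all _ fun z => hb _ _) (integrable_const C) (ae_of_all _ fun z => ?_)
  · have : Continuous (fun z => F (s x) (q x + Real.sqrt (σ x) * z)) :=
      hF.comp (by fun_prop : Continuous fun z => (s x, q x + Real.sqrt (σ x) * z))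
    exact this.aestronglyMeasurable
  · exact hF.comp (by fun_prop : Continuous fun x => (s x, q x + Real.sqrt (σ x) * z))

/-- Integrand of the fixed-point equation in the time `σ` before the present and the Gaussian
variable `z`; the factor `exp(-l σ)` makes the equation a contraction. -/
noncomputable def duhamelIntegrand (l : ℝ) (W : ℝ → ℝ → ℝ) (v : ℝ × ℝ → ℝ) (a b : ℝ × ℝ) : ℝ :=
  if b.1 < a.1 then Real.exp (-l * b.1) * (W (a.1 - b.1) (a.2 + Real.sqrt b.1 * b.2) *
    v (a.1 - b.1, a.2 + Real.sqrt b.1 * b.2)) else 0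

/-- Lebesgue measure in the elapsed time `σ > 0` times the Gaussian law of the displacement. -/
noncomputable def duhamelMeasure (D : ℝ) : Measure (ℝ × ℝ) :=
  (volume.restrict (Set.Ioi (0 : ℝ))).prod (wienerLaw D)

lemma integrable_exp_duhamelMeasure (D : ℝ) {l : ℝ} (hl : 0 < l) :
    Integrable (fun b : ℝ × ℝ => Real.exp (-l * b.1)) (duhamelMeasure D) :=
  (integrableOn_exp_mul_Ioi (neg_neg_of_pos hl) 0).integrable.comp_fst (wienerLaw D)

lemma integral_exp_duhamelMeasure (D : ℝ) {l : ℝ} (hl : 0 < l) :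
    ∫ b, Real.exp (-l * b.1) ∂(duhamelMeasure D) = 1 / l := by
  rw [duhamelMeasure, integral_fun_fst (fun s => Real.exp (-l * s)),
    integral_exp_mul_Ioi (neg_neg_of_pos hl) 0]
  simp

section Picard

variable {D l B : ℝ} {W : ℝ → ℝ → ℝ} {v : ℝ × ℝ → ℝ} {C : ℝ}

lemma abs_duhamelIntegrand_le (hB : ∀ t q, |W t q| ≤ B) (hv : ∀ a, |v a| ≤ C) (a b : ℝ × ℝ) :
    ‖duhamelIntegrand l W v a b‖ ≤ B * C * Real.exp (-l * b.1) := by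
  have hB0 : 0 ≤ B := (abs_nonneg _).trans (hB 0 0)
  have hC0 : 0 ≤ C := (abs_nonneg _).trans (hv 0)
  unfold duhamelIntegrand
  split_ifs
  · rw [Real.norm_eq_abs, abs_mul, abs_mul, Real.abs_exp, mul_comm]
    gcongr
    · exact hB _ _
    · exact hv _
  · rw [norm_zero]; positivity

lemma aestronglyMeasurable_duhamelIntegrand (hW : Continuous (Function.uncurry W))
    (hv : Continuous v) (a : ℝ × ℝ) :
    AEStronglyMeasurable (duhamelIntegrand l W v a) (duhamelMeasure D) := by
  refine Measurable.aestronglyMeasurable ?_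
  unfold duhamelIntegrand
  refine Measurable.ite (measurableSet_lt measurable_fst measurable_const) ?_ measurable_const
  have h1 : Continuous (fun b : ℝ × ℝ => W (a.1 - b.1) (a.2 + Real.sqrt b.1 * b.2)) :=
    hW.comp (by fun_prop : Continuous fun b : ℝ × ℝ => (a.1 - b.1, a.2 + Real.sqrt b.1 * b.2))
  have h2 : Continuous (fun b : ℝ × ℝ => v (a.1 - b.1, a.2 + Real.sqrt b.1 * b.2)) :=
    hv.comp (by fun_prop)
  exact Continuous.measurable (by fun_prop)

lemma integrable_duhamelIntegrand (hl : 0 < l) (hW : Continuous (Function.uncurry W))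
    (hB : ∀ t q, |W t q| ≤ B) (hv : Continuous v) (hvb : ∀ a, |v a| ≤ C) (a : ℝ × ℝ) :
    Integrable (duhamelIntegrand l W v a) (duhamelMeasure D) :=
  ((integrable_exp_duhamelMeasure D hl).const_mul (B * C)).mono'
    (aestronglyMeasurable_duhamelIntegrand hW hv a)
    (ae_of_all _ fun b => abs_duhamelIntegrand_le hB hvb a b)

lemma abs_integral_duhamelIntegrand_le (hl : 0 < l) (hB : ∀ t q, |W t q| ≤ B)
    (hvb : ∀ a, |v a| ≤ C) (a : ℝ × ℝ) :
    |∫ b, duhamelIntegrand l W v a b ∂(duhamelMeasure D)| ≤ B * C / l := by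
  have := norm_integral_le_of_norm_le ((integrable_exp_duhamelMeasure D hl).const_mul (B * C))
    (ae_of_all _ fun b => abs_duhamelIntegrand_le (l := l) hB hvb a b)
  rw [integral_const_mul, integral_exp_duhamelMeasure D hl, mul_one_div] at this
  exact this

lemma continuous_integral_duhamelIntegrand (hl : 0 < l) (hW : Continuous (Function.uncurry W))
    (hB : ∀ t q, |W t q| ≤ B) (hv : Continuous v) (hvb : ∀ a, |v a| ≤ C) :
    Continuous (fun a => ∫ b, duhamelIntegrand l W v a b ∂(duhamelMeasure D)) := by
  refine continuous_iff_continuousAt.2 fun a => ?_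
  refine continuousAt_of_dominated
    (Eventually.of_forall fun a => aestronglyMeasurable_duhamelIntegrand hW hv a)
    (Eventually.of_forall fun a => ae_of_all _ fun b => abs_duhamelIntegrand_le hB hvb a b)
    ((integrable_exp_duhamelMeasure D hl).const_mul (B * C)) ?_
  -- the cut-off at the initial time is discontinuous on a null set only
  have hne : ∀ᵐ b ∂(duhamelMeasure D), b.1 ≠ a.1 := by
    have : ∀ᵐ s ∂(volume.restrict (Set.Ioi (0 : ℝ))), s ≠ a.1 :=
      ae_restrict_of_ae (by simp [ae_iff])
    exact Measure.quasiMeasurePreserving_fst.ae this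
  filter_upwards [hne] with b hb
  have h1 : Continuous (fun a : ℝ × ℝ => W (a.1 - b.1) (a.2 + Real.sqrt b.1 * b.2)) :=
    hW.comp (by fun_prop : Continuous fun a : ℝ × ℝ => (a.1 - b.1, a.2 + Real.sqrt b.1 * b.2))
  have h2 : Continuous (fun a : ℝ × ℝ => v (a.1 - b.1, a.2 + Real.sqrt b.1 * b.2)) :=
    hv.comp (by fun_prop)
  rcases lt_or_gt_of_ne hb with h | h
  · have hc : Continuous (fun a : ℝ × ℝ => Real.exp (-l * b.1) *
      (W (a.1 - b.1) (a.2 + Real.sqrt b.1 * b.2) *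
        v (a.1 - b.1, a.2 + Real.sqrt b.1 * b.2))) := by fun_prop
    refine hc.continuousAt.congr ?_
    filter_upwards [continuousAt_const.eventually_lt continuous_fst.continuousAt h] with a' h'
    simp only [duhamelIntegrand, if_pos h']
  · refine (continuousAt_const (y := (0 : ℝ))).congr ?_
    filter_upwards [continuous_fst.continuousAt.eventually_lt continuousAt_const h] with a' h'
    simp only [duhamelIntegrand, if_neg h'.not_gt]

lemma integral_duhamelIntegrand (hl : 0 < l) (hW : Continuous (Function.uncurry W))
    (hB : ∀ t q, |W t q| ≤ B) (hv : Continuous v) (hvb : ∀ a, |v a| ≤ C) {t : ℝ} (ht : 0 ≤ t)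
    (q : ℝ) :
    ∫ b, duhamelIntegrand l W v (t, q) b ∂(duhamelMeasure D) =
      ∫ σ in (0 : ℝ)..t,
        Real.exp (-l * σ) * heat D σ (fun y => W (t - σ) y * v (t - σ, y)) q := by
  rw [duhamelMeasure, integral_prod _ (integrable_duhamelIntegrand hl hW hB hv hvb (t, q)),
    intervalIntegral.integral_of_le ht]
  have e : ∀ σ, ∫ z, duhamelIntegrand l W v (t, q) (σ, z) ∂(wienerLaw D) =
      (Set.Iio t).indicator
        (fun σ => Real.exp (-l * σ) * heat D σ (fun y => W (t - σ) y * v (t - σ, y)) q) σ := by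
    intro σ
    by_cases h : σ < t
    · simp only [duhamelIntegrand, if_pos h, integral_const_mul, heat]
      rw [Set.indicator_of_mem (by exact h)]
    · simp only [duhamelIntegrand, if_neg h, integral_zero]
      rw [Set.indicator_of_notMem (by exact h)]
  simp only [e]
  rw [setIntegral_indicator measurableSet_Iio, integral_Ioc_eq_integral_Ioo, Set.Ioi_inter_Iio]

end Picard

/-- Picard iteration for the mild form of the imaginary-time Schrödinger equation with a bounded
potential `W`. -/
theorem exists_mild_solution {D B C T : ℝ} {W : ℝ → ℝ → ℝ}
    (hW : Continuous (Function.uncurry W)) (hB : ∀ t q, |W t q| ≤ B) {φ : ℝ → ℝ}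
    (hφ : Continuous φ) (hC : ∀ q, |φ q| ≤ C) (hT : 0 ≤ T) :
    ∃ u : ℝ → ℝ → ℝ, Continuous (Function.uncurry u) ∧ (∃ C', ∀ t q, |u t q| ≤ C') ∧
      ∀ t, 0 ≤ t → t ≤ T → ∀ q, u t q = heat D t φ q -
        ∫ σ in (0 : ℝ)..t, heat D σ (fun y => W (t - σ) y * u (t - σ) y) q := by
  have hB0 : 0 ≤ B := (abs_nonneg _).trans (hB 0 0)
  set l : ℝ := 2 * (B + 1) with hl
  have hl0 : 0 < l := by positivity
  have hbcf : ∀ v : BoundedContinuousFunction (ℝ × ℝ) ℝ, ∀ a, |v a| ≤ ‖v‖ := fun v a =>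
    v.norm_coe_le_norm a
  have hcφ : Continuous (fun a : ℝ × ℝ => heat D (max a.1 0) φ a.2) :=
    continuous_heat_param D (X := ℝ × ℝ) (F := fun _ => φ) (s := id) (C := C)
      (hφ.comp continuous_snd) (fun _ => hC) continuous_id (by fun_prop) (by fun_prop)
  let Φ : BoundedContinuousFunction (ℝ × ℝ) ℝ → BoundedContinuousFunction (ℝ × ℝ) ℝ := fun v =>
    BoundedContinuousFunction.ofNormedAddCommGroup
      (fun a => Real.exp (-l * max a.1 0) * heat D (max a.1 0) φ a.2 -
        ∫ b, duhamelIntegrand l W v a b ∂(duhamelMeasure D))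
      (((by fun_prop : Continuous fun a : ℝ × ℝ => Real.exp (-l * max a.1 0)).mul hcφ).sub
        (continuous_integral_duhamelIntegrand hl0 hW hB v.continuous (hbcf v)))
      (C + B * ‖v‖ / l) (by
        intro a
        refine (norm_sub_le _ _).trans ?_
        refine add_le_add ?_ (abs_integral_duhamelIntegrand_le hl0 hB (hbcf v) a)
        rw [norm_mul, Real.norm_eq_abs, Real.abs_exp]
        refine (mul_le_of_le_one_left (norm_nonneg _) (Real.exp_le_one_iff.2 ?_)).trans
          (abs_heat_le_of_bounded hC _)
        have : 0 ≤ max a.1 0 := le_max_right _ _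
        nlinarith)
  have hΦ : ContractingWith (1 / 2) Φ := by
    refine ⟨by norm_num, LipschitzWith.of_dist_le_mul fun v w => ?_⟩
    rw [BoundedContinuousFunction.dist_le (by positivity)]
    intro a
    have e : Φ v a - Φ w a = -∫ b, duhamelIntegrand l W (v - w) a b ∂(duhamelMeasure D) := by
      have : ∀ b, duhamelIntegrand l W (v - w) a b =
          duhamelIntegrand l W v a b - duhamelIntegrand l W w a b := by
        intro b
        unfold duhamelIntegrand
        split_ifs
        · simp only [Pi.sub_apply]; ring
        · simp
      simp only [this]
      rw [integral_sub (integrable_duhamelIntegrand hl0 hW hB v.continuous (hbcf v) a)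
        (integrable_duhamelIntegrand hl0 hW hB w.continuous (hbcf w) a)]
      simp only [Φ, BoundedContinuousFunction.coe_ofNormedAddCommGroup]
      ring
    rw [Real.dist_eq, e, abs_neg]
    have h1 := abs_integral_duhamelIntegrand_le (D := D) hl0 hB (v := ⇑(v - w)) (hbcf (v - w)) a
    rw [dist_eq_norm]
    refine h1.trans ?_
    rw [div_le_iff₀ hl0, hl]
    push_cast
    nlinarith [norm_nonneg (v - w)]
  obtain ⟨v, hv⟩ : ∃ v, Φ v = v := ⟨_, hΦ.fixedPoint_isFixedPt⟩
  have hveq : ∀ a, v a = Real.exp (-l * max a.1 0) * heat D (max a.1 0) φ a.2 -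
        ∫ b, duhamelIntegrand l W v a b ∂(duhamelMeasure D) := fun a => by
    conv_lhs => rw [← hv]
    rfl
  set c : ℝ → ℝ := fun t => max 0 (min t T) with hc
  have hct : ∀ t, 0 ≤ t → t ≤ T → c t = t := fun t h0 h1 => by
    simp only [hc, min_eq_left h1, max_eq_right h0]
  have hcT : ∀ t, c t ≤ T := fun t => max_le hT (min_le_right _ _)
  refine ⟨fun t q => Real.exp (l * c t) * v (t, q), ?_, ⟨Real.exp (l * T) * ‖v‖, ?_⟩, ?_⟩
  · have := v.continuous
    simp only [Function.uncurry_def]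
    fun_prop
  · intro t q
    rw [abs_mul, Real.abs_exp]
    gcongr
    · exact hcT t
    · exact hbcf v _
  · intro t h0 hT' q
    simp only
    rw [hct t h0 hT', hveq, integral_duhamelIntegrand hl0 hW hB v.continuous (hbcf v) h0,
      max_eq_left h0, mul_sub, ← mul_assoc, ← Real.exp_add]
    congr 1
    · simp
    · rw [← intervalIntegral.integral_const_mul]
      refine intervalIntegral.integral_congr fun σ hσ => ?_
      rw [Set.uIcc_of_le h0] at hσ
      have h2 : t - σ ≤ T := by linarith [hσ.1]
      simp only [hct _ (sub_nonneg.2 hσ.2) h2]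
      rw [← mul_assoc, ← Real.exp_add, ← heat_const_mul]
      congr 1
      ext y
      rw [show l * t + -l * σ = l * (t - σ) by ring]
      ring

/-- The mild equation may be restarted at any intermediate time. -/
lemma mild_restart {D T CF C : ℝ} (hD : 0 < D) {F : ℝ → ℝ → ℝ}
    (hF : Continuous (Function.uncurry F)) (hFb : ∀ t q, |F t q| ≤ CF) {φ : ℝ → ℝ}
    (hφ : Continuous φ) (hC : ∀ q, |φ q| ≤ C) {u : ℝ → ℝ → ℝ}
    (hu : ∀ t, 0 ≤ t → t ≤ T → ∀ q, u t q = heat D t φ q -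
        ∫ σ in (0 : ℝ)..t, heat D σ (F (t - σ)) q) {t h : ℝ} (ht : 0 ≤ t) (hh : 0 ≤ h)
    (hth : t + h ≤ T) (q : ℝ) :
    u (t + h) q = heat D h (u t) q - ∫ σ in (0 : ℝ)..h, heat D σ (F (t + h - σ)) q := by
  rcases hh.eq_or_lt with rfl | hh'
  · simp
  have hcont : ∀ t, Continuous (fun a : ℝ × ℝ => heat D a.1 (F (t - a.1)) a.2) := fun t =>
    continuous_heat_param D (X := ℝ × ℝ) (F := fun a => F (t - a.1)) (s := id) (C := CF)
      (hF.comp (by fun_prop : Continuous fun a : (ℝ × ℝ) × ℝ => (t - a.1.1, a.2)))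
      (fun _ => hFb _) continuous_id (by fun_prop) (by fun_prop)
  have hcq : ∀ t q, Continuous (fun σ => heat D σ (F (t - σ)) q) := fun t q =>
    (hcont t).comp (by fun_prop : Continuous fun σ : ℝ => (σ, q))
  have hφh := heatIntegrable_of_bounded (D := D) hφ hC
  have hFs : ∀ s, Continuous (F s) := fun s =>
    hF.comp (by fun_prop : Continuous fun y : ℝ => (s, y))
  rw [hu (t + h) (by positivity) hth q,
    ← intervalIntegral.integral_add_adjacent_intervals (b := h)
      ((hcq _ _).intervalIntegrable _ _) ((hcq _ _).intervalIntegrable _ _)]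
  have e1 : u t = fun q => heat D t φ q - ∫ σ in (0 : ℝ)..t, heat D σ (F (t - σ)) q := by
    ext q; exact hu t ht (by linarith) q
  have hswap : heat D h (fun q => ∫ σ in (0 : ℝ)..t, heat D σ (F (t - σ)) q) q =
      ∫ σ in h..t + h, heat D σ (F (t + h - σ)) q := by
    have hi : Integrable (Function.uncurry fun (σ z : ℝ) =>
        heat D σ (F (t - σ)) (q + Real.sqrt h * z))
        ((volume.restrict (Set.uIoc 0 t)).prod (wienerLaw D)) := by
      have : IsFiniteMeasure (volume.restrict (Set.uIoc 0 t)) := ⟨by simp [Set.uIoc]⟩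
      refine Integrable.of_bound (C := CF) ?_ (ae_of_all _ fun a => ?_)
      · exact ((hcont t).comp (by fun_prop : Continuous fun a : ℝ × ℝ =>
          (a.1, q + Real.sqrt h * a.2))).aestronglyMeasurable
      · exact abs_heat_le_of_bounded (hFb _) _
    have := intervalIntegral_integral_swap hi
    rw [heat, ← this]
    have h2 := intervalIntegral.integral_comp_add_right (a := 0) (b := t)
      (fun σ => heat D σ (F (t + h - σ)) q) h
    rw [zero_add] at h2
    rw [← h2]
    refine intervalIntegral.integral_congr fun σ hσ => ?_
    rw [Set.uIcc_of_le ht] at hσ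
    have h3 := heat_heat hD hh hσ.1 (heatIntegrable_of_bounded (hFs (t - σ)) (hFb _)) q
    rw [show t + h - (σ + h) = t - σ by ring, add_comm σ h, ← h3]
    rfl
  have hi1 : HeatIntegrable D (heat D t φ) := by
    refine heatIntegrable_of_bounded (C := C) ?_ fun y => abs_heat_le_of_bounded hC y
    exact continuous_heat_param D (X := ℝ) (F := fun _ => φ) (s := id) (C := C)
      (hφ.comp continuous_snd) (fun _ => hC) continuous_id continuous_const continuous_id
  have hi2 : HeatIntegrable D (fun q => ∫ σ in (0 : ℝ)..t, heat D σ (F (t - σ)) q) := by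
    refine heatIntegrable_of_bounded (C := CF * |t - 0|) ?_ fun y => ?_
    · exact intervalIntegral.continuous_parametric_intervalIntegral_of_continuous' (by
        exact (hcont t).comp (by fun_prop : Continuous fun a : ℝ × ℝ => (a.2, a.1))) _ _
    · exact intervalIntegral.norm_integral_le_of_norm_le_const (a := 0) (b := t) (C := CF)
        (f := fun σ => heat D σ (F (t - σ)) y) fun σ _ => abs_heat_le_of_bounded (hFb _) _
  rw [e1, heat_sub hh' hi1 hi2, hswap, heat_heat hD hh ht hφh, add_comm t h]
  ring

/-! ### Split-step approximations -/

/-- The split-step scheme: alternate the heat flow over a time `ε` with multiplication by the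
factors `a 1, a 2, …`. -/
noncomputable def splitStep (D ε : ℝ) (a : ℕ → ℝ → ℝ) (f : ℝ → ℝ) : ℕ → ℝ → ℝ
  | 0 => f
  | n + 1 => fun q => a (n + 1) q * heat D ε (splitStep D ε a f n) q

section SplitStep

variable {D ε : ℝ} {a b : ℕ → ℝ → ℝ} {f g : ℝ → ℝ}

lemma splitStep_succ (n : ℕ) (q : ℝ) : splitStep D ε a f (n + 1) q =
    a (n + 1) q * heat D ε (splitStep D ε a f n) q := rfl

lemma splitStep_integrable (hD : 0 < D) (hε : 0 < ε) (ham : ∀ n, Measurable (a n))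
    (ha0 : ∀ n q, 0 ≤ a n q) (ha1 : ∀ n q, a n q ≤ 1) (hf : Integrable f) (n : ℕ) :
    Integrable (splitStep D ε a f n) := by
  induction n with
  | zero => exact hf
  | succ n ih =>
    refine (integrable_heat hD hε.le ih).bdd_mul (c := 1) (ham _).aestronglyMeasurable
      (ae_of_all _ fun q => ?_)
    rw [Real.norm_of_nonneg (ha0 _ _)]
    exact ha1 _ _

lemma splitStep_nonneg (ha0 : ∀ n q, 0 ≤ a n q) (hf : ∀ q, 0 ≤ f q) (n : ℕ) (q : ℝ) :
    0 ≤ splitStep D ε a f n q := by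
  induction n generalizing q with
  | zero => exact hf q
  | succ n ih => exact mul_nonneg (ha0 _ _) (heat_nonneg ih q)

lemma abs_splitStep_le_of_bounded {C : ℝ} (ha0 : ∀ n q, 0 ≤ a n q) (ha1 : ∀ n q, a n q ≤ 1)
    (hf : ∀ q, |f q| ≤ C) (n : ℕ) (q : ℝ) : |splitStep D ε a f n q| ≤ C := by
  induction n generalizing q with
  | zero => exact hf q
  | succ n ih =>
    rw [splitStep_succ, abs_mul, abs_of_nonneg (ha0 _ _)]
    exact (mul_le_of_le_one_left (abs_nonneg _) (ha1 _ _)).trans (abs_heat_le_of_bounded ih q)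

lemma splitStep_sub (hD : 0 < D) (hε : 0 < ε) (ham : ∀ n, Measurable (a n))
    (ha0 : ∀ n q, 0 ≤ a n q) (ha1 : ∀ n q, a n q ≤ 1) (hf : Integrable f) (hg : Integrable g)
    (n : ℕ) : splitStep D ε a (fun q => f q - g q) n =
      fun q => splitStep D ε a f n q - splitStep D ε a g n q := by
  induction n with
  | zero => rfl
  | succ n ih =>
    ext q
    rw [splitStep_succ, ih, heat_sub hε
      (heatIntegrable_of_integrable hD (splitStep_integrable hD hε ham ha0 ha1 hf n))
      (heatIntegrable_of_integrable hD (splitStep_integrable hD hε ham ha0 ha1 hg n)), mul_sub]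
    rfl

/-- A nonnegative potential only decreases the solution of the heat equation. -/
lemma abs_splitStep_le_heat (hD : 0 < D) (hε : 0 < ε) (ham : ∀ n, Measurable (a n))
    (ha0 : ∀ n q, 0 ≤ a n q) (ha1 : ∀ n q, a n q ≤ 1) (hf : Integrable f) (n : ℕ) (q : ℝ) :
    |splitStep D ε a f n q| ≤ heat D (n * ε) (fun q => |f q|) q := by
  induction n generalizing q with
  | zero => simp [splitStep]
  | succ n ih =>
    have h1 := heatIntegrable_of_integrable hD (splitStep_integrable hD hε ham ha0 ha1 hf n)
    have hn : (0 : ℝ) ≤ n * ε := by positivity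
    rw [splitStep_succ, abs_mul, abs_of_nonneg (ha0 _ _)]
    refine (mul_le_of_le_one_left (abs_nonneg _) (ha1 _ _)).trans ((abs_heat_le _ _ _ _).trans ?_)
    refine (heat_mono hε h1.abs
      (heatIntegrable_of_integrable hD (integrable_heat hD hn hf.abs)) ih q).trans_eq ?_
    rw [heat_heat hD hε.le hn (heatIntegrable_of_integrable hD hf.abs)]
    congr 1
    push_cast; ring

/-- A factor `c` lost in each step costs `c ^ n` after `n` steps. -/
lemma pow_mul_splitStep_le (hD : 0 < D) (hε : 0 < ε) (ham : ∀ n, Measurable (a n))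
    (ha0 : ∀ n q, 0 ≤ a n q) (ha1 : ∀ n q, a n q ≤ 1) (hbm : ∀ n, Measurable (b n))
    (hb0 : ∀ n q, 0 ≤ b n q) (hb1 : ∀ n q, b n q ≤ 1) {c : ℝ} (hc : 0 ≤ c) (hf : Integrable f)
    (hf0 : ∀ q, 0 ≤ f q) {N : ℕ} (hab : ∀ n ≤ N, ∀ q, c * b n q ≤ a n q) :
    ∀ n ≤ N, ∀ q, c ^ n * splitStep D ε b f n q ≤ splitStep D ε a f n q := by
  intro n
  induction n with
  | zero => intro _ q; simp [splitStep]
  | succ n ih =>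
    intro hn q
    have h1 := heatIntegrable_of_integrable hD (splitStep_integrable hD hε ham ha0 ha1 hf n)
    have h2 := heatIntegrable_of_integrable hD (splitStep_integrable hD hε hbm hb0 hb1 hf n)
    have h3 := heat_mono hε (h2.const_mul (c ^ n)) h1 (ih (by omega)) q
    rw [heat_const_mul] at h3
    rw [splitStep_succ, splitStep_succ]
    have h4 : 0 ≤ heat D ε (splitStep D ε b f n) q := heat_nonneg (splitStep_nonneg hb0 hf0 n) q
    calc _ = (c * b (n + 1) q) * (c ^ n * heat D ε (splitStep D ε b f n) q) := by ring
      _ ≤ a (n + 1) q * heat D ε (splitStep D ε a f n) q := by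
        apply mul_le_mul (hab _ hn q) h3 (by positivity) (ha0 _ _)

lemma splitStep_one (hD : 0 < D) (hε : 0 < ε) (hf : Integrable f) (n : ℕ) :
    splitStep D ε (fun _ _ => 1) f n = heat D (n * ε) f := by
  induction n with
  | zero => simp [splitStep]
  | succ n ih =>
    ext q
    rw [splitStep_succ, ih, one_mul, heat_heat hD hε.le (by positivity)
      (heatIntegrable_of_integrable hD hf)]
    congr 1
    push_cast; ring

/-- Two schemes whose factors agree for `|q| ≤ R` are close for large `R`: since `cosh` grows under
the heat flow by the factor `exp(D ε / 2)` only, `C exp(D n ε / 2) cosh q / cosh R` dominates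
their difference. -/
lemma abs_splitStep_sub_le_cosh {C R : ℝ} (hR0 : 0 ≤ R) (hD : 0 < D) (hε : 0 < ε)
    (ham : ∀ n, Measurable (a n)) (ha0 : ∀ n q, 0 ≤ a n q) (ha1 : ∀ n q, a n q ≤ 1) (hbm : ∀ n, Measurable (b n))
    (hb0 : ∀ n q, 0 ≤ b n q) (hb1 : ∀ n q, b n q ≤ 1) (hf : Integrable f)
    (hf0 : ∀ q, 0 ≤ f q) (hfC : ∀ q, f q ≤ C) {N : ℕ}
    (hab : ∀ n ≤ N, ∀ q, |q| ≤ R → a n q = b n q) :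
    ∀ n ≤ N, ∀ q, |splitStep D ε a f n q - splitStep D ε b f n q| ≤
      C / Real.cosh R * Real.exp (D * (n * ε) / 2) * Real.cosh q := by
  have hC : 0 ≤ C := (hf0 0).trans (hfC 0)
  have hR := Real.cosh_pos R
  have habs : ∀ q, |f q| ≤ C := fun q => by rw [abs_of_nonneg (hf0 q)]; exact hfC q
  intro n
  induction n with
  | zero =>
    intro _ q
    have := Real.cosh_pos q
    simp only [splitStep, sub_self, abs_zero]
    positivity
  | succ n ih =>
    intro hn q
    by_cases hq : |q| ≤ R
    · have h1 := heatIntegrable_of_integrable hD (splitStep_integrable hD hε ham ha0 ha1 hf n)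
      have h2 := heatIntegrable_of_integrable hD (splitStep_integrable hD hε hbm hb0 hb1 hf n)
      rw [splitStep_succ, splitStep_succ, hab _ hn q hq, ← mul_sub, abs_mul,
        abs_of_nonneg (hb0 _ _), ← heat_sub hε h1 h2]
      refine (mul_le_of_le_one_left (abs_nonneg _) (hb1 _ _)).trans
        ((abs_heat_le _ _ _ _).trans ?_)
      refine (heat_mono hε (h1.sub h2).abs ((heatIntegrable_cosh D).const_mul _)
        (ih (by omega)) q).trans_eq ?_
      rw [heat_const_mul, heat_cosh hD hε.le, ← mul_assoc, mul_assoc (C / Real.cosh R),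
        ← Real.exp_add]
      congr 3
      push_cast; ring
    · have hcosh : Real.cosh R ≤ Real.cosh q := by
        rw [Real.cosh_le_cosh, abs_of_nonneg hR0]
        exact (not_le.1 hq).le
      have i1 := splitStep_nonneg (D := D) (ε := ε) ha0 hf0 (n + 1) q
      have i2 := splitStep_nonneg (D := D) (ε := ε) hb0 hf0 (n + 1) q
      have i3 := abs_splitStep_le_of_bounded (D := D) (ε := ε) ha0 ha1 habs (n + 1) q
      have i4 := abs_splitStep_le_of_bounded (D := D) (ε := ε) hb0 hb1 habs (n + 1) q
      have i5 : |splitStep D ε a f (n + 1) q - splitStep D ε b f (n + 1) q| ≤ C := by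
        rw [abs_le]
        constructor <;> linarith [(abs_le.1 i3).2, (abs_le.1 i4).2]
      refine i5.trans ?_
      have i6 : (1 : ℝ) ≤ Real.exp (D * ((n + 1 : ℕ) * ε) / 2) :=
        Real.one_le_exp (by positivity)
      calc C = C / Real.cosh R * 1 * Real.cosh R := by field_simp
        _ ≤ _ := by gcongr

end SplitStep

/-- A bounded uniformly continuous function has a quadratic modulus of continuity up to an
arbitrarily small constant, which can be averaged against a Gaussian law. -/
lemma exists_quadratic_modulus {W : ℝ → ℝ → ℝ} {B : ℝ} (hB : ∀ t q, |W t q| ≤ B)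
    (hW : UniformContinuous (Function.uncurry W)) {η : ℝ} (hη : 0 < η) :
    ∃ K, 0 ≤ K ∧ ∀ s t y z, |W s y - W t z| ≤ η + K * ((s - t) ^ 2 + (y - z) ^ 2) := by
  obtain ⟨δ, hδ, h⟩ := Metric.uniformContinuous_iff.1 hW η hη
  have hB0 : 0 ≤ B := (abs_nonneg _).trans (hB 0 0)
  refine ⟨2 * B / δ ^ 2, by positivity, fun s t y z => ?_⟩
  by_cases hd : dist (s, y) (t, z) < δ
  · have := h hd
    rw [Real.dist_eq] at this
    have h2 : 0 ≤ 2 * B / δ ^ 2 * ((s - t) ^ 2 + (y - z) ^ 2) := by positivity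
    simp only [Function.uncurry] at this
    linarith
  · have h1 : |W s y - W t z| ≤ 2 * B := by
      refine (abs_sub _ _).trans ?_
      linarith [hB s y, hB t z]
    have h2 : δ ^ 2 ≤ (s - t) ^ 2 + (y - z) ^ 2 := by
      rw [not_lt, Prod.dist_eq, le_max_iff, Real.dist_eq, Real.dist_eq] at hd
      rcases hd with hd | hd
      · have := pow_le_pow_left₀ hδ.le hd 2
        rw [sq_abs] at this
        nlinarith [sq_nonneg (y - z)]
      · have := pow_le_pow_left₀ hδ.le hd 2
        rw [sq_abs] at this
        nlinarith [sq_nonneg (s - t)]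
    have h3 : 2 * B ≤ 2 * B / δ ^ 2 * ((s - t) ^ 2 + (y - z) ^ 2) := by
      calc 2 * B = 2 * B / δ ^ 2 * δ ^ 2 := by field_simp
        _ ≤ _ := by gcongr
    linarith

section Trotter

variable {D B C T : ℝ} {W u : ℝ → ℝ → ℝ}

/-- One step of the split-step scheme, started on the exact solution, has an error of order
`ε · o(1)`. -/
lemma splitStep_local_error (hD : 0 < D) (hW : Continuous (Function.uncurry W))
    (hW0 : ∀ t q, 0 ≤ W t q) (hB : ∀ t q, |W t q| ≤ B) (hu : Continuous (Function.uncurry u))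
    (hC : ∀ t q, |u t q| ≤ C)
    (hmild : ∀ t h, 0 ≤ t → 0 ≤ h → t + h ≤ T → ∀ q, u (t + h) q = heat D h (u t) q -
      ∫ σ in (0 : ℝ)..h, heat D σ (fun y => W (t + h - σ) y * u (t + h - σ) y) q)
    {η K : ℝ} (hK : 0 ≤ K)
    (hmod : ∀ s t y z, |W s y - W t z| ≤ η + K * ((s - t) ^ 2 + (y - z) ^ 2))
    {t ε : ℝ} (ht : 0 ≤ t) (hε : 0 < ε) (htε : t + ε ≤ T) (q : ℝ) :
    |Real.exp (-ε * W (t + ε) q) * heat D ε (u t) q - u (t + ε) q| ≤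
      ε * (C * (2 * B ^ 2 * ε + η + K * (ε ^ 2 + ε * D))) := by
  have hB0 : 0 ≤ B := (abs_nonneg _).trans (hB 0 0)
  have hC0 : 0 ≤ C := (abs_nonneg _).trans (hC 0 0)
  have hus : ∀ s, Continuous (u s) := fun s =>
    hu.comp (by fun_prop : Continuous fun y : ℝ => (s, y))
  have hWs : ∀ s, Continuous (W s) := fun s =>
    hW.comp (by fun_prop : Continuous fun y : ℝ => (s, y))
  have hF : ∀ s y, |W s y * u s y| ≤ B * C := fun s y => by
    rw [abs_mul]; exact mul_le_mul (hB _ _) (hC _ _) (abs_nonneg _) hB0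
  have hFc : Continuous (fun a : ℝ × ℝ => W a.1 a.2 * u a.1 a.2) := hW.mul hu
  have hcq : Continuous (fun σ => heat D σ (fun y => W (t + ε - σ) y * u (t + ε - σ) y) q) :=
    continuous_heat_param D (X := ℝ) (F := fun σ y => W (t + ε - σ) y * u (t + ε - σ) y) (s := id)
      (C := B * C) (hFc.comp (by fun_prop : Continuous fun a : ℝ × ℝ => (t + ε - a.1, a.2)))
      (fun _ => hF _) continuous_id continuous_id continuous_const
  have hshort : ∀ h, 0 ≤ h → h ≤ ε → ∀ y, |heat D h (u t) y - u (t + h) y| ≤ ε * (B * C) := by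
    intro h h0 h1 y
    rw [hmild t h ht h0 (by linarith) y, sub_sub_cancel]
    have := intervalIntegral.norm_integral_le_of_norm_le_const (a := 0) (b := h) (C := B * C)
      (f := fun σ => heat D σ (fun y => W (t + h - σ) y * u (t + h - σ) y) y)
      fun σ _ => abs_heat_le_of_bounded (hF _) _
    rw [Real.norm_eq_abs, sub_zero, abs_of_nonneg h0] at this
    refine this.trans ?_
    rw [mul_comm]
    gcongr
  set g := heat D ε (u t) q with hg
  have hgC : |g| ≤ C := abs_heat_le_of_bounded (hC t) q
  set w := W (t + ε) q with hw
  have hw0 : 0 ≤ w := hW0 _ _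
  have hwB : w ≤ B := (le_abs_self _).trans (hB _ _)
  have hmom : ∫ z, (B * (ε * (B * C)) + C * (η + K * (ε ^ 2 + ε * z ^ 2))) ∂(wienerLaw D) =
      B * (ε * (B * C)) + C * (η + K * (ε ^ 2 + ε * D)) := by
    have i := integrable_sq_wienerLaw D
    have e : ∀ z : ℝ, B * (ε * (B * C)) + C * (η + K * (ε ^ 2 + ε * z ^ 2)) =
        (B * (ε * (B * C)) + C * (η + K * ε ^ 2)) + (C * K * ε) * z ^ 2 := fun z => by ring
    simp only [e]
    rw [integral_add (integrable_const _) (i.const_mul _), integral_const_mul,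
      integral_sq_wienerLaw hD]
    simp
    ring
  have hmomi : Integrable (fun z : ℝ => B * (ε * (B * C)) + C * (η + K * (ε ^ 2 + ε * z ^ 2)))
      (wienerLaw D) :=
    (integrable_const _).add (((integrable_const _).add
      (((integrable_const _).add ((integrable_sq_wienerLaw D).const_mul _)).const_mul _)).const_mul _)
  -- the potential may be frozen at the end point of the step
  have hfreeze : ∀ σ, 0 ≤ σ → σ ≤ ε →
      |heat D σ (fun y => W (t + ε - σ) y * u (t + ε - σ) y) q - w * g| ≤
        B * (ε * (B * C)) + C * (η + K * (ε ^ 2 + ε * D)) := by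
    intro σ h0 h1
    have e1 : w * g = heat D σ (fun y => w * heat D (ε - σ) (u t) y) q := by
      rw [heat_const_mul, heat_heat hD h0 (by linarith)
        (heatIntegrable_of_bounded (hus t) (hC t)), hg]
      congr 2; ring
    have c1 : Continuous (fun y => W (t + ε - σ) y * u (t + ε - σ) y) := (hWs _).mul (hus _)
    have c2 : Continuous (fun y => w * heat D (ε - σ) (u t) y) :=
      (continuous_heat_param D (X := ℝ) (F := fun _ => u t) (s := id) (C := C)
        ((hus t).comp continuous_snd) (fun _ => hC t) continuous_id continuous_const
        continuous_id).const_mul w |>.congr fun _ => rfl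
    have b2 : ∀ y, |w * heat D (ε - σ) (u t) y| ≤ B * C := fun y => by
      rw [abs_mul, abs_of_nonneg hw0]
      exact mul_le_mul hwB (abs_heat_le_of_bounded (hC t) y) (abs_nonneg _) hB0
    rw [e1, ← hmom]
    have hsub := integral_sub (integrable_affine_of_bounded (D := D) c1 (hF _) σ q)
      (integrable_affine_of_bounded (D := D) c2 b2 σ q)
    refine (congrArg abs hsub.symm).trans_le ?_
    rw [← Real.norm_eq_abs]
    refine norm_integral_le_of_norm_le hmomi (ae_of_all _ fun z => ?_)
    set y := q + Real.sqrt σ * z with hy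
    change ‖W (t + ε - σ) y * u (t + ε - σ) y - w * heat D (ε - σ) (u t) y‖ ≤ _
    have e2 : W (t + ε - σ) y * u (t + ε - σ) y - w * heat D (ε - σ) (u t) y =
        -(w * (heat D (ε - σ) (u t) y - u (t + (ε - σ)) y)) +
          (W (t + ε - σ) y - w) * u (t + ε - σ) y := by
      rw [show t + (ε - σ) = t + ε - σ by ring]; ring
    rw [e2]
    refine (norm_add_le _ _).trans (add_le_add ?_ ?_)
    · rw [norm_neg, norm_mul, Real.norm_of_nonneg hw0]
      exact mul_le_mul hwB (hshort _ (by linarith) (by linarith) y) (norm_nonneg _) hB0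
    · rw [norm_mul, mul_comm]
      refine mul_le_mul (hC _ _) ?_ (norm_nonneg _) hC0
      refine (hmod (t + ε - σ) (t + ε) y q).trans ?_
      have i1 : (t + ε - σ - (t + ε)) ^ 2 ≤ ε ^ 2 := by nlinarith
      have i2 : (y - q) ^ 2 ≤ ε * z ^ 2 := by
        rw [hy, add_sub_cancel_left, mul_pow, Real.sq_sqrt h0]
        gcongr
      gcongr
  have hint : |(∫ σ in (0 : ℝ)..ε, heat D σ (fun y => W (t + ε - σ) y * u (t + ε - σ) y) q) -
      ε * (w * g)| ≤ (B * (ε * (B * C)) + C * (η + K * (ε ^ 2 + ε * D))) * ε := by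
    have e : ε * (w * g) = ∫ σ in (0 : ℝ)..ε, w * g := by
      rw [intervalIntegral.integral_const, sub_zero, smul_eq_mul]
    rw [e, ← intervalIntegral.integral_sub (hcq.intervalIntegrable _ _)
      (continuous_const.intervalIntegrable _ _)]
    have := intervalIntegral.norm_integral_le_of_norm_le_const (a := 0) (b := ε)
      (C := B * (ε * (B * C)) + C * (η + K * (ε ^ 2 + ε * D)))
      (f := fun σ => heat D σ (fun y => W (t + ε - σ) y * u (t + ε - σ) y) q - w * g)
      fun σ hσ => by
        rw [Set.uIoc_of_le hε.le] at hσ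
        exact hfreeze σ hσ.1.le hσ.2
    rwa [sub_zero, abs_of_pos hε] at this
  have hexp : |Real.exp (-ε * w) - 1 + ε * w| ≤ (ε * B) ^ 2 := by
    have hx : 0 ≤ ε * w := by positivity
    have h1 : 1 - ε * w ≤ Real.exp (-ε * w) := by
      have := Real.add_one_le_exp (-ε * w); linarith
    have h2 : Real.exp (-ε * w) ≤ 1 - ε * w + (ε * w) ^ 2 := by
      have h3 := Real.add_one_le_exp (ε * w)
      rw [neg_mul, Real.exp_neg, inv_le_iff_one_le_mul₀ (Real.exp_pos _)]
      have h4 : 0 ≤ 1 - ε * w + (ε * w) ^ 2 := by nlinarith [sq_nonneg (ε * w - 1)]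
      have h5 : 0 ≤ (ε * w) ^ 3 := by positivity
      calc (1 : ℝ) ≤ (1 - ε * w + (ε * w) ^ 2) * (ε * w + 1) := by nlinarith
        _ ≤ _ := by gcongr
    have h3 : (ε * w) ^ 2 ≤ (ε * B) ^ 2 := by gcongr
    rw [abs_le]
    constructor <;> nlinarith [sq_nonneg (ε * B)]
  rw [hmild t ε ht hε.le htε q]
  set I := ∫ σ in (0 : ℝ)..ε, heat D σ (fun y => W (t + ε - σ) y * u (t + ε - σ) y) q with hI
  have e3 : Real.exp (-ε * w) * g - (g - I) =
      (Real.exp (-ε * w) - 1 + ε * w) * g + (I - ε * (w * g)) := by ring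
  rw [e3]
  refine (abs_add_le _ _).trans ?_
  rw [abs_mul]
  have h6 : |Real.exp (-ε * w) - 1 + ε * w| * |g| ≤ (ε * B) ^ 2 * C :=
    mul_le_mul hexp hgC (abs_nonneg _) (by positivity)
  refine (add_le_add h6 hint).trans_eq ?_
  ring

/-- The split-step scheme converges to the mild solution when the potential is bounded and
uniformly continuous. -/
theorem tendsto_splitStep_of_bounded (hD : 0 < D) (hW : UniformContinuous (Function.uncurry W))
    (hW0 : ∀ t q, 0 ≤ W t q) (hB : ∀ t q, |W t q| ≤ B) (hu : Continuous (Function.uncurry u))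
    (hC : ∀ t q, |u t q| ≤ C)
    (hmild : ∀ t h, 0 ≤ t → 0 ≤ h → t + h ≤ T → ∀ q, u (t + h) q = heat D h (u t) q -
      ∫ σ in (0 : ℝ)..h, heat D σ (fun y => W (t + h - σ) y * u (t + h - σ) y) q)
    {t : ℝ} (ht : 0 < t) (htT : t ≤ T) (q : ℝ) :
    Tendsto (fun N : ℕ => splitStep D (t / N) (fun n q => Real.exp (-(t / N) * W (n * (t / N)) q))
      (u 0) N q) atTop (𝓝 (u t q)) := by
  have hC0 : 0 ≤ C := (abs_nonneg _).trans (hC 0 0)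
  have hus : ∀ s, Continuous (u s) := fun s =>
    hu.comp (by fun_prop : Continuous fun y : ℝ => (s, y))
  have hWs : ∀ s, Continuous (W s) := fun s =>
    hW.continuous.comp (by fun_prop : Continuous fun y : ℝ => (s, y))
  -- accumulation of the local errors
  have hacc : ∀ η > 0, ∃ K, 0 ≤ K ∧ ∀ ε > 0, ∀ n : ℕ, n * ε ≤ T → ∀ q,
      |splitStep D ε (fun n q => Real.exp (-ε * W (n * ε) q)) (u 0) n q - u (n * ε) q| ≤
        n * (ε * (C * (2 * B ^ 2 * ε + η + K * (ε ^ 2 + ε * D)))) := by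
    intro η hη
    obtain ⟨K, hK, hmod⟩ := exists_quadratic_modulus hB hW hη
    refine ⟨K, hK, fun ε hε n => ?_⟩
    set a : ℕ → ℝ → ℝ := fun n q => Real.exp (-ε * W (n * ε) q) with ha
    have ha1 : ∀ n q, a n q ≤ 1 := fun n q => Real.exp_le_one_iff.2 (by
      have := hW0 (n * ε) q; nlinarith)
    have hac : ∀ n, Continuous (a n) := fun n => by
      have := hWs (n * ε); simp only [ha]; fun_prop
    have hsb : ∀ n q, |splitStep D ε a (u 0) n q| ≤ C := fun n q =>
      abs_splitStep_le_of_bounded (fun _ _ => (Real.exp_pos _).le) ha1 (hC 0) n q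
    have hsc : ∀ n, Continuous (splitStep D ε a (u 0) n) := by
      intro n
      induction n with
      | zero => exact hus 0
      | succ n ih =>
        exact (hac (n + 1)).mul (continuous_heat_param D (X := ℝ)
          (F := fun _ => splitStep D ε a (u 0) n) (s := id) (C := C) (ih.comp continuous_snd)
          (fun _ => hsb n) continuous_id continuous_const continuous_id)
    induction n with
    | zero => intro _ q; simp [splitStep]
    | succ n ih =>
      intro hn q
      push_cast at hn
      have hnε : (0 : ℝ) ≤ n * ε := by positivity
      have hloc := splitStep_local_error hD hW.continuous hW0 hB hu hC hmild hK hmod hnε hε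
        (by linarith) q
      have ih' := ih (by linarith)
      have e0 : ((n + 1 : ℕ) : ℝ) * ε = n * ε + ε := by push_cast; ring
      have hsub := heat_sub (D := D) hε (heatIntegrable_of_bounded (hsc n) (hsb n))
        (heatIntegrable_of_bounded (hus (n * ε)) (hC (n * ε))) q
      have hd := abs_heat_le_of_bounded (D := D) (σ := ε) ih' q
      rw [hsub] at hd
      rw [splitStep_succ]
      simp only [ha, e0]
      simp only [ha] at hd
      set A := heat D ε (splitStep D ε a (u 0) n) q
      have hex : Real.exp (-ε * W (n * ε + ε) q) ≤ 1 := by rw [← e0]; exact ha1 (n + 1) q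
      have e1 : Real.exp (-ε * W (n * ε + ε) q) * A - u (n * ε + ε) q =
        Real.exp (-ε * W (n * ε + ε) q) * (A - heat D ε (u (n * ε)) q) +
        (Real.exp (-ε * W (n * ε + ε) q) * heat D ε (u (n * ε)) q - u (n * ε + ε) q) := by ring
      rw [e1]
      refine (abs_add_le _ _).trans ?_
      rw [abs_mul, Real.abs_exp]
      refine (add_le_add ((mul_le_of_le_one_left (abs_nonneg _) hex).trans hd) hloc).trans_eq ?_
      push_cast; ring
  rw [Metric.tendsto_atTop']
  intro ρ hρ
  obtain ⟨K, hK, hest⟩ := hacc (ρ / (2 * (t * C + 1))) (by positivity)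
  have hlim : Tendsto (fun N : ℕ => t * (C * (2 * B ^ 2 * (t / N) + ρ / (2 * (t * C + 1)) +
      K * ((t / N) ^ 2 + t / N * D)))) atTop
      (𝓝 (t * (C * (2 * B ^ 2 * 0 + ρ / (2 * (t * C + 1)) + K * (0 ^ 2 + 0 * D))))) := by
    have h0 : Tendsto (fun N : ℕ => t / N) atTop (𝓝 0) := tendsto_const_div_atTop_nhds_zero_nat t
    exact ((((h0.const_mul _).add_const _).add (((h0.pow 2).add (h0.mul_const D)).const_mul
      K)).const_mul C).const_mul t
  have hlt : t * (C * (2 * B ^ 2 * 0 + ρ / (2 * (t * C + 1)) + K * (0 ^ 2 + 0 * D))) < ρ := by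
    have : t * C * ρ < ρ * (2 * (t * C + 1)) := by nlinarith [mul_nonneg ht.le hC0]
    have h2 : 0 < 2 * (t * C + 1) := by positivity
    calc _ = t * C * ρ / (2 * (t * C + 1)) := by ring
      _ < ρ := by rwa [div_lt_iff₀ h2]
  obtain ⟨N, hN⟩ := ((hlim.eventually_lt_const hlt).and (eventually_gt_atTop 0)).exists_forall_of_atTop
  refine ⟨N, fun n hn => ?_⟩
  obtain ⟨h1, h2⟩ := hN n hn.le
  have hn0 : (0 : ℝ) < n := by exact_mod_cast h2
  have e : (n : ℝ) * (t / n) = t := by field_simp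
  have := hest (t / n) (by positivity) n (by rw [e]; exact htT) q
  rw [Real.dist_eq]
  rw [e, ← mul_assoc, e] at this
  exact this.trans_lt h1

end Trotter

/-! ### The continuous-time limit for an unbounded potential -/

/-- The factors `exp(-ε U(n ε, q))` of the split-step scheme for the potential `U`. -/
noncomputable def potentialFactor (U : ℝ → ℝ → ℝ) (ε : ℝ) (n : ℕ) (q : ℝ) : ℝ :=
  Real.exp (-ε * U (n * ε) q)

lemma potentialFactor_nonneg (U : ℝ → ℝ → ℝ) (ε : ℝ) (n : ℕ) (q : ℝ) :
    0 ≤ potentialFactor U ε n q := (Real.exp_pos _).le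

lemma potentialFactor_le_one {U : ℝ → ℝ → ℝ} (hU0 : ∀ t q, 0 ≤ U t q) {ε : ℝ} (hε : 0 ≤ ε) (n : ℕ)
    (q : ℝ) : potentialFactor U ε n q ≤ 1 :=
  Real.exp_le_one_iff.2 (by have := hU0 (n * ε) q; nlinarith)

lemma continuous_uncurry_right {U : ℝ → ℝ → ℝ} (hU : Continuous (Function.uncurry U)) (t : ℝ) :
    Continuous (U t) := hU.comp (by fun_prop : Continuous fun y : ℝ => (t, y))

lemma measurable_potentialFactor {U : ℝ → ℝ → ℝ} (hU : Continuous (Function.uncurry U)) (ε : ℝ)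
    (n : ℕ) : Measurable (potentialFactor U ε n) := by
  have := continuous_uncurry_right hU (n * ε)
  unfold potentialFactor
  exact Continuous.measurable (by fun_prop)

/-- `U` with both arguments clamped to `[-R, R]`: a bounded uniformly continuous potential which
agrees with `U` on a large square. -/
lemma exists_clamped_potential {U : ℝ → ℝ → ℝ} (hU : Continuous (Function.uncurry U))
    (hU0 : ∀ t q, 0 ≤ U t q) {R : ℝ} (hR : 0 ≤ R) :
    ∃ W : ℝ → ℝ → ℝ, UniformContinuous (Function.uncurry W) ∧ (∀ t q, 0 ≤ W t q) ∧
      (∃ B, ∀ t q, |W t q| ≤ B) ∧ ∀ t q, |t| ≤ R → |q| ≤ R → W t q = U t q := by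
  have h : -R ≤ R := by linarith
  set pr := Set.projIcc (-R) R h with hpr
  have hUc : Continuous (fun a : Set.Icc (-R) R × Set.Icc (-R) R => U a.1 a.2) :=
    hU.comp (by fun_prop : Continuous fun a : Set.Icc (-R) R × Set.Icc (-R) R =>
      ((a.1 : ℝ), (a.2 : ℝ)))
  refine ⟨fun t q => U (pr t) (pr q), ?_, fun t q => hU0 _ _, ?_, fun t q ht hq => ?_⟩
  · have h1 := CompactSpace.uniformContinuous_of_continuous hUc
    have h2 : UniformContinuous pr := (LipschitzWith.projIcc h).uniformContinuous
    exact h1.comp (h2.prodMap h2)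
  · obtain ⟨B, hB⟩ := isCompact_univ.exists_bound_of_continuousOn hUc.continuousOn
    exact ⟨B, fun t q => hB (pr t, pr q) trivial⟩
  · simp only [hpr, Set.projIcc_of_mem h (abs_le.1 ht), Set.projIcc_of_mem h (abs_le.1 hq)]

/-- `u` is the mild solution up to time `T` for a bounded potential `W` which agrees with `U` on
`[0, T] × [-T, T]`, with nonnegative initial value `u 0`. -/
structure IsBoundedApprox (D : ℝ) (U : ℝ → ℝ → ℝ) (T : ℝ) (W u : ℝ → ℝ → ℝ) : Prop where
  continuous_potential : Continuous (Function.uncurry W)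
  potential_nonneg : ∀ t q, 0 ≤ W t q
  potential_bounded : ∃ B, ∀ t q, |W t q| ≤ B
  potential_eq : ∀ t q, 0 ≤ t → t ≤ T → |q| ≤ T → W t q = U t q
  continuous : Continuous (Function.uncurry u)
  bounded : ∃ C, ∀ t q, |u t q| ≤ C
  integrable_zero : Integrable (u 0)
  nonneg : ∀ t q, 0 ≤ t → t ≤ T → 0 ≤ u t q
  le_heat : ∀ t q, 0 ≤ t → t ≤ T → u t q ≤ heat D t (u 0) q
  mild : ∀ t h, 0 ≤ t → 0 ≤ h → t + h ≤ T → ∀ q, u (t + h) q = heat D h (u t) q -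
    ∫ σ in (0 : ℝ)..h, heat D σ (fun y => W (t + h - σ) y * u (t + h - σ) y) q

lemma exists_nonneg_compactSupport_approx {p₀ : ℝ → ℝ} (hp : Integrable p₀)
    (hp0 : ∀ q, 0 ≤ p₀ q) {δ : ℝ} (hδ : 0 < δ) :
    ∃ φ : ℝ → ℝ, Continuous φ ∧ (∃ C, ∀ q, φ q ≤ C) ∧ (∀ q, 0 ≤ φ q) ∧ Integrable φ ∧
      ∫ q, |φ q - p₀ q| ≤ δ := by
  obtain ⟨g, hgc, hg, hgcont, hgi⟩ := hp.exists_hasCompactSupport_integral_sub_le hδ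
  refine ⟨fun q => max (g q) 0, by fun_prop, ?_, fun q => le_max_right _ _, hgi.pos_part, ?_⟩
  · obtain ⟨C, hC⟩ := hgcont.bounded_above_of_compact_support hgc
    exact ⟨C, fun q => max_le ((le_abs_self _).trans (hC q)) ((norm_nonneg _).trans (hC q))⟩
  · refine le_trans (integral_mono (hgi.pos_part.sub hp).abs (hp.sub hgi).norm fun q => ?_) hg
    simp only [Pi.sub_apply, Real.norm_eq_abs]
    rw [abs_sub_comm (p₀ q)]
    calc |max (g q) 0 - p₀ q| = |max (g q) 0 - max (p₀ q) 0| := by rw [max_eq_left (hp0 q)]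
      _ ≤ _ := abs_max_sub_max_le_abs _ _ _

lemma self_le_cosh (x : ℝ) : x ≤ Real.cosh x := by
  rcases le_or_gt 0 x with h | h
  · exact (Real.self_le_sinh_iff.2 h).trans (Real.sinh_lt_cosh x).le
  · exact h.le.trans (Real.cosh_pos x).le

/-- The split-step scheme for `U` and `p₀` is uniformly close to one that converges. -/
lemma exists_boundedApprox {D : ℝ} (hD : 0 < D) {U : ℝ → ℝ → ℝ}
    (hU : Continuous (Function.uncurry U)) (hU0 : ∀ t q, 0 ≤ U t q) {p₀ : ℝ → ℝ}
    (hp : Integrable p₀) (hp0 : ∀ q, 0 ≤ p₀ q) (k : ℕ) :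
    ∃ W u : ℝ → ℝ → ℝ, IsBoundedApprox D U k W u ∧ ∫ q, |u 0 q - p₀ q| ≤ 1 / (k + 1) ∧
      ∀ t : ℝ, 0 < t → t ≤ k → ∀ q : ℝ, |q| ≤ k → ∃ s : ℕ → ℝ, Tendsto s atTop (𝓝 (u t q)) ∧
        ∀ N : ℕ, 0 < N → |splitStep D (t / N) (potentialFactor U (t / N)) p₀ N q - s N| ≤
          ((Real.sqrt (2 * Real.pi * D * t))⁻¹ + 1) / (k + 1) := by
  obtain ⟨φ, hφc, ⟨C, hφC⟩, hφ0, hφi, hφp⟩ :=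
    exists_nonneg_compactSupport_approx hp hp0 (δ := 1 / ((k : ℝ) + 1)) (by positivity)
  have hC0 : 0 ≤ C := (hφ0 0).trans (hφC 0)
  have hφabs : ∀ q, |φ q| ≤ C := fun q => by rw [abs_of_nonneg (hφ0 q)]; exact hφC q
  set R : ℝ := max k (C * Real.exp (D * k / 2) * Real.cosh k * (k + 1)) with hR
  have hkR : (k : ℝ) ≤ R := le_max_left _ _
  have hR0 : 0 ≤ R := (Nat.cast_nonneg k).trans hkR
  obtain ⟨W, hWu, hW0, ⟨B, hB⟩, hWU⟩ := exists_clamped_potential hU hU0 hR0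
  have hWc := hWu.continuous
  obtain ⟨u, huc, ⟨C', hC'⟩, hu⟩ := exists_mild_solution (D := D) (T := k) hWc hB hφc hφabs
    (Nat.cast_nonneg k)
  have hB0 : 0 ≤ B := (abs_nonneg _).trans (hB 0 0)
  have hu0 : u 0 = φ := by
    ext q
    rw [hu 0 le_rfl (Nat.cast_nonneg k) q]
    simp
  have hmild : ∀ t h : ℝ, 0 ≤ t → 0 ≤ h → t + h ≤ k → ∀ q, u (t + h) q = heat D h (u t) q -
      ∫ σ in (0 : ℝ)..h, heat D σ (fun y => W (t + h - σ) y * u (t + h - σ) y) q :=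
    fun t h ht hh hth q => mild_restart (CF := B * C') hD (F := fun t y => W t y * u t y)
      (hWc.mul huc) (fun t y => by
        rw [abs_mul]; exact mul_le_mul (hB _ _) (hC' _ _) (abs_nonneg _) hB0) hφc hφabs hu ht hh hth q
  have hlim : ∀ t : ℝ, 0 < t → t ≤ k → ∀ q, Tendsto
      (fun N : ℕ => splitStep D (t / N) (potentialFactor W (t / N)) φ N q) atTop (𝓝 (u t q)) := by
    intro t ht htk q
    rw [← hu0]
    exact tendsto_splitStep_of_bounded hD hWu hW0 hB huc hC' hmild ht htk q
  have hpos : ∀ t q : ℝ, 0 ≤ t → t ≤ k → 0 ≤ u t q := by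
    intro t q ht htk
    rcases ht.eq_or_lt with rfl | ht
    · rw [hu0]; exact hφ0 q
    exact ge_of_tendsto' (hlim t ht htk q) fun N =>
      splitStep_nonneg (potentialFactor_nonneg W _) hφ0 N q
  have hle : ∀ t q : ℝ, 0 ≤ t → t ≤ k → u t q ≤ heat D t (u 0) q := by
    intro t q ht htk
    rcases ht.eq_or_lt with rfl | ht
    · simp
    rw [hu0]
    refine le_of_tendsto (hlim t ht htk q) ?_
    filter_upwards [eventually_gt_atTop 0] with N hN
    have hN0 : (0 : ℝ) < N := by exact_mod_cast hN
    have h1 := abs_splitStep_le_heat hD (ε := t / N) (by positivity)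
      (measurable_potentialFactor hWc (t / N)) (potentialFactor_nonneg W (t / N))
      (potentialFactor_le_one hW0 (by positivity)) hφi N q
    rw [show (N : ℝ) * (t / N) = t by field_simp] at h1
    simp only [abs_of_nonneg (hφ0 _)] at h1
    exact (le_abs_self _).trans h1
  refine ⟨W, u, ⟨hWc, hW0, ⟨B, hB⟩, fun t q h0 h1 h2 => hWU t q ?_ (h2.trans hkR), huc, ⟨C', hC'⟩,
    by rwa [hu0], hpos, hle, hmild⟩, by rwa [hu0], fun t ht htk q hq => ?_⟩
  · rw [abs_of_nonneg h0]; exact h1.trans hkR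
  refine ⟨_, hlim t ht htk q, fun N hN => ?_⟩
  have hN0 : (0 : ℝ) < N := by exact_mod_cast hN
  have hε : 0 < t / N := by positivity
  have hNε : (N : ℝ) * (t / N) = t := by field_simp
  have m1 := measurable_potentialFactor hU (t / N)
  have m2 := potentialFactor_nonneg U (t / N)
  have m3 := potentialFactor_le_one hU0 hε.le
  have n1 := measurable_potentialFactor hWc (t / N)
  have n2 := potentialFactor_nonneg W (t / N)
  have n3 := potentialFactor_le_one hW0 hε.le
  -- replace the prior
  have h1 : |splitStep D (t / N) (potentialFactor U (t / N)) p₀ N q -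
      splitStep D (t / N) (potentialFactor U (t / N)) φ N q| ≤
      (Real.sqrt (2 * Real.pi * D * t))⁻¹ * (1 / (k + 1)) := by
    have e := congrFun (splitStep_sub hD hε m1 m2 m3 hp hφi N) q
    rw [← e]
    have h2 := abs_splitStep_le_heat hD hε m1 m2 m3 (hp.sub hφi) N q
    rw [hNε] at h2
    refine h2.trans ((le_abs_self _).trans ((abs_heat_le_integral hD ht (hp.sub hφi).abs q).trans ?_))
    gcongr
    simp only [abs_abs, Pi.sub_apply]
    simpa only [abs_sub_comm] using hφp
  -- replace the potential
  have h2 : |splitStep D (t / N) (potentialFactor U (t / N)) φ N q -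
      splitStep D (t / N) (potentialFactor W (t / N)) φ N q| ≤ 1 / (k + 1) := by
    refine (abs_splitStep_sub_le_cosh (R := R) (C := C) hR0 hD hε m1 m2 m3 n1 n2 n3 hφi hφ0 hφC
      (N := N) (fun n hn y hy => ?_) N le_rfl q).trans ?_
    · simp only [potentialFactor]
      rw [hWU _ y _ hy]
      have : (n : ℝ) * (t / N) ≤ t := by
        have : (n : ℝ) ≤ N := by exact_mod_cast hn
        calc (n : ℝ) * (t / N) ≤ N * (t / N) := by gcongr
          _ = t := hNε
      rw [abs_of_nonneg (by positivity)]
      linarith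
    · rw [hNε]
      have i1 : Real.cosh q ≤ Real.cosh k := by
        rw [Real.cosh_le_cosh, Nat.abs_cast]; exact hq
      have i2 : Real.exp (D * t / 2) ≤ Real.exp (D * k / 2) := by gcongr
      have i3 : C * Real.exp (D * k / 2) * Real.cosh k * (k + 1) ≤ Real.cosh R :=
        (le_max_right _ _).trans (self_le_cosh R)
      have i4 := Real.cosh_pos R
      have i5 := Real.cosh_pos q
      calc C / Real.cosh R * Real.exp (D * t / 2) * Real.cosh q
          ≤ C / Real.cosh R * Real.exp (D * k / 2) * Real.cosh k := by gcongr
        _ = C * Real.exp (D * k / 2) * Real.cosh k / Real.cosh R := by ring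
        _ ≤ 1 / (k + 1) := by
          rw [div_le_div_iff₀ i4 (by positivity)]
          linarith
  refine (abs_sub_le _ _ _).trans ((add_le_add h1 h2).trans_eq ?_)
  ring

/-- The data produced by the limit: the limit `p` of the split-step schemes, and mild solutions
`u k` for bounded potentials that approximate it. -/
theorem exists_limit {D : ℝ} (hD : 0 < D) {U : ℝ → ℝ → ℝ}
    (hU : Continuous (Function.uncurry U)) (hU0 : ∀ t q, 0 ≤ U t q) {p₀ : ℝ → ℝ}
    (hp : Integrable p₀) (hp0 : ∀ q, 0 ≤ p₀ q) :
    ∃ (p : ℝ → ℝ → ℝ) (W u : ℕ → ℝ → ℝ → ℝ),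
      (∀ k : ℕ, IsBoundedApprox D U k (W k) (u k)) ∧
      (∀ k : ℕ, ∫ q, |u k 0 q - p₀ q| ≤ 1 / (k + 1)) ∧
      (∀ t > 0, ∀ q, Tendsto (fun N : ℕ => splitStep D (t / N) (potentialFactor U (t / N)) p₀ N q)
        atTop (𝓝 (p t q))) ∧
      ∀ (k : ℕ) (t : ℝ), 0 < t → t ≤ k → ∀ q : ℝ, |q| ≤ k →
        |p t q - u k t q| ≤ ((Real.sqrt (2 * Real.pi * D * t))⁻¹ + 1) / (k + 1) := by
  choose W u h1 h2 h3 using fun k : ℕ => exists_boundedApprox hD hU hU0 hp hp0 k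
  have hex : ∀ t > 0, ∀ q, ∃ l, Tendsto
      (fun N : ℕ => splitStep D (t / N) (potentialFactor U (t / N)) p₀ N q) atTop (𝓝 l) := by
    intro t ht q
    refine cauchySeq_tendsto_of_complete (Metric.cauchySeq_iff'.2 fun ρ hρ => ?_)
    set A := (Real.sqrt (2 * Real.pi * D * t))⁻¹ + 1 with hA
    have hlim : Tendsto (fun k : ℕ => A / ((k : ℝ) + 1)) atTop (𝓝 0) :=
      tendsto_const_nhds.div_atTop (tendsto_atTop_add_const_right _ _ tendsto_natCast_atTop_atTop)
    obtain ⟨k, hk1, hk2, hk3⟩ := ((hlim.eventually_lt_const (by positivity : (0 : ℝ) < ρ / 4)).and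
      ((tendsto_natCast_atTop_atTop.eventually_ge_atTop t).and
        (tendsto_natCast_atTop_atTop.eventually_ge_atTop |q|))).exists
    obtain ⟨s, hs, hsb⟩ := h3 k t ht hk2 q hk3
    obtain ⟨N, hN⟩ := Metric.cauchySeq_iff'.1 hs.cauchySeq (ρ / 4) (by positivity)
    refine ⟨N + 1, fun n hn => ?_⟩
    have a1 := hsb n (by omega)
    have a2 := hsb (N + 1) (by omega)
    have a3 := hN n (by omega)
    have a4 := hN (N + 1) (by omega)
    rw [Real.dist_eq] at a3 a4 ⊢
    rw [abs_lt] at a3 a4 ⊢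
    rw [abs_le] at a1 a2
    constructor <;> linarith [a1.1, a1.2, a2.1, a2.2, a3.1, a3.2, a4.1, a4.2]
  choose! p hpl using hex
  refine ⟨p, W, u, h1, h2, hpl, fun k t ht htk q hq => ?_⟩
  obtain ⟨s, hs, hsb⟩ := h3 k t ht htk q hq
  refine le_of_tendsto ((hpl t ht q).sub hs).abs ?_
  filter_upwards [eventually_gt_atTop 0] with N hN using hsb N hN

/-! ### The mild equation for the limit -/

/-- `p` is the locally uniform limit, on positive times, of mild solutions `u k` for bounded
potentials `W k` whose initial values converge to `p₀` in `L¹`. -/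
structure IsApproxLimit (D : ℝ) (U : ℝ → ℝ → ℝ) (p₀ : ℝ → ℝ) (p : ℝ → ℝ → ℝ)
    (W u : ℕ → ℝ → ℝ → ℝ) : Prop where
  approx : ∀ k : ℕ, IsBoundedApprox D U k (W k) (u k)
  initial : ∀ k : ℕ, ∫ q, |u k 0 q - p₀ q| ≤ 1 / (k + 1)
  close : ∀ (k : ℕ) (t : ℝ), 0 < t → t ≤ k → ∀ q : ℝ, |q| ≤ k →
    |p t q - u k t q| ≤ ((Real.sqrt (2 * Real.pi * D * t))⁻¹ + 1) / (k + 1)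

/-- The heat flow of a bounded nonnegative function preserves its total mass, finite or not. -/
lemma lintegral_heat {D σ C : ℝ} {F : ℝ → ℝ} (hF : Continuous F) (hF0 : ∀ y, 0 ≤ F y)
    (hC : ∀ y, |F y| ≤ C) :
    ∫⁻ q, ENNReal.ofReal (heat D σ F q) = ∫⁻ q, ENNReal.ofReal (F q) := by
  have e : ∀ q, ENNReal.ofReal (heat D σ F q) =
      ∫⁻ z, ENNReal.ofReal (F (q + Real.sqrt σ * z)) ∂(wienerLaw D) := fun q =>
    ofReal_integral_eq_lintegral_ofReal (integrable_affine_of_bounded hF hC σ q)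
      (ae_of_all _ fun z => hF0 _)
  simp only [e]
  rw [lintegral_lintegral_swap (by fun_prop)]
  simp only [lintegral_add_right_eq_self (fun q => ENNReal.ofReal (F q))]
  simp

lemma integrableOn_heatKernel_reflect {D : ℝ} (hD : 0 < D) (t s q : ℝ) :
    IntegrableOn (fun b : ℝ × ℝ => heatKernel D (s - b.1) (q - b.2)) (Set.Ioo t s ×ˢ Set.univ) := by
  have h := ((integrableOn_heatKernel_slab hD (s - t)).mono_set
    (Set.prod_mono_left Set.Ioo_subset_Ioc_self)).integrable_indicator
      (measurableSet_Ioo.prod MeasurableSet.univ)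
  have h2 := h.comp_sub_left (s, q)
  rw [← integrable_indicator_iff (measurableSet_Ioo.prod MeasurableSet.univ)]
  refine h2.congr (ae_of_all _ fun b => ?_)
  simp only [Set.indicator, Set.mem_prod, Set.mem_Ioo, Set.mem_univ, and_true, Prod.fst_sub,
    Prod.snd_sub]
  congr 1
  simp only [eq_iff_iff]
  constructor <;> rintro ⟨h1, h2⟩ <;> constructor <;> linarith

/-- The Duhamel term as an integral over space-time. -/
lemma integral_heat_eq_setIntegral {D C t h : ℝ} (hD : 0 < D) {F : ℝ → ℝ → ℝ}
    (hF : Continuous (Function.uncurry F)) (hC : ∀ s y, |F s y| ≤ C) (hh : 0 ≤ h) (q : ℝ) :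
    IntegrableOn (fun b : ℝ × ℝ => heatKernel D (t + h - b.1) (q - b.2) * F b.1 b.2)
      (Set.Ioo t (t + h) ×ˢ Set.univ) ∧
    ∫ σ in (0 : ℝ)..h, heat D σ (F (t + h - σ)) q =
      ∫ b in Set.Ioo t (t + h) ×ˢ Set.univ,
        heatKernel D (t + h - b.1) (q - b.2) * F b.1 b.2 := by
  have hi : IntegrableOn (fun b : ℝ × ℝ => heatKernel D (t + h - b.1) (q - b.2) * F b.1 b.2)
      (Set.Ioo t (t + h) ×ˢ Set.univ) := by
    refine Integrable.mul_bdd (c := C) (integrableOn_heatKernel_reflect hD t (t + h) q) ?_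
      (ae_of_all _ fun b => hC _ _)
    exact hF.aestronglyMeasurable
  refine ⟨hi, ?_⟩
  have e := intervalIntegral.integral_comp_sub_left (a := 0) (b := h)
    (fun r => heat D (t + h - r) (F r) q) (t + h)
  simp only [sub_sub_cancel, sub_zero, add_sub_cancel_right] at e
  rw [e, intervalIntegral.integral_of_le (by linarith), integral_Ioc_eq_integral_Ioo]
  rw [IntegrableOn, Measure.volume_eq_prod, ← Measure.prod_restrict, Measure.restrict_univ] at hi
  rw [Measure.volume_eq_prod, ← Measure.prod_restrict, Measure.restrict_univ, integral_prod _ hi]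
  refine setIntegral_congr_fun measurableSet_Ioo fun r hr => ?_
  exact heat_eq_integral hD (by linarith [hr.2]) q _

lemma setIntegral_le_of_lintegral_le {S : Set (ℝ × ℝ)} (hS : MeasurableSet S) {g : ℝ × ℝ → ℝ}
    (hg : IntegrableOn g S) (hg0 : ∀ b ∈ S, 0 ≤ g b) {M : ℝ} (hM : 0 ≤ M)
    (h : ∫⁻ b in S, ENNReal.ofReal (g b) ≤ ENNReal.ofReal M) : ∫ b in S, g b ≤ M := by
  rw [← ofReal_integral_eq_lintegral_ofReal hg
    (by filter_upwards [ae_restrict_mem hS] with b hb using hg0 b hb)] at h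
  exact (ENNReal.ofReal_le_ofReal_iff hM).1 h

namespace IsBoundedApprox

variable {D T : ℝ} {U W u : ℝ → ℝ → ℝ}

lemma bounded_mul (h : IsBoundedApprox D U T W u) : ∃ C, ∀ t q, |W t q * u t q| ≤ C := by
  obtain ⟨B, hB⟩ := h.potential_bounded
  obtain ⟨C, hC⟩ := h.bounded
  refine ⟨B * C, fun t q => ?_⟩
  rw [abs_mul]
  exact mul_le_mul (hB _ _) (hC _ _) (abs_nonneg _) ((abs_nonneg _).trans (hB 0 0))

lemma continuous_mul (h : IsBoundedApprox D U T W u) :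
    Continuous (Function.uncurry fun t q => W t q * u t q) :=
  h.continuous_potential.mul h.continuous

/-- The mass absorbed by the potential does not exceed the initial mass. -/
lemma lintegral_mul_le (h : IsBoundedApprox D U T W u) (hT : 0 ≤ T) :
    ∫⁻ b in Set.Ioo 0 T ×ˢ Set.univ, ENNReal.ofReal (W b.1 b.2 * u b.1 b.2) ≤
      ENNReal.ofReal (∫ q, u 0 q) := by
  obtain ⟨C, hC⟩ := h.bounded_mul
  obtain ⟨C', hC'⟩ := h.bounded
  have hF := h.continuous_mul
  have hFs := fun s => continuous_uncurry_right hF s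
  have hus := continuous_uncurry_right h.continuous 0
  have hF0 : ∀ t ∈ Set.Icc 0 T, ∀ q, 0 ≤ W t q * u t q := fun t ht q =>
    mul_nonneg (h.potential_nonneg t q) (h.nonneg t q ht.1 ht.2)
  have hu0 : ∀ q, 0 ≤ u 0 q := fun q => h.nonneg 0 q le_rfl hT
  have hcont : Continuous (fun a : ℝ × ℝ => heat D (T - a.1) (fun y => W a.1 y * u a.1 y) a.2) :=
    continuous_heat_param D (X := ℝ × ℝ) (F := fun a y => W a.1 y * u a.1 y) (s := id) (C := C)
      (hF.comp (by fun_prop : Continuous fun a : (ℝ × ℝ) × ℝ => (a.1.1, a.2)))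
      (fun _ => hC _) continuous_id (by fun_prop) (by fun_prop)
  have hmild : ∀ q, ∫ r in Set.Ioo 0 T, heat D (T - r) (fun y => W r y * u r y) q ≤
      heat D T (u 0) q := by
    intro q
    have h1 := h.mild 0 T le_rfl hT (by simp) q
    have h2 := h.nonneg (0 + T) q (by simpa) (by simp)
    have e := intervalIntegral.integral_comp_sub_left (a := 0) (b := T)
      (fun r => heat D (T - r) (fun y => W r y * u r y) q) T
    simp only [sub_sub_cancel, sub_zero, sub_self] at e
    simp only [zero_add] at h1 h2
    rw [← integral_Ioc_eq_integral_Ioo, ← intervalIntegral.integral_of_le hT, ← e]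
    linarith
  rw [Measure.volume_eq_prod, ← Measure.prod_restrict, Measure.restrict_univ,
    lintegral_prod _ (by
      refine Measurable.aemeasurable (Measurable.ennreal_ofReal ?_)
      exact hF.measurable)]
  calc ∫⁻ r in Set.Ioo 0 T, ∫⁻ y, ENNReal.ofReal (W r y * u r y)
      = ∫⁻ r in Set.Ioo 0 T, ∫⁻ q, ENNReal.ofReal
          (heat D (T - r) (fun y => W r y * u r y) q) := by
        refine setLIntegral_congr_fun measurableSet_Ioo fun r hr => ?_
        exact (lintegral_heat (hFs r) (hF0 r ⟨hr.1.le, hr.2.le⟩) (hC r)).symm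
    _ = ∫⁻ q, ∫⁻ r in Set.Ioo 0 T, ENNReal.ofReal
          (heat D (T - r) (fun y => W r y * u r y) q) :=
        lintegral_lintegral_swap (by
          refine Measurable.aemeasurable (Measurable.ennreal_ofReal ?_)
          exact hcont.measurable)
    _ ≤ ∫⁻ q, ENNReal.ofReal (heat D T (u 0) q) := by
        refine lintegral_mono fun q => ?_
        rw [← ofReal_integral_eq_lintegral_ofReal]
        · exact ENNReal.ofReal_le_ofReal (hmild q)
        · have : Continuous (fun r => heat D (T - r) (fun y => W r y * u r y) q) :=
            hcont.comp (by fun_prop : Continuous fun r : ℝ => (r, q))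
          exact (this.integrableOn_Icc (a := 0) (b := T)).mono_set Set.Ioo_subset_Icc_self
        · filter_upwards [ae_restrict_mem measurableSet_Ioo] with r hr
          exact heat_nonneg (hF0 r ⟨hr.1.le, hr.2.le⟩) q
    _ = ∫⁻ q, ENNReal.ofReal (u 0 q) := lintegral_heat hus hu0 (hC' 0)
    _ = ENNReal.ofReal (∫ q, u 0 q) :=
        (ofReal_integral_eq_lintegral_ofReal h.integrable_zero (ae_of_all _ hu0)).symm

end IsBoundedApprox

namespace IsApproxLimit

variable {D : ℝ} {U : ℝ → ℝ → ℝ} {p₀ : ℝ → ℝ} {p : ℝ → ℝ → ℝ} {W u : ℕ → ℝ → ℝ → ℝ}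

lemma tendsto (h : IsApproxLimit D U p₀ p W u) {t : ℝ} (ht : 0 < t) (q : ℝ) :
    Tendsto (fun k => u k t q) atTop (𝓝 (p t q)) := by
  rw [tendsto_iff_dist_tendsto_zero]
  have hlim : Tendsto (fun k : ℕ => ((Real.sqrt (2 * Real.pi * D * t))⁻¹ + 1) / ((k : ℝ) + 1))
      atTop (𝓝 0) :=
    tendsto_const_nhds.div_atTop (tendsto_atTop_add_const_right _ _ tendsto_natCast_atTop_atTop)
  refine squeeze_zero' (Eventually.of_forall fun _ => dist_nonneg) ?_ hlim
  filter_upwards [tendsto_natCast_atTop_atTop.eventually_ge_atTop t,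
    tendsto_natCast_atTop_atTop.eventually_ge_atTop |q|] with k h1 h2
  rw [dist_comm, Real.dist_eq]
  exact h.close k t ht h1 q h2

lemma nonneg (h : IsApproxLimit D U p₀ p W u) {t : ℝ} (ht : 0 < t) (q : ℝ) : 0 ≤ p t q := by
  refine ge_of_tendsto (h.tendsto ht q) ?_
  filter_upwards [tendsto_natCast_atTop_atTop.eventually_ge_atTop t] with k h1
  exact (h.approx k).nonneg t q ht.le h1

lemma integral_zero_le (h : IsApproxLimit D U p₀ p W u) (hp : Integrable p₀) (k : ℕ) :
    ∫ q, |u k 0 q| ≤ (∫ q, |p₀ q|) + 1 := by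
  have hi := (h.approx k).integrable_zero
  have h1 : ∫ q, |u k 0 q| ≤ ∫ q, (|p₀ q| + |u k 0 q - p₀ q|) := by
    refine integral_mono hi.abs (hp.abs.add (hi.sub hp).abs) fun q => ?_
    have := abs_add_le (p₀ q) (u k 0 q - p₀ q)
    rwa [add_sub_cancel] at this
  have h4 : ∫ q, (|p₀ q| + |u k 0 q - p₀ q|) = (∫ q, |p₀ q|) + ∫ q, |u k 0 q - p₀ q| :=
    integral_add hp.abs (hi.sub hp).abs
  rw [h4] at h1
  have h2 := h.initial k
  have h3 : 1 / ((k : ℝ) + 1) ≤ 1 := by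
    rw [div_le_one (by positivity)]; linarith [(Nat.cast_nonneg k : (0 : ℝ) ≤ k)]
  linarith

/-- Smoothing by the heat flow: at positive times the approximations are bounded uniformly. -/
lemma approx_le (h : IsApproxLimit D U p₀ p W u) (hD : 0 < D) (hp : Integrable p₀) {k : ℕ} {s t : ℝ}
    (hs : 0 < s) (hst : s ≤ t) (htk : t ≤ k) (q : ℝ) :
    u k t q ≤ (Real.sqrt (2 * Real.pi * D * s))⁻¹ * ((∫ q, |p₀ q|) + 1) := by
  have ht : 0 < t := hs.trans_le hst
  refine ((h.approx k).le_heat t q ht.le htk).trans ((le_abs_self _).trans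
    ((abs_heat_le_integral hD ht (h.approx k).integrable_zero q).trans ?_))
  gcongr
  exact h.integral_zero_le hp k

lemma limit_le (h : IsApproxLimit D U p₀ p W u) (hD : 0 < D) (hp : Integrable p₀) {s t : ℝ}
    (hs : 0 < s) (hst : s ≤ t) (q : ℝ) :
    p t q ≤ (Real.sqrt (2 * Real.pi * D * s))⁻¹ * ((∫ q, |p₀ q|) + 1) := by
  refine le_of_tendsto (h.tendsto (hs.trans_le hst) q) ?_
  filter_upwards [tendsto_natCast_atTop_atTop.eventually_ge_atTop t] with k h1
  exact h.approx_le hD hp hs hst h1 q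

lemma continuousAt (h : IsApproxLimit D U p₀ p W u) (hD : 0 < D) {t : ℝ} (ht : 0 < t) (q : ℝ) :
    ContinuousAt (Function.uncurry p) (t, q) := by
  refine continuousAt_of_locally_uniform_approx_of_continuousAt fun V hV => ?_
  obtain ⟨ρ, hρ, hρV⟩ := Metric.mem_uniformity_dist.1 hV
  set A := (Real.sqrt (2 * Real.pi * D * (t / 2)))⁻¹ + 1 with hA
  have hlim : Tendsto (fun k : ℕ => A / ((k : ℝ) + 1)) atTop (𝓝 0) :=
    tendsto_const_nhds.div_atTop (tendsto_atTop_add_const_right _ _ tendsto_natCast_atTop_atTop)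
  obtain ⟨k, hk1, hk2, hk3⟩ := ((hlim.eventually_lt_const hρ).and
      ((tendsto_natCast_atTop_atTop.eventually_ge_atTop (t + 1)).and
        (tendsto_natCast_atTop_atTop.eventually_ge_atTop (|q| + 1)))).exists
  have e1 : ∀ᶠ a : ℝ × ℝ in 𝓝 (t, q), t / 2 < a.1 :=
    continuousAt_const.eventually_lt continuous_fst.continuousAt (by simp; linarith)
  have e2 : ∀ᶠ a : ℝ × ℝ in 𝓝 (t, q), a.1 < t + 1 :=
    continuous_fst.continuousAt.eventually_lt continuousAt_const (by simp)
  have e3 : ∀ᶠ a : ℝ × ℝ in 𝓝 (t, q), |a.2| < |q| + 1 :=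
    continuous_snd.abs.continuousAt.eventually_lt continuousAt_const (by simp)
  refine ⟨_, e1.and (e2.and e3), Function.uncurry (u k), (h.approx k).continuous.continuousAt, ?_⟩
  rintro ⟨s, y⟩ ⟨h1, h2, h3⟩
  simp only at h1 h2 h3
  apply hρV
  have hs : 0 < s := by linarith
  rw [Real.dist_eq]
  refine (h.close k s hs (by linarith) y (by linarith)).trans_lt (lt_of_le_of_lt ?_ hk1)
  rw [hA]
  gcongr

lemma continuousOn (h : IsApproxLimit D U p₀ p W u) (hD : 0 < D) :
    ContinuousOn (Function.uncurry p) (Set.Ioi 0 ×ˢ Set.univ) := by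
  rintro ⟨t, q⟩ ⟨ht, _⟩
  exact (h.continuousAt hD ht q).continuousWithinAt

lemma tendsto_mul (h : IsApproxLimit D U p₀ p W u) {t : ℝ} (ht : 0 < t) (q : ℝ) :
    Tendsto (fun k => W k t q * u k t q) atTop (𝓝 (U t q * p t q)) := by
  refine ((h.tendsto ht q).const_mul (U t q)).congr' ?_
  filter_upwards [tendsto_natCast_atTop_atTop.eventually_ge_atTop t,
    tendsto_natCast_atTop_atTop.eventually_ge_atTop |q|] with k h1 h2
  rw [(h.approx k).potential_eq t q ht.le h1 h2]

lemma aestronglyMeasurable_mul (h : IsApproxLimit D U p₀ p W u) (hD : 0 < D)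
    (hU : Continuous (Function.uncurry U)) {S : Set (ℝ × ℝ)} (hS : MeasurableSet S)
    (hS0 : S ⊆ Set.Ioi 0 ×ˢ Set.univ) :
    AEStronglyMeasurable (fun b : ℝ × ℝ => U b.1 b.2 * p b.1 b.2) (volume.restrict S) := by
  have : ContinuousOn (fun b : ℝ × ℝ => U b.1 b.2 * p b.1 b.2) S :=
    (hU.continuousOn (s := S)).mul ((h.continuousOn hD).mono hS0)
  exact this.aestronglyMeasurable hS

lemma approx_integrableOn (h : IsApproxLimit D U p₀ p W u) (hp : Integrable p₀) {T : ℝ} (hT : 0 ≤ T)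
    {k : ℕ} (hk : T ≤ k) :
    IntegrableOn (fun b : ℝ × ℝ => W k b.1 b.2 * u k b.1 b.2) (Set.Ioo 0 T ×ˢ Set.univ) ∧
    ∫⁻ b in Set.Ioo 0 T ×ˢ Set.univ, ENNReal.ofReal (W k b.1 b.2 * u k b.1 b.2) ≤
      ENNReal.ofReal ((∫ q, |p₀ q|) + 1) := by
  have hk0 : (0 : ℝ) ≤ k := hT.trans hk
  have h1 : ∫⁻ b in Set.Ioo 0 T ×ˢ Set.univ, ENNReal.ofReal (W k b.1 b.2 * u k b.1 b.2) ≤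
      ENNReal.ofReal ((∫ q, |p₀ q|) + 1) := by
    refine (lintegral_mono_set (Set.prod_mono_left (Set.Ioo_subset_Ioo_right hk))).trans
      (((h.approx k).lintegral_mul_le hk0).trans (ENNReal.ofReal_le_ofReal ?_))
    refine le_trans (integral_mono (h.approx k).integrable_zero
      (h.approx k).integrable_zero.abs fun q => le_abs_self _) (h.integral_zero_le hp k)
  refine ⟨⟨(h.approx k).continuous_mul.aestronglyMeasurable, ?_⟩, h1⟩
  rw [hasFiniteIntegral_iff_ofReal]
  · exact h1.trans_lt ENNReal.ofReal_lt_top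
  · filter_upwards [ae_restrict_mem (measurableSet_Ioo.prod MeasurableSet.univ)] with b hb
    exact mul_nonneg ((h.approx k).potential_nonneg _ _)
      ((h.approx k).nonneg _ _ hb.1.1.le (hb.1.2.le.trans hk))

/-- The absorption rate `U p` is integrable over space-time, by Fatou's lemma. -/
lemma integrableOn_mul (h : IsApproxLimit D U p₀ p W u) (hD : 0 < D)
    (hU : Continuous (Function.uncurry U)) (hU0 : ∀ t q, 0 ≤ U t q) (hp : Integrable p₀) {T : ℝ}
    (hT : 0 ≤ T) :
    IntegrableOn (fun b : ℝ × ℝ => U b.1 b.2 * p b.1 b.2) (Set.Ioo 0 T ×ˢ Set.univ) ∧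
    ∫⁻ b in Set.Ioo 0 T ×ˢ Set.univ, ENNReal.ofReal (U b.1 b.2 * p b.1 b.2) ≤
      ENNReal.ofReal ((∫ q, |p₀ q|) + 1) := by
  have hS : MeasurableSet (Set.Ioo 0 T ×ˢ (Set.univ : Set ℝ)) :=
    measurableSet_Ioo.prod MeasurableSet.univ
  have h1 : ∫⁻ b in Set.Ioo 0 T ×ˢ Set.univ, ENNReal.ofReal (U b.1 b.2 * p b.1 b.2) ≤
      ENNReal.ofReal ((∫ q, |p₀ q|) + 1) := by
    calc ∫⁻ b in Set.Ioo 0 T ×ˢ Set.univ, ENNReal.ofReal (U b.1 b.2 * p b.1 b.2)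
        = ∫⁻ b in Set.Ioo 0 T ×ˢ Set.univ,
            liminf (fun k => ENNReal.ofReal (W k b.1 b.2 * u k b.1 b.2)) atTop := by
          refine setLIntegral_congr_fun hS fun b hb => ?_
          exact ((ENNReal.tendsto_ofReal (h.tendsto_mul hb.1.1 b.2)).liminf_eq).symm
      _ ≤ liminf (fun k => ∫⁻ b in Set.Ioo 0 T ×ˢ Set.univ,
            ENNReal.ofReal (W k b.1 b.2 * u k b.1 b.2)) atTop :=
          lintegral_liminf_le fun k =>
            Measurable.ennreal_ofReal (h.approx k).continuous_mul.measurable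
      _ ≤ _ := by
          refine liminf_le_of_frequently_le' (Eventually.frequently ?_)
          filter_upwards [tendsto_natCast_atTop_atTop.eventually_ge_atTop T] with k hk
          exact (h.approx_integrableOn hp hT hk).2
  refine ⟨⟨h.aestronglyMeasurable_mul hD hU hS (Set.prod_mono_left Set.Ioo_subset_Ioi_self), ?_⟩, h1⟩
  rw [hasFiniteIntegral_iff_ofReal]
  · exact h1.trans_lt ENNReal.ofReal_lt_top
  · filter_upwards [ae_restrict_mem hS] with b hb
    exact mul_nonneg (hU0 _ _) (h.nonneg hb.1.1 _)

/-- The Duhamel terms of the approximations converge: their densities converge pointwise with local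
bounds, while far away the kernel is small and the total mass is bounded. -/
lemma tendsto_duhamel (h : IsApproxLimit D U p₀ p W u) (hD : 0 < D)
    (hU : Continuous (Function.uncurry U)) (hU0 : ∀ t q, 0 ≤ U t q) (hp : Integrable p₀) {t s : ℝ}
    (ht : 0 < t) (hts : t < s) (q : ℝ) :
    Tendsto (fun k => ∫ b in Set.Ioo t s ×ˢ Set.univ,
      heatKernel D (s - b.1) (q - b.2) * (W k b.1 b.2 * u k b.1 b.2)) atTop
      (𝓝 (∫ b in Set.Ioo t s ×ˢ Set.univ,
        heatKernel D (s - b.1) (q - b.2) * (U b.1 b.2 * p b.1 b.2))) := by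
  set M : ℝ := (∫ q, |p₀ q|) + 1 with hM
  have hM0 : 0 ≤ M := by positivity
  have hs0 : 0 ≤ s := by linarith
  set S : Set (ℝ × ℝ) := Set.Ioo t s ×ˢ Set.univ with hSdef
  have hSm : MeasurableSet S := measurableSet_Ioo.prod MeasurableSet.univ
  have hST : S ⊆ Set.Ioo 0 s ×ˢ Set.univ := Set.prod_mono_left (Set.Ioo_subset_Ioo_left ht.le)
  obtain ⟨C, hC, hCb⟩ := exists_heatKernel_le_div_pow hD s
  -- the far part of a Duhamel integral
  have tail : ∀ (A : ℝ) (g : ℝ × ℝ → ℝ), 1 ≤ A →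
      IntegrableOn (fun b => heatKernel D (s - b.1) (q - b.2) * g b)
        (S ∩ {b | |q - b.2| ≤ A}) → IntegrableOn g S →
      (∀ b ∈ S, 0 ≤ g b) → ∫⁻ b in S, ENNReal.ofReal (g b) ≤ ENNReal.ofReal M →
      |(∫ b in S, heatKernel D (s - b.1) (q - b.2) * g b) -
        ∫ b in S ∩ {b | |q - b.2| ≤ A}, heatKernel D (s - b.1) (q - b.2) * g b| ≤
        C * s / A * M := by
    intro A g hA hi1 hg hg0 hgM
    have hAm : MeasurableSet {b : ℝ × ℝ | |q - b.2| ≤ A} :=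
      measurableSet_le (by fun_prop) measurable_const
    have hKb : ∀ b ∈ S \ {b | |q - b.2| ≤ A}, heatKernel D (s - b.1) (q - b.2) ≤ C * s / A := by
      rintro b ⟨hb, hbA⟩
      have hbA' : A < |q - b.2| := not_le.1 hbA
      have hne : q - b.2 ≠ 0 := by
        intro h0; rw [h0, abs_zero] at hbA'; linarith
      refine (hCb (s - b.1) (by linarith [hb.1.1]) _ hne).trans ?_
      have h1 : |s - b.1| ≤ s := by
        rw [abs_of_nonneg (by linarith [hb.1.2])]; linarith [hb.1.1]
      have h2 : A ≤ (q - b.2) ^ 4 := by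
        have h3 : A ^ 4 ≤ |q - b.2| ^ 4 := by gcongr
        rw [show |q - b.2| ^ 4 = (q - b.2) ^ 4 from Even.pow_abs (by decide) _] at h3
        exact (le_self_pow₀ hA (by norm_num)).trans h3
      gcongr
    have hgd : IntegrableOn g (S \ {b | |q - b.2| ≤ A}) := hg.mono_set Set.sdiff_subset
    have hi2 : IntegrableOn (fun b => heatKernel D (s - b.1) (q - b.2) * g b)
        (S \ {b | |q - b.2| ≤ A}) := by
      refine Integrable.bdd_mul (c := C * s / A) hgd ?_ ?_
      · exact ((measurable_heatKernel D).comp (f := fun b : ℝ × ℝ => (s - b.1, q - b.2))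
          (by fun_prop)).aestronglyMeasurable
      · filter_upwards [ae_restrict_mem (hSm.diff hAm)] with b hb
        rw [Real.norm_of_nonneg (heatKernel_nonneg _ _ _)]
        exact hKb b hb
    have hunion := setIntegral_union (μ := volume) (s := S ∩ {b | |q - b.2| ≤ A})
      (t := S \ {b | |q - b.2| ≤ A}) (f := fun b => heatKernel D (s - b.1) (q - b.2) * g b)
      (Set.disjoint_left.2 fun b hb hb' => hb'.2 hb.2) (hSm.diff hAm) hi1 hi2
    rw [Set.inter_union_sdiff] at hunion
    rw [hunion, add_sub_cancel_left, abs_of_nonneg (setIntegral_nonneg (hSm.diff hAm) fun b hb =>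
      mul_nonneg (heatKernel_nonneg _ _ _) (hg0 b hb.1))]
    calc ∫ b in S \ {b | |q - b.2| ≤ A}, heatKernel D (s - b.1) (q - b.2) * g b
        ≤ ∫ b in S \ {b | |q - b.2| ≤ A}, C * s / A * g b := by
          refine setIntegral_mono_on hi2 (hgd.const_mul _) (hSm.diff hAm) fun b hb => ?_
          exact mul_le_mul_of_nonneg_right (hKb b hb) (hg0 b hb.1)
      _ = C * s / A * ∫ b in S \ {b | |q - b.2| ≤ A}, g b := integral_const_mul _ _
      _ ≤ C * s / A * ∫ b in S, g b := by
          gcongr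
          · filter_upwards [ae_restrict_mem hSm] with b hb using hg0 b hb
          · exact Set.sdiff_subset
      _ ≤ _ := by
          gcongr
          exact setIntegral_le_of_lintegral_le hSm hg hg0 hM0 hgM
  have hKi := integrableOn_heatKernel_reflect hD t s q
  have hfS := h.integrableOn_mul hD hU hU0 hp hs0
  -- local bound on the densities
  have hloc : ∀ A : ℝ, ∃ B : ℝ, 0 ≤ B ∧ ∀ᶠ k : ℕ in atTop, ∀ b ∈ S ∩ {b | |q - b.2| ≤ A},
      |W k b.1 b.2 * u k b.1 b.2| ≤ B := by
    intro A
    obtain ⟨B, hB⟩ := (isCompact_Icc.prod isCompact_Icc :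
      IsCompact (Set.Icc t s ×ˢ Set.Icc (q - A) (q + A))).exists_bound_of_continuousOn
        hU.continuousOn
    set A' := (Real.sqrt (2 * Real.pi * D * t))⁻¹ * M with hA'
    have hA'0 : 0 ≤ A' := by positivity
    refine ⟨|B| * A', by positivity, ?_⟩
    filter_upwards [tendsto_natCast_atTop_atTop.eventually_ge_atTop s,
      tendsto_natCast_atTop_atTop.eventually_ge_atTop (|q| + A)] with k h1 h2
    rintro b ⟨hb, hbA⟩
    have hb0 : 0 ≤ b.1 := by linarith [hb.1.1]
    have hbk : b.1 ≤ k := by linarith [hb.1.2]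
    have hb2 : |b.2| ≤ k := by
      have := abs_sub_abs_le_abs_sub b.2 q
      rw [abs_sub_comm] at this
      have hbA' : |q - b.2| ≤ A := hbA
      linarith
    rw [(h.approx k).potential_eq _ _ hb0 hbk hb2, abs_mul,
      abs_of_nonneg ((h.approx k).nonneg _ b.2 hb0 hbk)]
    refine mul_le_mul ?_ (h.approx_le hD hp ht hb.1.1.le hbk _)
      ((h.approx k).nonneg _ b.2 hb0 hbk) (abs_nonneg _)
    have hbA' := abs_le.1 (show |q - b.2| ≤ A from hbA)
    exact (hB b ⟨⟨hb.1.1.le, hb.1.2.le⟩, by constructor <;> linarith⟩).trans (le_abs_self B)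
  have hAm : ∀ A : ℝ, MeasurableSet {b : ℝ × ℝ | |q - b.2| ≤ A} := fun A =>
    measurableSet_le (by fun_prop) measurable_const
  have hnear : ∀ A : ℝ, IntegrableOn (fun b => heatKernel D (s - b.1) (q - b.2) *
        (U b.1 b.2 * p b.1 b.2)) (S ∩ {b | |q - b.2| ≤ A}) ∧
      Tendsto (fun k => ∫ b in S ∩ {b | |q - b.2| ≤ A},
      heatKernel D (s - b.1) (q - b.2) * (W k b.1 b.2 * u k b.1 b.2)) atTop
      (𝓝 (∫ b in S ∩ {b | |q - b.2| ≤ A},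
        heatKernel D (s - b.1) (q - b.2) * (U b.1 b.2 * p b.1 b.2))) := by
    intro A
    obtain ⟨B, hB0, hB⟩ := hloc A
    have hKi' : IntegrableOn (fun b : ℝ × ℝ => heatKernel D (s - b.1) (q - b.2))
      (S ∩ {b | |q - b.2| ≤ A}) := hKi.mono_set Set.inter_subset_left
    have hlimf : ∀ b ∈ S, Tendsto (fun k => heatKernel D (s - b.1) (q - b.2) *
        (W k b.1 b.2 * u k b.1 b.2)) atTop (𝓝 (heatKernel D (s - b.1) (q - b.2) *
        (U b.1 b.2 * p b.1 b.2))) := fun b hb =>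
      (h.tendsto_mul (ht.trans hb.1.1) b.2).const_mul _
    constructor
    · refine Integrable.mul_bdd (c := B) hKi' ?_ ?_
      · exact h.aestronglyMeasurable_mul hD hU (hSm.inter (hAm A)) (Set.inter_subset_left.trans
          (hST.trans (Set.prod_mono_left Set.Ioo_subset_Ioi_self)))
      · filter_upwards [ae_restrict_mem (hSm.inter (hAm A))] with b hb
        refine le_of_tendsto (h.tendsto_mul (ht.trans hb.1.1.1) b.2).norm ?_
        filter_upwards [hB] with k hk using hk b hb
    · refine tendsto_integral_filter_of_dominated_convergence
        (fun b => heatKernel D (s - b.1) (q - b.2) * B) ?_ ?_ (hKi'.mul_const B) ?_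
      · refine Eventually.of_forall fun k => hKi'.aestronglyMeasurable.mul ?_
        exact (h.approx k).continuous_mul.aestronglyMeasurable
      · filter_upwards [hB] with k hk
        filter_upwards [ae_restrict_mem (hSm.inter (hAm A))] with b hb
        rw [norm_mul, Real.norm_of_nonneg (heatKernel_nonneg _ _ _)]
        exact mul_le_mul_of_nonneg_left (hk b hb) (heatKernel_nonneg _ _ _)
      · filter_upwards [ae_restrict_mem (hSm.inter (hAm A))] with b hb using hlimf b hb.1
  rw [Metric.tendsto_atTop']
  intro ρ hρ
  obtain ⟨A, hA1, hAρ⟩ : ∃ A : ℝ, 1 ≤ A ∧ C * s / A * M < ρ / 4 := by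
    refine ⟨C * s * M / (ρ / 4) + 1, ?_, ?_⟩
    · have : 0 ≤ C * s * M / (ρ / 4) := by positivity
      linarith
    · rw [div_mul_eq_mul_div, div_lt_iff₀ (by positivity)]
      have : ρ / 4 * (C * s * M / (ρ / 4) + 1) = C * s * M + ρ / 4 := by field_simp
      linarith
  have e1 := (Metric.tendsto_nhds.1 (hnear A).2 (ρ / 4) (by positivity))
  obtain ⟨N, hN⟩ := (e1.and (tendsto_natCast_atTop_atTop.eventually_ge_atTop s)).exists_forall_of_atTop
  refine ⟨N, fun k hk => ?_⟩
  obtain ⟨hk1, hk2⟩ := hN k hk.le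
  obtain ⟨a1, a2⟩ := h.approx_integrableOn hp hs0 hk2
  obtain ⟨C', hC'⟩ := (h.approx k).bounded_mul
  have t1 := tail A (fun b => W k b.1 b.2 * u k b.1 b.2) hA1
    (Integrable.mul_bdd (c := C') (hKi.mono_set Set.inter_subset_left)
      (h.approx k).continuous_mul.aestronglyMeasurable (ae_of_all _ fun b => hC' _ _))
    (a1.mono_set hST)
    (fun b hb => mul_nonneg ((h.approx k).potential_nonneg _ _) ((h.approx k).nonneg _ _
      (by linarith [hb.1.1]) (by linarith [hb.1.2])))
    ((lintegral_mono_set hST).trans a2)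
  have t2 := tail A (fun b => U b.1 b.2 * p b.1 b.2) hA1 (hnear A).1 (hfS.1.mono_set hST)
    (fun b hb => mul_nonneg (hU0 _ _) (h.nonneg (ht.trans hb.1.1) _))
    ((lintegral_mono_set hST).trans hfS.2)
  rw [Real.dist_eq] at hk1 ⊢
  rw [abs_lt] at hk1 ⊢
  rw [abs_le] at t1 t2
  constructor <;> linarith [hk1.1, hk1.2, t1.1, t1.2, t2.1, t2.2]

lemma continuous_slice (h : IsApproxLimit D U p₀ p W u) (hD : 0 < D) {t : ℝ} (ht : 0 < t) :
    Continuous (p t) := continuous_iff_continuousAt.2 fun q =>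
  ContinuousAt.comp (f := fun y : ℝ => (t, y)) (g := Function.uncurry p) (h.continuousAt hD ht q)
    (by fun_prop)

/-- The mild form of the imaginary-time Schrödinger equation. -/
theorem mild (h : IsApproxLimit D U p₀ p W u) (hD : 0 < D)
    (hU : Continuous (Function.uncurry U)) (hU0 : ∀ t q, 0 ≤ U t q) (hp : Integrable p₀) {t s : ℝ}
    (ht : 0 < t) (hts : t < s) (q : ℝ) :
    p s q = heat D (s - t) (p t) q - ∫ b in Set.Ioo t s ×ˢ Set.univ,
        heatKernel D (s - b.1) (q - b.2) * (U b.1 b.2 * p b.1 b.2) := by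
  have h1 : Tendsto (fun k => heat D (s - t) (u k t) q) atTop (𝓝 (heat D (s - t) (p t) q)) := by
    refine tendsto_integral_filter_of_dominated_convergence
      (fun _ => (Real.sqrt (2 * Real.pi * D * t))⁻¹ * ((∫ q, |p₀ q|) + 1)) ?_ ?_
      (integrable_const _) ?_
    · refine Eventually.of_forall fun k => ?_
      exact ((continuous_uncurry_right (h.approx k).continuous t).comp
        (by fun_prop)).aestronglyMeasurable
    · filter_upwards [tendsto_natCast_atTop_atTop.eventually_ge_atTop t] with k hk
      refine ae_of_all _ fun z => ?_
      rw [Real.norm_of_nonneg ((h.approx k).nonneg _ _ ht.le hk)]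
      exact h.approx_le hD hp ht le_rfl hk _
    · exact ae_of_all _ fun z => h.tendsto ht _
  refine tendsto_nhds_unique (h.tendsto (ht.trans hts) q)
    ((h1.sub (h.tendsto_duhamel hD hU hU0 hp ht hts q)).congr' ?_)
  filter_upwards [tendsto_natCast_atTop_atTop.eventually_ge_atTop s] with k hk
  obtain ⟨C, hC⟩ := (h.approx k).bounded_mul
  have h2 := (h.approx k).mild t (s - t) ht.le (by linarith) (by linarith) q
  have h3 := (integral_heat_eq_setIntegral (t := t) (h := s - t) hD (h.approx k).continuous_mul hC
    (by linarith) q).2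
  rw [h3] at h2
  simp only [add_sub_cancel] at h2
  exact h2.symm

end IsApproxLimit

/-! ### Strict positivity -/

/-- The limit of the split-step schemes is positive: paths confined to `|q| ≤ R` carry a
contribution of at least `exp(-t sup U)` times half of the free heat flow, once `R` is large. -/
theorem limit_splitStep_pos {D : ℝ} (hD : 0 < D) {U : ℝ → ℝ → ℝ}
    (hU : Continuous (Function.uncurry U)) (hU0 : ∀ t q, 0 ≤ U t q) {p₀ : ℝ → ℝ}
    (hp : Integrable p₀) (hp0 : ∀ q, 0 ≤ p₀ q) (hp1 : 0 < ∫ q, p₀ q) {t l : ℝ} (ht : 0 < t) (q : ℝ)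
    (hl : Tendsto (fun N : ℕ => splitStep D (t / N) (potentialFactor U (t / N)) p₀ N q) atTop
      (𝓝 l)) : 0 < l := by
  -- A smaller prior gives a smaller limit, so the prior may be taken bounded.
  set φ : ℝ → ℝ := fun y => min (p₀ y) 1 with hφ
  have hφ0 : ∀ y, 0 ≤ φ y := fun y => le_min (hp0 y) zero_le_one
  have hφ1 : ∀ y, φ y ≤ 1 := fun y => min_le_right _ _
  have hφi : Integrable φ := by
    refine hp.mono (hp.aestronglyMeasurable.inf aestronglyMeasurable_const)
      (ae_of_all _ fun y => ?_)
    rw [Real.norm_of_nonneg (hφ0 y), Real.norm_of_nonneg (hp0 y)]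
    exact min_le_left _ _
  have hφpos : 0 < ∫ y, φ y := by
    rw [integral_pos_iff_support_of_nonneg hφ0 hφi]
    rw [integral_pos_iff_support_of_nonneg hp0 hp] at hp1
    refine hp1.trans_le (measure_mono fun y hy => ?_)
    have : 0 < p₀ y := lt_of_le_of_ne (hp0 y) (Ne.symm hy)
    exact (lt_min this one_pos).ne'
  set G := heat D t φ q with hG
  have hGpos : 0 < G := heat_pos hD ht hφi hφ0 hφpos q
  -- By the `cosh` estimate, leaving `|q| ≤ R` costs at most half of the heat flow `G`.
  set R : ℝ := max 0 (2 * Real.exp (D * t / 2) * Real.cosh q / G) with hR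
  have hR0 : 0 ≤ R := le_max_left _ _
  obtain ⟨K, hK⟩ := (isCompact_Icc.prod isCompact_Icc :
    IsCompact (Set.Icc 0 t ×ˢ Set.Icc (-R) R)).exists_bound_of_continuousOn hU.continuousOn
  set b : ℕ → ℝ → ℝ := fun _ => (Set.Icc (-R) R).indicator fun _ => 1 with hb
  have hbm : ∀ n, Measurable (b n) := fun n => measurable_const.indicator measurableSet_Icc
  have hb0 : ∀ n y, 0 ≤ b n y := fun n y => Set.indicator_nonneg (fun _ _ => zero_le_one) y
  have hb1 : ∀ n y, b n y ≤ 1 := fun n y =>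
    Set.indicator_le_self' (f := fun _ => (1 : ℝ)) (fun _ _ => zero_le_one) y
  have key : Real.exp (-t * K) * (G / 2) ≤ l := by
    refine ge_of_tendsto hl ?_
    filter_upwards [eventually_gt_atTop 0] with N hN
    have hN0 : (0 : ℝ) < N := by exact_mod_cast hN
    have hε : 0 < t / N := by positivity
    have hNε : (N : ℝ) * (t / N) = t := by field_simp
    have m1 := measurable_potentialFactor hU (t / N)
    have m2 := potentialFactor_nonneg U (t / N)
    have m3 := potentialFactor_le_one hU0 hε.le
    have s1 : splitStep D (t / N) (potentialFactor U (t / N)) φ N q ≤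
        splitStep D (t / N) (potentialFactor U (t / N)) p₀ N q := by
      have e := congrFun (splitStep_sub hD hε m1 m2 m3 hp hφi N) q
      have := splitStep_nonneg (D := D) (ε := t / N) m2 (f := fun y => p₀ y - φ y)
        (fun y => sub_nonneg.2 (min_le_left _ _)) N q
      linarith
    have s2 : Real.exp (-(t / N) * K) ^ N * splitStep D (t / N) b φ N q ≤
        splitStep D (t / N) (potentialFactor U (t / N)) φ N q := by
      refine pow_mul_splitStep_le hD hε m1 m2 m3 hbm hb0 hb1 (Real.exp_pos _).le hφi hφ0
        (N := N) (fun n hn y => ?_) N le_rfl q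
      by_cases hy : y ∈ Set.Icc (-R) R
      · simp only [hb, Set.indicator_of_mem hy, mul_one, potentialFactor]
        have hnt : (n : ℝ) * (t / N) ≤ t := by
          have : (n : ℝ) ≤ N := by exact_mod_cast hn
          calc (n : ℝ) * (t / N) ≤ N * (t / N) := by gcongr
            _ = t := hNε
        have h1 := (le_abs_self _).trans (hK (n * (t / N), y) ⟨⟨by positivity, hnt⟩, hy⟩)
        simp only [Function.uncurry] at h1
        exact Real.exp_le_exp.2 (by nlinarith)
      · simp only [hb, Set.indicator_of_notMem hy, mul_zero]
        exact m2 n y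
    have s3 : G / 2 ≤ splitStep D (t / N) b φ N q := by
      have h1 := abs_splitStep_sub_le_cosh (a := b) (b := fun _ _ => (1 : ℝ)) (R := R) (C := 1) hR0
        hD hε hbm hb0 hb1 (fun _ => measurable_const) (fun _ _ => zero_le_one) (fun _ _ => le_rfl)
        hφi hφ0 hφ1 (N := N) (fun n _ y hy => by
          exact Set.indicator_of_mem (Set.mem_Icc.2 (abs_le.1 hy)) _) N le_rfl q
      rw [splitStep_one hD hε hφi, hNε] at h1
      have h2 : 2 * Real.exp (D * t / 2) * Real.cosh q / G ≤ Real.cosh R :=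
        (le_max_right _ _).trans (self_le_cosh R)
      have h3 : 1 / Real.cosh R * Real.exp (D * t / 2) * Real.cosh q ≤ G / 2 := by
        rw [div_le_iff₀ hGpos] at h2
        rw [show 1 / Real.cosh R * Real.exp (D * t / 2) * Real.cosh q =
          Real.exp (D * t / 2) * Real.cosh q / Real.cosh R by ring,
          div_le_iff₀ (Real.cosh_pos R)]
        linarith
      have := (abs_le.1 h1).1
      linarith
    have e : Real.exp (-(t / N) * K) ^ N = Real.exp (-t * K) := by
      rw [← Real.exp_nat_mul]
      congr 1
      field_simp
    rw [e] at s2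
    calc Real.exp (-t * K) * (G / 2) ≤ Real.exp (-t * K) * splitStep D (t / N) b φ N q := by
          gcongr
      _ ≤ _ := s2.trans s1
  exact lt_of_lt_of_le (by positivity) key

/-! ### Spatial regularity of the limit -/

/-- `φ` is a cutoff in space-time near `(t₀, q₀)`, with spatial derivative `φ'`. It vanishes outside
the time interval `(t₀ / 2, t₀ + 1)`. -/
structure IsCutoff (t₀ q₀ δ : ℝ) (φ φ' : ℝ × ℝ → ℝ) : Prop where
  continuous : Continuous φ
  continuous_deriv : Continuous φ'
  hasCompactSupport : HasCompactSupport φ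
  hasCompactSupport_deriv : HasCompactSupport φ'
  hasDerivAt : ∀ r y, HasDerivAt (fun z => φ (r, z)) (φ' (r, y)) y
  eq_zero : ∀ b : ℝ × ℝ, b.1 ≤ t₀ / 2 ∨ t₀ + 1 ≤ b.1 → φ b = 0 ∧ φ' b = 0
  eq_one : ∀ b : ℝ × ℝ, |b.1 - t₀| < 2 * δ → |b.2 - q₀| < 2 * δ → φ b = 1
  nonneg : ∀ b, 0 ≤ φ b
  le_one : ∀ b, φ b ≤ 1

lemma exists_cutoff {t₀ : ℝ} (ht₀ : 0 < t₀) (q₀ : ℝ) :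
    ∃ δ φ φ', 0 < δ ∧ δ ≤ 1 ∧ 2 * δ ≤ t₀ / 2 ∧ IsCutoff t₀ q₀ δ φ φ' := by
  set r : ℝ := min (t₀ / 2) 1 with hr
  have hr0 : 0 < r := lt_min (by positivity) one_pos
  have hr1 : r ≤ t₀ / 2 := min_le_left _ _
  have hr2 : r ≤ 1 := min_le_right _ _
  let α : ContDiffBump t₀ := ⟨r / 2, r, by positivity, by linarith⟩
  let β : ContDiffBump q₀ := ⟨r / 2, r, by positivity, by linarith⟩
  have hβ : ContDiff ℝ 1 β := β.contDiff
  have hβ' : Continuous (deriv β) := hβ.continuous_deriv le_rfl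
  have hα0 : ∀ s : ℝ, s ≤ t₀ / 2 ∨ t₀ + 1 ≤ s → α s = 0 := by
    intro s hs
    refine α.zero_of_le_dist (?_ : r ≤ dist s t₀)
    rw [Real.dist_eq, le_abs]
    rcases hs with hs | hs
    · right; linarith
    · left; linarith
  have hsupp : ∀ γ : ℝ → ℝ, HasCompactSupport γ →
      HasCompactSupport (fun b : ℝ × ℝ => α b.1 * γ b.2) := by
    intro γ hγ
    refine HasCompactSupport.intro (α.hasCompactSupport.isCompact.prod hγ.isCompact) ?_
    intro b hb
    rw [Set.mem_prod, not_and_or] at hb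
    rcases hb with hb | hb
    · simp [image_eq_zero_of_notMem_tsupport hb]
    · simp [image_eq_zero_of_notMem_tsupport hb]
  refine ⟨r / 4, fun b => α b.1 * β b.2, fun b => α b.1 * deriv β b.2, by positivity, by linarith,
    by linarith, ?_⟩
  constructor
  · exact (α.continuous.comp continuous_fst).mul (β.continuous.comp continuous_snd)
  · exact (α.continuous.comp continuous_fst).mul (hβ'.comp continuous_snd)
  · exact hsupp _ β.hasCompactSupport
  · exact hsupp _ β.hasCompactSupport.deriv
  · intro s y
    have := (hβ.differentiable one_ne_zero y).hasDerivAt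
    exact this.const_mul (α s)
  · intro b hb
    simp [hα0 b.1 hb]
  · intro b h1 h2
    have e1 : α b.1 = 1 := α.one_of_mem_closedBall (by
      rw [Metric.mem_closedBall, Real.dist_eq]
      change _ ≤ r / 2
      linarith)
    have e2 : β b.2 = 1 := β.one_of_mem_closedBall (by
      rw [Metric.mem_closedBall, Real.dist_eq]
      change _ ≤ r / 2
      linarith)
    simp [e1, e2]
  · exact fun b => mul_nonneg α.nonneg β.nonneg
  · exact fun b => mul_le_one₀ α.le_one β.nonneg β.le_one

lemma continuous_mul_of_eq_zero {τ : ℝ} (hτ : 0 < τ) {φ G : ℝ × ℝ → ℝ} (hφ : Continuous φ)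
    (h0 : ∀ b : ℝ × ℝ, b.1 ≤ τ → φ b = 0) (hG : ∀ b : ℝ × ℝ, 0 < b.1 → ContinuousAt G b) :
    Continuous (fun b => φ b * G b) := by
  rw [continuous_iff_continuousAt]
  intro b
  rcases lt_or_ge 0 b.1 with hb | hb
  · exact hφ.continuousAt.mul (hG b hb)
  · refine (continuousAt_const (y := (0 : ℝ))).congr ?_
    filter_upwards [continuous_fst.continuousAt.eventually_lt continuousAt_const
      (lt_of_le_of_lt hb hτ)] with c hc
    simp [h0 c hc.le]

namespace IsApproxLimit

variable {D : ℝ} {U : ℝ → ℝ → ℝ} {p₀ : ℝ → ℝ} {p : ℝ → ℝ → ℝ} {W u : ℕ → ℝ → ℝ → ℝ}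

lemma le_heat (h : IsApproxLimit D U p₀ p W u) (hD : 0 < D) (hp : Integrable p₀) {t : ℝ}
    (ht : 0 < t) (q : ℝ) : p t q ≤ heat D t p₀ q := by
  set A := (Real.sqrt (2 * Real.pi * D * t))⁻¹ with hA
  have hlim : Tendsto (fun k : ℕ => heat D t p₀ q + A / ((k : ℝ) + 1)) atTop
      (𝓝 (heat D t p₀ q + 0)) := tendsto_const_nhds.add
    (tendsto_const_nhds.div_atTop (tendsto_atTop_add_const_right _ _ tendsto_natCast_atTop_atTop))
  rw [add_zero] at hlim
  refine le_of_tendsto_of_tendsto (h.tendsto ht q) hlim ?_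
  filter_upwards [tendsto_natCast_atTop_atTop.eventually_ge_atTop t] with k hk
  have hi := (h.approx k).integrable_zero
  have h1 := (h.approx k).le_heat t q ht.le hk
  have h2 := heat_sub ht (heatIntegrable_of_integrable hD hi) (heatIntegrable_of_integrable hD hp) q
  have h3 := (le_abs_self _).trans (abs_heat_le_integral hD ht (hi.sub hp) q)
  have h4 : A * ∫ q, |u k 0 q - p₀ q| ≤ A * (1 / (k + 1)) := by
    gcongr
    exact h.initial k
  rw [mul_one_div] at h4
  simp only [Pi.sub_apply] at h3
  change heat D t (fun y => u k 0 y - p₀ y) q ≤ _ at h3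
  linarith

lemma integrable_slice (h : IsApproxLimit D U p₀ p W u) (hD : 0 < D) (hp : Integrable p₀) {t : ℝ}
    (ht : 0 < t) : Integrable (p t) := by
  refine (integrable_heat hD ht.le hp).mono' (h.continuous_slice hD ht).aestronglyMeasurable
    (ae_of_all _ fun q => ?_)
  rw [Real.norm_of_nonneg (h.nonneg ht q)]
  exact h.le_heat hD hp ht q

/-- Near `(t₀, q₀)` the limit is, up to heat potentials `H` of densities supported away from
`(t₀, q₀)`, minus the heat potential of a cutoff of `U p`. -/
lemma exists_local_representation (h : IsApproxLimit D U p₀ p W u) (hD : 0 < D)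
    (hU : Continuous (Function.uncurry U)) (hU0 : ∀ t q, 0 ≤ U t q) (hp : Integrable p₀) {t₀ : ℝ}
    (ht₀ : 0 < t₀) (q₀ : ℝ) :
    ∃ (δ : ℝ) (φ φ' : ℝ × ℝ → ℝ) (H : ℕ → ℝ → ℝ → ℝ), 0 < δ ∧ IsCutoff t₀ q₀ δ φ φ' ∧
      ∀ t q, |t - t₀| < δ → |q - q₀| < δ →
        (∀ i, ContinuousAt (fun a : ℝ × ℝ => H i a.1 a.2) (t, q)) ∧
        (∀ i < 2, HasDerivAt (H i t) (H (i + 1) t q) q) ∧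
        p t q = H 0 t q - spaceTimeConv (fun a => heatKernel D a.1 a.2)
          (fun b => φ b * (U b.1 b.2 * p b.1 b.2)) (t, q) := by
  obtain ⟨δ, φ, φ', hδ, hδ1, hδt, hφ⟩ := exists_cutoff ht₀ q₀
  set s : ℝ := t₀ / 2 with hs
  have hs0 : 0 < s := by positivity
  set S : Set (ℝ × ℝ) := Set.Ioo s (t₀ + 1) ×ˢ Set.univ with hS
  have hSm : MeasurableSet S := measurableSet_Ioo.prod MeasurableSet.univ
  set G : ℝ × ℝ → ℝ := fun b => U b.1 b.2 * p b.1 b.2 with hG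
  have hGc : ∀ b : ℝ × ℝ, 0 < b.1 → ContinuousAt G b := fun b hb =>
    hU.continuousAt.mul (h.continuousAt hD hb b.2)
  have hFc : Continuous (fun b => φ b * G b) :=
    continuous_mul_of_eq_zero hs0 hφ.continuous (fun b hb => (hφ.eq_zero b (Or.inl hb)).1) hGc
  have hFs : HasCompactSupport (fun b => φ b * G b) := hφ.hasCompactSupport.mul_right
  have hGi : IntegrableOn G S := (h.integrableOn_mul hD hU hU0 hp (T := t₀ + 1) (by linarith)).1.mono_set
    (Set.prod_mono_left (Set.Ioo_subset_Ioo_left hs0.le))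
  set g : ℝ × ℝ → ℝ := S.indicator (fun b => (1 - φ b) * G b) with hg
  have hgi : Integrable g := by
    rw [hg, integrable_indicator_iff hSm]
    refine Integrable.bdd_mul (c := 1) hGi ?_ (ae_of_all _ fun b => ?_)
    · exact (continuous_const.sub hφ.continuous).aestronglyMeasurable
    · rw [Real.norm_of_nonneg (sub_nonneg.2 (hφ.le_one b))]
      linarith [hφ.nonneg b]
  have hgT : ∀ b, g b ≠ 0 → |b.1| ≤ t₀ + 1 := by
    intro b hb
    have hbS : b ∈ S := Set.mem_of_indicator_ne_zero hb
    rw [abs_of_nonneg (hs0.le.trans hbS.1.1.le)]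
    exact hbS.1.2.le
  have hgfar : ∀ b, g b ≠ 0 → 2 * δ ≤ |t₀ - b.1| ∨ 2 * δ ≤ |q₀ - b.2| := by
    intro b hb
    by_contra! hc
    rw [abs_sub_comm t₀, abs_sub_comm q₀] at hc
    refine hb ?_
    have : (1 - φ b) * G b = 0 := by rw [hφ.eq_one b hc.1 hc.2]; ring
    by_cases hbS : b ∈ S
    · rw [hg, Set.indicator_of_mem hbS, this]
    · rw [hg, Set.indicator_of_notMem hbS]
  refine ⟨δ, φ, φ', fun i t q => farPotential D volume (fun _ => s) id (p s) i t q -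
    farPotential D volume Prod.fst Prod.snd g i t q, hδ, hφ, fun t q ht hq => ?_⟩
  obtain ⟨c1, d1⟩ := farPotential_regular hD measurable_const measurable_id
    (h.integrable_slice hD hp hs0) (r := fun _ => s) (T := s) hδ
    (fun _ _ => (abs_of_pos hs0).le)
    (fun _ _ => Or.inl (by rw [show t₀ - s = s by rw [hs]; ring, abs_of_pos hs0]; exact hδt)) ht hq
  obtain ⟨c2, d2⟩ := farPotential_regular hD measurable_fst measurable_snd hgi hδ hgT hgfar ht hq
  refine ⟨fun i => (c1 i).sub (c2 i), fun i hi => (d1 i hi).sub (d2 i hi), ?_⟩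
  have ht' := abs_lt.1 ht
  have hst : s < t := by linarith
  have htT : t < t₀ + 1 := by linarith
  have l0 := locallyIntegrable_heatKernel hD
  have e1 : heat D (t - s) (p s) q = farPotential D volume (fun _ => s) id (p s) 0 t q :=
    heat_eq_integral hD (by linarith) q _
  -- The kernel vanishes for negative times, so the Duhamel integral may be extended to `S`.
  have e2 : ∫ b in Set.Ioo s t ×ˢ Set.univ, heatKernel D (t - b.1) (q - b.2) * G b =
      ∫ b in S, heatKernel D (t - b.1) (q - b.2) * G b := by
    refine (setIntegral_eq_of_subset_of_forall_sdiff_eq_zero hSm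
      (Set.prod_mono_left (Set.Ioo_subset_Ioo_right htT.le)) fun b hb => ?_).symm
    have : t ≤ b.1 := by
      by_contra! hc
      exact hb.2 ⟨⟨hb.1.1.1, hc⟩, trivial⟩
    rw [heatKernel_of_nonpos (by linarith), zero_mul]
  have i1 : Integrable (fun b : ℝ × ℝ => heatKernel D (t - b.1) (q - b.2) * (φ b * G b)) :=
    integrable_spaceTimeConv_swap l0 hFc hFs (t, q)
  have i2 : Integrable (fun b : ℝ × ℝ => heatKernel D (t - b.1) (q - b.2) * g b) := by
    obtain ⟨C, hC, hb⟩ := exists_heatKernelIter_le_of_far hD hδ (|t₀| + δ + (t₀ + 1))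
    refine (hgi.norm.const_mul C).mono' ?_ (ae_of_all _ fun b => ?_)
    · exact ((measurable_heatKernel D).comp (f := fun b : ℝ × ℝ => (t - b.1, q - b.2))
        (by fun_prop)).aestronglyMeasurable.mul hgi.aestronglyMeasurable
    by_cases hb0 : g b = 0
    · simp [hb0]
    rw [norm_mul]
    gcongr
    refine hb 0 _ ?_ _ ?_
    · have h1 := abs_sub_le t t₀ b.1
      have h2 := abs_sub t₀ b.1
      have h3 := hgT b hb0
      linarith
    · rcases hgfar b hb0 with h1 | h1
      · left
        have := abs_sub_le t₀ t b.1
        rw [abs_sub_comm t₀ t] at this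
        linarith
      · right
        have := abs_sub_le q₀ q b.2
        rw [abs_sub_comm q₀ q] at this
        linarith
  have e3 : ∫ b in S, heatKernel D (t - b.1) (q - b.2) * G b =
      spaceTimeConv (fun a => heatKernel D a.1 a.2) (fun b => φ b * G b) (t, q) +
        farPotential D volume Prod.fst Prod.snd g 0 t q := by
    rw [spaceTimeConv_eq_swap, farPotential, ← integral_indicator hSm]
    simp only [Prod.fst_sub, Prod.snd_sub, heatKernelIter]
    rw [← integral_add i1 i2]
    refine integral_congr_ae (ae_of_all _ fun b => ?_)
    by_cases hbS : b ∈ S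
    · simp only [hg, Set.indicator_of_mem hbS]
      ring
    · have : φ b = 0 := by
        refine (hφ.eq_zero b ?_).1
        by_contra! hc
        exact hbS ⟨⟨hc.1, hc.2⟩, trivial⟩
      simp only [hg, Set.indicator_of_notMem hbS, this]
      ring
  rw [h.mild hD hU hU0 hp hs0 hst q, e1, e2, e3]
  ring

/-- Away from time zero the limit is twice continuously differentiable in space. One derivative
comes from the heat kernel, whose derivative is still integrable in space-time. Since `U` is
differentiable, the density `U p` is then differentiable itself and takes the second one. -/
theorem exists_spatial_deriv (h : IsApproxLimit D U p₀ p W u) (hD : 0 < D)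
    (hU : Continuous (Function.uncurry U)) (hU0 : ∀ t q, 0 ≤ U t q) {U' : ℝ → ℝ → ℝ}
    (hUd : ∀ t q, HasDerivAt (U t) (U' t q) q) (hU' : Continuous (Function.uncurry U'))
    (hp : Integrable p₀) :
    ∃ p₁ p₂ : ℝ → ℝ → ℝ, ∀ t, 0 < t → ∀ q, ContinuousAt (Function.uncurry p₁) (t, q) ∧
      ContinuousAt (Function.uncurry p₂) (t, q) ∧ HasDerivAt (p t) (p₁ t q) q ∧
      HasDerivAt (p₁ t) (p₂ t q) q := by
  have l0 := locallyIntegrable_heatKernel hD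
  have l1 := locallyIntegrable_heatKernelDeriv hD
  have box : ∀ {δ : ℝ}, 0 < δ → ∀ t q : ℝ, ∀ᶠ a : ℝ × ℝ in 𝓝 (t, q),
      |a.1 - t| < δ ∧ |a.2 - q| < δ := by
    intro δ hδ t q
    have e1 : Continuous (fun a : ℝ × ℝ => |a.1 - t|) := by fun_prop
    have e2 : Continuous (fun a : ℝ × ℝ => |a.2 - q|) := by fun_prop
    exact (e1.continuousAt.eventually_lt continuousAt_const (by simpa)).and
      (e2.continuousAt.eventually_lt continuousAt_const (by simpa))
  have near : ∀ {δ q₀ q : ℝ}, |q - q₀| < δ → ∀ᶠ y in 𝓝 q, |y - q₀| < δ := by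
    intro δ q₀ q hq
    have e2 : Continuous (fun y : ℝ => |y - q₀|) := by fun_prop
    exact e2.continuousAt.eventually_lt continuousAt_const hq
  have hGc : ∀ b : ℝ × ℝ, 0 < b.1 → ContinuousAt (fun b : ℝ × ℝ => U b.1 b.2 * p b.1 b.2) b :=
    fun b hb => hU.continuousAt.mul (h.continuousAt hD hb b.2)
  have round1 : ∀ t, 0 < t → ∀ q, ContinuousAt (fun a : ℝ × ℝ => deriv (p a.1) a.2) (t, q) ∧
      HasDerivAt (p t) (deriv (p t) q) q := by
    intro t₀ ht₀ q₀
    obtain ⟨δ, φ, φ', H, hδ, hφ, hH⟩ := h.exists_local_representation hD hU hU0 hp ht₀ q₀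
    have hFc := continuous_mul_of_eq_zero (half_pos ht₀) hφ.continuous
      (fun b hb => (hφ.eq_zero b (Or.inl hb)).1) hGc
    have hFs : HasCompactSupport (fun b : ℝ × ℝ => φ b * (U b.1 b.2 * p b.1 b.2)) :=
      hφ.hasCompactSupport.mul_right
    have hd : ∀ t q, |t - t₀| < δ → |q - q₀| < δ → HasDerivAt (p t) (H 1 t q -
        spaceTimeConv (fun a => heatKernelDeriv D a.1 a.2)
          (fun b => φ b * (U b.1 b.2 * p b.1 b.2)) (t, q)) q := by
      intro t q ht hq
      refine (((hH t q ht hq).2.1 0 two_pos).sub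
        (hasDerivAt_heatPotential hD hFc hFs t q)).congr_of_eventuallyEq ?_
      filter_upwards [near hq] with y hy using (hH t y ht hy).2.2
    have h00 := hd t₀ q₀ (by simpa) (by simpa)
    refine ⟨?_, h00.differentiableAt.hasDerivAt⟩
    refine ((((hH t₀ q₀ (by simpa) (by simpa)).1 1).sub
      (continuous_spaceTimeConv l1 hFc hFs).continuousAt)).congr ?_
    filter_upwards [box hδ t₀ q₀] with a ha using (hd a.1 a.2 ha.1 ha.2).deriv.symm
  refine ⟨fun t => deriv (p t), fun t => deriv (deriv (p t)), fun t₀ ht₀ q₀ => ?_⟩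
  obtain ⟨δ, φ, φ', H, hδ, hφ, hH⟩ := h.exists_local_representation hD hU hU0 hp ht₀ q₀
  have hFc := continuous_mul_of_eq_zero (half_pos ht₀) hφ.continuous
    (fun b hb => (hφ.eq_zero b (Or.inl hb)).1) hGc
  have hFs : HasCompactSupport (fun b : ℝ × ℝ => φ b * (U b.1 b.2 * p b.1 b.2)) :=
    hφ.hasCompactSupport.mul_right
  set F' : ℝ × ℝ → ℝ := fun b => φ' b * (U b.1 b.2 * p b.1 b.2) +
    φ b * (U' b.1 b.2 * p b.1 b.2 + U b.1 b.2 * deriv (p b.1) b.2) with hF'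
  have hF'c : Continuous F' := by
    refine (continuous_mul_of_eq_zero (half_pos ht₀) hφ.continuous_deriv
      (fun b hb => (hφ.eq_zero b (Or.inl hb)).2) hGc).add
      (continuous_mul_of_eq_zero (half_pos ht₀) hφ.continuous
      (fun b hb => (hφ.eq_zero b (Or.inl hb)).1) fun b hb => ?_)
    exact (hU'.continuousAt.mul (h.continuousAt hD hb b.2)).add
      (hU.continuousAt.mul (round1 b.1 hb b.2).1)
  have hF's : HasCompactSupport F' :=
    hφ.hasCompactSupport_deriv.mul_right.add hφ.hasCompactSupport.mul_right
  have hFd : ∀ r y, HasDerivAt (fun z => φ (r, z) * (U r z * p r z)) (F' (r, y)) y := by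
    intro r y
    rcases le_or_gt r (t₀ / 2) with hr | hr
    · have : (fun z => φ (r, z) * (U r z * p r z)) = fun _ => 0 := by
        ext z; rw [(hφ.eq_zero (r, z) (Or.inl hr)).1, zero_mul]
      have e := hφ.eq_zero (r, y) (Or.inl hr)
      simp only [this, hF', e.1, e.2, zero_mul, add_zero]
      exact hasDerivAt_const y 0
    · exact (hφ.hasDerivAt r y).mul ((hUd r y).mul (round1 r (by linarith) y).2)
  have hd : ∀ t q, |t - t₀| < δ → |q - q₀| < δ → deriv (p t) q = H 1 t q -
      spaceTimeConv (fun a => heatKernel D a.1 a.2) F' (t, q) := by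
    intro t q ht hq
    refine HasDerivAt.deriv ?_
    refine (((hH t q ht hq).2.1 0 two_pos).sub (hasDerivAt_spaceTimeConv l0
      (measurable_heatKernel D) hFc hFs hF'c hF's hFd t q)).congr_of_eventuallyEq ?_
    filter_upwards [near hq] with y hy using (hH t y ht hy).2.2
  have hd2 : ∀ t q, |t - t₀| < δ → |q - q₀| < δ → HasDerivAt (deriv (p t)) (H 2 t q -
      spaceTimeConv (fun a => heatKernelDeriv D a.1 a.2) F' (t, q)) q := by
    intro t q ht hq
    refine (((hH t q ht hq).2.1 1 one_lt_two).sub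
      (hasDerivAt_heatPotential hD hF'c hF's t q)).congr_of_eventuallyEq ?_
    filter_upwards [near hq] with y hy using hd t y ht hy
  have h00 := hd2 t₀ q₀ (by simpa) (by simpa)
  refine ⟨(round1 t₀ ht₀ q₀).1, ?_, (round1 t₀ ht₀ q₀).2, h00.differentiableAt.hasDerivAt⟩
  refine ((((hH t₀ q₀ (by simpa) (by simpa)).1 2).sub
    (continuous_spaceTimeConv l1 hF'c hF's).continuousAt)).congr ?_
  filter_upwards [box hδ t₀ q₀] with a ha using (hd2 a.1 a.2 ha.1 ha.2).deriv.symm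

end IsApproxLimit

/-! ### Short-time expansions and the time derivative -/

/-- The Taylor remainder of order two of a bounded function is quadratically bounded everywhere,
not only near the base point. -/
lemma exists_taylor_remainder {C : ℝ} {w w₁ : ℝ → ℝ} {w₂ q : ℝ} (hC : ∀ y, |w y| ≤ C)
    (h1 : ∀ y, HasDerivAt w (w₁ y) y) (h2 : HasDerivAt w₁ w₂ q) :
    ∃ R : ℝ → ℝ, (∀ z, w (q + z) = w q + w₁ q * z + w₂ / 2 * z ^ 2 + R z) ∧
      (R =o[𝓝 0] fun z => z ^ 2) ∧ ∃ B, ∀ z, |R z| ≤ B * z ^ 2 := by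
  set R : ℝ → ℝ := fun z => w (q + z) - w q - w₁ q * z - w₂ / 2 * z ^ 2 with hR
  have hR0 : R 0 = 0 := by simp [hR]
  have hRd : ∀ z, HasDerivAt R (w₁ (q + z) - w₁ q - w₂ * z) z := by
    intro z
    have a1 : HasDerivAt (fun z => w (q + z)) (w₁ (q + z)) z := (h1 (q + z)).comp_const_add q z
    have a2 : HasDerivAt (fun z => w₁ q * z) (w₁ q * 1) z := (hasDerivAt_id z).const_mul _
    have a3 : HasDerivAt (fun z : ℝ => w₂ / 2 * z ^ 2) (w₂ / 2 * (2 * z)) z := by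
      simpa using (hasDerivAt_pow 2 z).const_mul (w₂ / 2)
    refine (((a1.sub_const (w q)).sub a2).sub a3).congr_deriv ?_
    ring
  have hRd' : (fun z => w₁ (q + z) - w₁ q - w₂ * z) =o[𝓝 0] fun z : ℝ => (z - 0) ^ 1 := by
    have := hasDerivAt_iff_isLittleO_nhds_zero.1 h2
    simpa [mul_comm] using this
  have hRo : R =o[𝓝 0] fun z => z ^ 2 := by
    have := Convex.isLittleO_pow_succ_real (f := R) (s := Set.univ) (x₀ := 0) (n := 1)
      convex_univ (Set.mem_univ _) (fun z _ => (hRd z).hasDerivWithinAt)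
      (by rw [nhdsWithin_univ]; exact hRd')
    simpa [hR0, nhdsWithin_univ] using this
  refine ⟨R, fun z => by simp only [hR]; ring, hRo, ?_⟩
  obtain ⟨δ, hδ, hb⟩ := Metric.eventually_nhds_iff.1 (hRo.bound one_pos)
  refine ⟨1 + (2 * C / δ ^ 2 + |w₁ q| / δ + |w₂| / 2), fun z => ?_⟩
  have hC0 : 0 ≤ C := (abs_nonneg _).trans (hC 0)
  have hB : 0 ≤ 2 * C / δ ^ 2 + |w₁ q| / δ + |w₂| / 2 := by positivity
  rcases lt_or_ge |z| δ with hz | hz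
  · have := hb (y := z) (by rwa [Real.dist_eq, sub_zero])
    rw [Real.norm_eq_abs, Real.norm_of_nonneg (sq_nonneg z), one_mul] at this
    nlinarith [sq_nonneg z]
  · have hz2 : δ ^ 2 ≤ z ^ 2 := by rw [← sq_abs z]; gcongr
    have b1 : |w (q + z) - w q| ≤ 2 * C / δ ^ 2 * z ^ 2 := by
      have : |w (q + z) - w q| ≤ 2 * C := (abs_sub _ _).trans (by linarith [hC (q + z), hC q])
      refine this.trans ?_
      rw [div_mul_eq_mul_div, le_div_iff₀ (by positivity)]
      gcongr
    have b2 : |w₁ q * z| ≤ |w₁ q| / δ * z ^ 2 := by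
      rw [abs_mul, div_mul_eq_mul_div, le_div_iff₀ hδ, mul_assoc, ← sq_abs z, sq]
      gcongr
    have b3 : |w₂ / 2 * z ^ 2| = |w₂| / 2 * z ^ 2 := by
      rw [abs_mul, abs_div, abs_two, abs_of_nonneg (sq_nonneg z)]
    have b4 : |R z| ≤ |w (q + z) - w q| + |w₁ q * z| + |w₂ / 2 * z ^ 2| := by
      have e1 := abs_sub (w (q + z) - w q - w₁ q * z) (w₂ / 2 * z ^ 2)
      have e2 := abs_sub (w (q + z) - w q) (w₁ q * z)
      linarith
    nlinarith [sq_nonneg z]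

lemma tendsto_sqrt_mul (z : ℝ) : Tendsto (fun h : ℝ => Real.sqrt h * z) (𝓝[>] 0) (𝓝 0) := by
  have : Continuous (fun h : ℝ => Real.sqrt h * z) := by fun_prop
  have h0 := this.tendsto 0
  simp only [Real.sqrt_zero, zero_mul] at h0
  exact h0.mono_left nhdsWithin_le_nhds

/-- The generator of the heat flow is `(D / 2) ∂²`. -/
lemma tendsto_heat_sub_div {D C : ℝ} (hD : 0 < D) {w w₁ : ℝ → ℝ} {w₂ q : ℝ}
    (hC : ∀ y, |w y| ≤ C) (h1 : ∀ y, HasDerivAt w (w₁ y) y) (h2 : HasDerivAt w₁ w₂ q) :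
    Tendsto (fun h => (heat D h w q - w q) / h) (𝓝[>] 0) (𝓝 (D / 2 * w₂)) := by
  obtain ⟨R, hR, hRo, B, hB⟩ := exists_taylor_remainder hC h1 h2
  have hwc : Continuous w := continuous_iff_continuousAt.2 fun y => (h1 y).continuousAt
  have hRc : Continuous R := by
    have : R = fun z => w (q + z) - w q - w₁ q * z - w₂ / 2 * z ^ 2 := by
      ext z; rw [hR z]; ring
    rw [this]
    fun_prop
  have hsq := (integrable_sq_wienerLaw D)
  have hlim : Tendsto (fun h => ∫ z, R (Real.sqrt h * z) / h ∂(wienerLaw D)) (𝓝[>] 0)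
      (𝓝 (∫ _, (0 : ℝ) ∂(wienerLaw D))) := by
    refine tendsto_integral_filter_of_dominated_convergence (fun z => B * z ^ 2) ?_ ?_
      (hsq.const_mul B) (ae_of_all _ fun z => ?_)
    · refine Eventually.of_forall fun h => Continuous.aestronglyMeasurable ?_
      exact (hRc.comp (by fun_prop)).div_const h
    · filter_upwards [self_mem_nhdsWithin] with h hh
      have hh : 0 < h := hh
      refine ae_of_all _ fun z => ?_
      rw [Real.norm_eq_abs, abs_div, abs_of_pos hh, div_le_iff₀ hh]
      refine (hB _).trans (le_of_eq ?_)
      rw [mul_pow, Real.sq_sqrt hh.le]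
      ring
    · have := (hRo.comp_tendsto (tendsto_sqrt_mul z))
      have e : ((fun z : ℝ => z ^ 2) ∘ fun h => Real.sqrt h * z) =O[𝓝[>] 0] fun h : ℝ => h := by
        refine IsBigO.of_bound (z ^ 2) ?_
        filter_upwards [self_mem_nhdsWithin] with h hh
        have hh : 0 < h := hh
        simp only [Function.comp]
        rw [mul_pow, Real.sq_sqrt hh.le, Real.norm_of_nonneg (by positivity),
          Real.norm_of_nonneg hh.le]
        linarith
      exact (this.trans_isBigO e).tendsto_div_nhds_zero
  rw [integral_zero] at hlim
  have hlim2 := hlim.const_add (D / 2 * w₂)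
  rw [add_zero] at hlim2
  refine hlim2.congr' ?_
  filter_upwards [self_mem_nhdsWithin] with h hh
  have hh : 0 < h := hh
  have hRi : Integrable (fun z => R (Real.sqrt h * z)) (wienerLaw D) := by
    refine (hsq.const_mul (B * h)).mono' (hRc.comp (by fun_prop)).aestronglyMeasurable
      (ae_of_all _ fun z => (hB _).trans (le_of_eq ?_))
    rw [mul_pow, Real.sq_sqrt hh.le]
    ring
  have e : heat D h w q = w q + w₂ / 2 * h * D + ∫ z, R (Real.sqrt h * z) ∂(wienerLaw D) := by
    rw [heat]
    have : ∀ z, w (q + Real.sqrt h * z) =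
        w q + w₁ q * Real.sqrt h * z + w₂ / 2 * h * z ^ 2 + R (Real.sqrt h * z) := by
      intro z
      rw [hR, mul_pow, Real.sq_sqrt hh.le]
      ring
    simp only [this]
    have i1 := (integrable_id_wienerLaw D).const_mul (w₁ q * Real.sqrt h)
    have i2 := hsq.const_mul (w₂ / 2 * h)
    have i0 := integrable_const (w q) (μ := wienerLaw D)
    have i01 : Integrable (fun z => w q + w₁ q * Real.sqrt h * z) (wienerLaw D) := i0.add i1
    have i012 : Integrable (fun z => w q + w₁ q * Real.sqrt h * z + w₂ / 2 * h * z ^ 2)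
      (wienerLaw D) := i01.add i2
    rw [integral_add i012 hRi, integral_add i01 i2, integral_add i0 i1, integral_const_mul, integral_const_mul, integral_id_wienerLaw, integral_sq_wienerLaw hD]
    simp
  rw [e, integral_div]
  field_simp
  ring

/-- Absorption at the rate `v`, which need not be bounded, to first order in time. -/
lemma tendsto_heat_absorption {D C : ℝ} {v w : ℝ → ℝ} (hv : Continuous v)
    (hv0 : ∀ y, 0 ≤ v y) (hw : Continuous w) (hC : ∀ y, |w y| ≤ C) (q : ℝ) :
    Tendsto (fun h => heat D h (fun y => (1 - Real.exp (-h * v y)) / h * w y) q) (𝓝[>] 0)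
      (𝓝 (v q * w q)) := by
  have hC0 : 0 ≤ C := (abs_nonneg _).trans (hC 0)
  obtain ⟨B, hB⟩ := (isCompact_Icc : IsCompact (Set.Icc (q - 1) (q + 1))).exists_bound_of_continuousOn
    hv.continuousOn
  have hB0 : 0 ≤ B := (norm_nonneg _).trans (hB q ⟨by linarith, by linarith⟩)
  have hup : ∀ h y, 0 < h → (1 - Real.exp (-h * v y)) / h ≤ v y := by
    intro h y hh
    rw [div_le_iff₀ hh]
    have := Real.add_one_le_exp (-h * v y)
    linarith
  have hnn : ∀ h y, 0 < h → 0 ≤ (1 - Real.exp (-h * v y)) / h := by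
    intro h y hh
    refine div_nonneg (sub_nonneg.2 (Real.exp_le_one_iff.2 ?_)) hh.le
    have := mul_nonneg hh.le (hv0 y)
    linarith
  have hlow : ∀ h y, 0 < h → v y - h * v y ^ 2 ≤ (1 - Real.exp (-h * v y)) / h := by
    intro h y hh
    have hx : 0 ≤ h * v y := mul_nonneg hh.le (hv0 y)
    have h1 : Real.exp (-h * v y) * (1 + h * v y) ≤ 1 := by
      have h2 : 1 + h * v y ≤ Real.exp (h * v y) := by
        linarith [Real.add_one_le_exp (h * v y)]
      calc Real.exp (-h * v y) * (1 + h * v y)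
          ≤ Real.exp (-h * v y) * Real.exp (h * v y) := by gcongr
        _ = 1 := by rw [← Real.exp_add]; simp
    have h3 : 0 ≤ (1 - h * v y + (h * v y) ^ 2 - Real.exp (-h * v y)) := by
      have h4 : Real.exp (-h * v y) ≤ 1 / (1 + h * v y) := by rwa [le_div_iff₀ (by linarith)]
      have h5 : 1 / (1 + h * v y) ≤ 1 - h * v y + (h * v y) ^ 2 := by
        rw [div_le_iff₀ (by linarith)]
        have : 0 ≤ (h * v y) ^ 3 := by positivity
        linarith [show (1 - h * v y + (h * v y) ^ 2) * (1 + h * v y) = 1 + (h * v y) ^ 3 by ring]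
      linarith
    rw [le_div_iff₀ hh]
    linarith [show (v y - h * v y ^ 2) * h = h * v y - (h * v y) ^ 2 by ring]
  have key : Tendsto (fun h => heat D h (fun y => (1 - Real.exp (-h * v y)) / h * w y) q) (𝓝[>] 0)
      (𝓝 (∫ _, v q * w q ∂(wienerLaw D))) := by
    refine tendsto_integral_filter_of_dominated_convergence (fun z => (B + z ^ 2) * C) ?_ ?_
      (((integrable_const B).add (integrable_sq_wienerLaw D)).mul_const C)
      (ae_of_all _ fun z => ?_)
    · refine Eventually.of_forall fun h => Continuous.aestronglyMeasurable ?_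
      fun_prop
    · filter_upwards [self_mem_nhdsWithin] with h hh
      have hh : 0 < h := hh
      refine ae_of_all _ fun z => ?_
      rw [norm_mul, Real.norm_of_nonneg (hnn h _ hh)]
      refine mul_le_mul ?_ (hC _) (norm_nonneg _) (by positivity)
      rcases le_or_gt |Real.sqrt h * z| 1 with hz | hz
      · have hz' := abs_le.1 hz
        have := (le_abs_self _).trans (hB (q + Real.sqrt h * z) ⟨by linarith, by linarith⟩)
        have := hup h (q + Real.sqrt h * z) hh
        nlinarith [sq_nonneg z]
      -- Far from `q` the trivial bound `1 / h` is at most `z ^ 2`.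
      · have h1 : (1 - Real.exp (-h * v (q + Real.sqrt h * z))) / h ≤ 1 / h := by
          gcongr
          linarith [Real.exp_pos (-h * v (q + Real.sqrt h * z))]
        have h2 : 1 < h * z ^ 2 := by
          have : 1 < |Real.sqrt h * z| ^ 2 := one_lt_pow₀ hz two_ne_zero
          rwa [sq_abs, mul_pow, Real.sq_sqrt hh.le] at this
        have h3 : 1 / h ≤ z ^ 2 := by
          rw [div_le_iff₀ hh]; linarith
        linarith
    · have hy : Tendsto (fun h : ℝ => q + Real.sqrt h * z) (𝓝[>] 0) (𝓝 q) := by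
        simpa using (tendsto_sqrt_mul z).const_add q
      have tv := (hv.tendsto q).comp hy
      have tw := (hw.tendsto q).comp hy
      refine Tendsto.mul ?_ tw
      have th : Tendsto (fun h : ℝ => h) (𝓝[>] 0) (𝓝 0) := tendsto_id.mono_left nhdsWithin_le_nhds
      have tl := tv.sub (th.mul (tv.pow 2))
      simp only [zero_mul, sub_zero] at tl
      refine tendsto_of_tendsto_of_tendsto_of_le_of_le' tl tv ?_ ?_
      · filter_upwards [self_mem_nhdsWithin] with h hh using hlow h _ hh
      · filter_upwards [self_mem_nhdsWithin] with h hh using hup h _ hh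
  simpa using key

lemma tendsto_interval_average {g : ℝ × ℝ → ℝ} (hg : Continuous g) :
    Tendsto (fun h => (∫ σ in (0 : ℝ)..h, g (h, σ)) / h) (𝓝[>] 0) (𝓝 (g (0, 0))) := by
  rw [Metric.tendsto_nhds]
  intro ρ hρ
  obtain ⟨δ, hδ, hb⟩ := Metric.continuous_iff.1 hg (0, 0) (ρ / 2) (by positivity)
  filter_upwards [Ioo_mem_nhdsGT hδ] with h hh
  have hc : Continuous (fun σ => g (h, σ)) := hg.comp (by fun_prop)
  have h1 : ‖∫ σ in (0 : ℝ)..h, (g (h, σ) - g (0, 0))‖ ≤ ρ / 2 * |h - 0| := by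
    refine intervalIntegral.norm_integral_le_of_norm_le_const fun σ hσ => ?_
    rw [Set.uIoc_of_le hh.1.le] at hσ
    refine (hb (h, σ) ?_).le
    rw [Prod.dist_eq, max_lt_iff, Real.dist_eq, Real.dist_eq, sub_zero, sub_zero,
      abs_of_pos hh.1, abs_of_pos hσ.1]
    exact ⟨hh.2, hσ.2.trans_lt hh.2⟩
  rw [intervalIntegral.integral_sub (hc.intervalIntegrable _ _) (by simp),
    intervalIntegral.integral_const, sub_zero, abs_of_pos hh.1, smul_eq_mul, Real.norm_eq_abs] at h1
  have e : (∫ σ in (0 : ℝ)..h, g (h, σ)) / h - g (0, 0) =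
      ((∫ σ in (0 : ℝ)..h, g (h, σ)) - h * g (0, 0)) / h := by
    have := hh.1.ne'
    field_simp
  rw [Real.dist_eq, e, abs_div, abs_of_pos hh.1, div_lt_iff₀ hh.1]
  have := hh.1
  nlinarith

/-- A heat potential over a short time, of a density that is continuous near `(t, q)` and integrable
elsewhere: the heat kernel concentrates at `(t, q)`. -/
lemma tendsto_duhamel_div {D T t q : ℝ} (hD : 0 < D) (ht : 0 < t) (htT : t < T) {G : ℝ × ℝ → ℝ}
    (hGc : ∀ b : ℝ × ℝ, 0 < b.1 → ContinuousAt G b)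
    (hGi : IntegrableOn G (Set.Ioo 0 T ×ˢ Set.univ)) :
    Tendsto (fun h => (∫ b in Set.Ioo t (t + h) ×ˢ Set.univ,
      heatKernel D (t + h - b.1) (q - b.2) * G b) / h) (𝓝[>] 0) (𝓝 (G (t, q))) := by
  obtain ⟨δ, φ, φ', hδ, -, -, hφ⟩ := exists_cutoff ht q
  have hFc : Continuous (fun b => φ b * G b) :=
    continuous_mul_of_eq_zero (half_pos ht) hφ.continuous
      (fun b hb => (hφ.eq_zero b (Or.inl hb)).1) hGc
  have hFs : HasCompactSupport (fun b => φ b * G b) := hφ.hasCompactSupport.mul_right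
  obtain ⟨C₀, hC₀⟩ := hFs.exists_bound_of_continuous hFc
  obtain ⟨C, hC, hb⟩ := exists_pow_mul_heatKernel_le hD 1 3
  set I := ∫ b in Set.Ioo 0 T ×ˢ Set.univ, |G b| with hI
  have hI0 : 0 ≤ I := by positivity
  set g : ℝ × ℝ → ℝ := fun a => heat D a.2 (fun y => φ (t + a.1 - a.2, y) * G (t + a.1 - a.2, y)) q
    with hg
  have hgc : Continuous g :=
    continuous_heat_param D (X := ℝ × ℝ)
      (F := fun a y => φ (t + a.1 - a.2, y) * G (t + a.1 - a.2, y)) (s := id) (C := C₀)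
      (hFc.comp (by fun_prop : Continuous fun a : (ℝ × ℝ) × ℝ => (t + a.1.1 - a.1.2, a.2)))
      (fun a y => hC₀ _) continuous_id (by fun_prop) (by fun_prop)
  have hnear := tendsto_interval_average hgc
  have hg0 : g (0, 0) = G (t, q) := by
    simp only [hg, heat_zero, add_zero, sub_zero]
    rw [hφ.eq_one (t, q) (by simpa) (by simpa), one_mul]
  rw [hg0] at hnear
  have hfar : Tendsto (fun h : ℝ => C * h / (2 * δ) ^ 6 * I) (𝓝[>] 0) (𝓝 0) := by
    have : Continuous (fun h : ℝ => C * h / (2 * δ) ^ 6 * I) := by fun_prop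
    have h0 := this.tendsto 0
    simp only [mul_zero, zero_div, zero_mul] at h0
    exact h0.mono_left nhdsWithin_le_nhds
  have hdiff : Tendsto (fun h => (∫ b in Set.Ioo t (t + h) ×ˢ Set.univ,
      heatKernel D (t + h - b.1) (q - b.2) * G b) / h - (∫ σ in (0 : ℝ)..h, g (h, σ)) / h)
      (𝓝[>] 0) (𝓝 0) := by
    refine squeeze_zero_norm' ?_ hfar
    have hsmall : 0 < min (2 * δ) (min 1 (T - t)) :=
      lt_min (by positivity) (lt_min one_pos (by linarith))
    filter_upwards [Ioo_mem_nhdsGT hsmall] with h hh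
    have hh0 : 0 < h := hh.1
    have hhδ : h < 2 * δ := hh.2.trans_le (min_le_left _ _)
    have hh1 : h < 1 := hh.2.trans_le ((min_le_right _ _).trans (min_le_left _ _))
    have hhT : h < T - t := hh.2.trans_le ((min_le_right _ _).trans (min_le_right _ _))
    set S : Set (ℝ × ℝ) := Set.Ioo t (t + h) ×ˢ Set.univ with hS
    have hSm : MeasurableSet S := measurableSet_Ioo.prod MeasurableSet.univ
    have hSsub : S ⊆ Set.Ioo 0 T ×ˢ Set.univ :=
      Set.prod_mono_left (Set.Ioo_subset_Ioo ht.le (by linarith))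
    obtain ⟨i1, e1⟩ := integral_heat_eq_setIntegral (F := fun r y => φ (r, y) * G (r, y)) (t := t)
      (h := h) (C := C₀) hD hFc (fun s y => hC₀ _) hh0.le q
    have hbd : ∀ b ∈ S, ‖heatKernel D (t + h - b.1) (q - b.2) * ((1 - φ b) * G b)‖ ≤
        C * h ^ 2 / (2 * δ) ^ 6 * |G b| := by
      intro b hbS
      by_cases hb2 : |b.2 - q| < 2 * δ
      · have hb1 : |b.1 - t| < 2 * δ := by
          rw [abs_of_pos (by linarith [hbS.1.1])]
          linarith [hbS.1.2]
        rw [hφ.eq_one b hb1 hb2]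
        simp only [sub_self, zero_mul, mul_zero, norm_zero]
        positivity
      push Not at hb2
      have hσ : 0 < t + h - b.1 := by linarith [hbS.1.2]
      have hσh : t + h - b.1 ≤ h := by linarith [hbS.1.1]
      rw [abs_sub_comm] at hb2
      have hK := hb (t + h - b.1) hσ (by linarith) (q - b.2)
      have hpow : (2 * δ) ^ 6 ≤ (q - b.2) ^ (2 * 3) := by
        rw [← Even.pow_abs (by decide : Even (2 * 3)) (q - b.2)]
        gcongr
      have hKn := heatKernel_nonneg D (t + h - b.1) (q - b.2)
      have hKb : heatKernel D (t + h - b.1) (q - b.2) ≤ C * h ^ 2 / (2 * δ) ^ 6 := by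
        rw [le_div_iff₀ (by positivity)]
        have h5 : (heatKernel D (t + h - b.1) (q - b.2) * (2 * δ) ^ 6) * (t + h - b.1) ≤
            (C * (t + h - b.1) ^ 2) * (t + h - b.1) := by
          calc _ ≤ (heatKernel D (t + h - b.1) (q - b.2) * (q - b.2) ^ (2 * 3)) *
                (t + h - b.1) := by gcongr
            _ = (q - b.2) ^ (2 * 3) * heatKernel D (t + h - b.1) (q - b.2) * (t + h - b.1) := by
                ring
            _ ≤ _ := hK
            _ = _ := by ring
        refine (le_of_mul_le_mul_right h5 hσ).trans ?_
        gcongr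
      rw [norm_mul, norm_mul, Real.norm_of_nonneg hKn, Real.norm_of_nonneg
        (sub_nonneg.2 (hφ.le_one b)), Real.norm_eq_abs]
      refine mul_le_mul hKb ?_ (by have := sub_nonneg.2 (hφ.le_one b); positivity) (by positivity)
      exact mul_le_of_le_one_left (abs_nonneg _) (by linarith [hφ.nonneg b])
    have hGS : IntegrableOn G S := hGi.mono_set hSsub
    have i2 : IntegrableOn (fun b => heatKernel D (t + h - b.1) (q - b.2) * ((1 - φ b) * G b)) S := by
      refine Integrable.mono' (hGS.abs.const_mul (C * h ^ 2 / (2 * δ) ^ 6)) ?_ ?_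
      · refine AEStronglyMeasurable.mul ?_
          ((continuous_const.sub hφ.continuous).aestronglyMeasurable.mul hGS.aestronglyMeasurable)
        exact ((measurable_heatKernel D).comp (f := fun b : ℝ × ℝ => (t + h - b.1, q - b.2))
          (by fun_prop)).aestronglyMeasurable
      · filter_upwards [ae_restrict_mem hSm] with b hbS using hbd b hbS
    have e2 : (∫ b in S, heatKernel D (t + h - b.1) (q - b.2) * G b) =
        (∫ σ in (0 : ℝ)..h, g (h, σ)) +
          ∫ b in S, heatKernel D (t + h - b.1) (q - b.2) * ((1 - φ b) * G b) := by
      simp only [hg]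
      rw [e1, ← integral_add i1 i2]
      refine integral_congr_ae (ae_of_all _ fun b => ?_)
      simp only
      ring
    rw [e2, add_div, add_sub_cancel_left, norm_div, Real.norm_of_nonneg hh0.le, div_le_iff₀ hh0]
    calc ‖∫ b in S, heatKernel D (t + h - b.1) (q - b.2) * ((1 - φ b) * G b)‖
        ≤ ∫ b in S, C * h ^ 2 / (2 * δ) ^ 6 * |G b| := by
          refine norm_integral_le_of_norm_le (hGS.abs.const_mul _) ?_
          filter_upwards [ae_restrict_mem hSm] with b hbS using hbd b hbS
      _ = C * h ^ 2 / (2 * δ) ^ 6 * ∫ b in S, |G b| := integral_const_mul _ _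
      _ ≤ C * h ^ 2 / (2 * δ) ^ 6 * I := by
          gcongr
          exact setIntegral_mono_set hGi.abs (ae_of_all _ fun b => abs_nonneg _)
            (ae_of_all _ hSsub)
      _ = _ := by ring
  have := hdiff.add hnear
  simpa using this

/-- A continuous function with a continuous right derivative is differentiable. -/
lemma hasDerivAt_of_right {f f' : ℝ → ℝ} (hf : ∀ t, 0 < t → ContinuousAt f t)
    (hf' : ∀ t, 0 < t → ContinuousAt f' t)
    (hr : ∀ t, 0 < t → Tendsto (fun h => (f (t + h) - f t) / h) (𝓝[>] 0) (𝓝 (f' t))) {t : ℝ}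
    (ht : 0 < t) : HasDerivAt f (f' t) t := by
  set a := t / 2 with ha
  have ha0 : 0 < a := by positivity
  set g' : ℝ → ℝ := fun s => f' (max s a) with hg'
  have hg'c : Continuous g' := continuous_iff_continuousAt.2 fun s =>
    ContinuousAt.comp (g := f') (f := fun s => max s a)
      (hf' _ (lt_max_of_lt_right ha0)) (by fun_prop)
  set g : ℝ → ℝ := fun y => (∫ s in a..y, g' s) + f a with hg
  have hgd : ∀ y, HasDerivAt g (g' y) y := fun y =>
    ((hg'c.integral_hasStrictDerivAt a y).hasDerivAt).add_const _
  have hright : ∀ y, 0 < y → HasDerivWithinAt f (f' y) (Set.Ici y) y := by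
    intro y hy
    rw [hasDerivWithinAt_iff_tendsto_slope, Set.Ici_sdiff_left]
    have h1 : Tendsto (fun s => s - y) (𝓝[>] y) (𝓝[>] 0) := by
      refine tendsto_nhdsWithin_iff.2 ⟨?_, ?_⟩
      · have : Continuous (fun s => s - y) := by fun_prop
        have h0 := this.tendsto y
        rw [sub_self] at h0
        exact h0.mono_left nhdsWithin_le_nhds
      · filter_upwards [self_mem_nhdsWithin] with s hs using sub_pos.2 (Set.mem_Ioi.1 hs)
    refine ((hr y hy).comp h1).congr fun s => ?_
    simp only [Function.comp, slope_def_field, add_sub_cancel]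
  have heq := eq_of_has_deriv_right_eq (f := f) (g := g) (f' := g') (a := a) (b := t + 1)
    (fun y hy => by
      simp only [hg', max_eq_left hy.1]
      exact hright y (ha0.trans_le hy.1))
    (fun y _ => (hgd y).hasDerivWithinAt)
    (fun y hy => (hf y (ha0.trans_le hy.1)).continuousWithinAt)
    (fun y _ => (hgd y).continuousAt.continuousWithinAt) (by simp [hg])
  have hat : a < t := by linarith
  have h2 : HasDerivAt g (f' t) t := by
    have := hgd t
    simp only [hg', max_eq_left hat.le] at this
    exact this
  refine h2.congr_of_eventuallyEq ?_
  filter_upwards [Ioo_mem_nhds hat (lt_add_one t)] with y hy using heq y ⟨hy.1.le, hy.2.le⟩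

namespace IsApproxLimit

variable {D : ℝ} {U : ℝ → ℝ → ℝ} {p₀ : ℝ → ℝ} {p : ℝ → ℝ → ℝ} {W u : ℕ → ℝ → ℝ → ℝ}

lemma exists_bound_slice (h : IsApproxLimit D U p₀ p W u) (hD : 0 < D) (hp : Integrable p₀) {t : ℝ}
    (ht : 0 < t) : ∃ C, ∀ q, |p t q| ≤ C :=
  ⟨_, fun q => (abs_of_nonneg (h.nonneg ht q)).le.trans (h.limit_le hD hp ht le_rfl q)⟩

/-- The imaginary-time Schrödinger equation for the limit, from the mild equation. -/
theorem hasDerivAt_time (h : IsApproxLimit D U p₀ p W u) (hD : 0 < D)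
    (hU : Continuous (Function.uncurry U)) (hU0 : ∀ t q, 0 ≤ U t q) (hp : Integrable p₀)
    {p₁ p₂ : ℝ → ℝ → ℝ} (h₂ : ∀ t, 0 < t → ∀ q, ContinuousAt (Function.uncurry p₂) (t, q))
    (hd₁ : ∀ t, 0 < t → ∀ q, HasDerivAt (p t) (p₁ t q) q)
    (hd₂ : ∀ t, 0 < t → ∀ q, HasDerivAt (p₁ t) (p₂ t q) q) {t : ℝ} (ht : 0 < t) (q : ℝ) :
    HasDerivAt (fun s => p s q) (D / 2 * p₂ t q - U t q * p t q) t := by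
  have hpc : ∀ t, 0 < t → ContinuousAt (fun s => p s q) t := fun t ht =>
    ContinuousAt.comp (f := fun s : ℝ => (s, q)) (g := Function.uncurry p) (h.continuousAt hD ht q)
      (by fun_prop)
  have hp2c : ∀ t, 0 < t → ContinuousAt (fun s => p₂ s q) t := fun t ht =>
    ContinuousAt.comp (f := fun s : ℝ => (s, q)) (g := Function.uncurry p₂) (h₂ t ht q)
      (by fun_prop)
  have hUc : Continuous (fun s => U s q) := hU.comp (by fun_prop : Continuous fun s : ℝ => (s, q))
  refine hasDerivAt_of_right (f' := fun t => D / 2 * p₂ t q - U t q * p t q) hpc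
    (fun t ht => (continuousAt_const.mul (hp2c t ht)).sub (hUc.continuousAt.mul (hpc t ht)))
    (fun t ht => ?_) ht
  obtain ⟨C, hC⟩ := h.exists_bound_slice hD hp ht
  have l1 := tendsto_heat_sub_div hD hC (hd₁ t ht) (hd₂ t ht q)
  have l2 := tendsto_duhamel_div (G := fun b : ℝ × ℝ => U b.1 b.2 * p b.1 b.2) (q := q) hD ht
    (lt_add_one t) (fun b hb => hU.continuousAt.mul (h.continuousAt hD hb b.2))
    (h.integrableOn_mul hD hU hU0 hp (by linarith)).1
  refine (l1.sub l2).congr' ?_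
  filter_upwards [self_mem_nhdsWithin] with s hs
  have hs : 0 < s := hs
  rw [h.mild hD hU hU0 hp ht (by linarith : t < t + s) q, add_sub_cancel_left]
  ring

/-- Splitting off the potential in one short time step is exact to first order. -/
theorem isLittleO_shortTime (h : IsApproxLimit D U p₀ p W u) (hD : 0 < D)
    (hU : Continuous (Function.uncurry U)) (hU0 : ∀ t q, 0 ≤ U t q) (hp : Integrable p₀)
    {p₁ p₂ : ℝ → ℝ → ℝ} (h₂ : ∀ t, 0 < t → ∀ q, ContinuousAt (Function.uncurry p₂) (t, q))
    (hd₁ : ∀ t, 0 < t → ∀ q, HasDerivAt (p t) (p₁ t q) q)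
    (hd₂ : ∀ t, 0 < t → ∀ q, HasDerivAt (p₁ t) (p₂ t q) q) {t : ℝ} (ht : 0 < t) (q : ℝ) :
    (fun ε => p (t + ε) q - heat D ε (fun y => Real.exp (-ε * U t y) * p t y) q)
      =o[𝓝[>] 0] fun ε : ℝ => ε := by
  obtain ⟨C, hC⟩ := h.exists_bound_slice hD hp ht
  have hpt := h.continuous_slice hD ht
  have hUt := continuous_uncurry_right hU t
  have l1 := tendsto_heat_sub_div hD hC (hd₁ t ht) (hd₂ t ht q)
  have l2 := tendsto_heat_absorption (D := D) hUt (hU0 t) hpt hC q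
  have l3 : Tendsto (fun ε => (p (t + ε) q - p t q) / ε) (𝓝[>] 0)
      (𝓝 (D / 2 * p₂ t q - U t q * p t q)) := by
    have := (hasDerivAt_iff_tendsto_slope_zero.1
      (h.hasDerivAt_time hD hU hU0 hp h₂ hd₁ hd₂ ht q)).mono_left (nhdsGT_le_nhdsNE 0)
    refine this.congr fun ε => ?_
    rw [smul_eq_mul, div_eq_inv_mul]
  have l4 := l3.sub (l1.sub l2)
  rw [sub_self] at l4
  rw [isLittleO_iff_tendsto' (by
    filter_upwards [self_mem_nhdsWithin] with ε hε h0
    exact absurd h0 (ne_of_gt hε))]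
  refine l4.congr' ?_
  filter_upwards [self_mem_nhdsWithin] with ε hε
  have hε : 0 < ε := hε
  have e1 : heat D ε (fun y => (1 - Real.exp (-ε * U t y)) / ε * p t y) q =
      (heat D ε (p t) q - heat D ε (fun y => Real.exp (-ε * U t y) * p t y) q) / ε := by
    rw [← heat_sub hε (heatIntegrable_of_bounded hpt hC)
      (heatIntegrable_of_bounded (C := C) (by fun_prop) fun y => ?_), div_eq_inv_mul,
      ← heat_const_mul]
    · congr 1
      ext y
      field_simp
    · rw [abs_mul, Real.abs_exp]
      have h1 : Real.exp (-ε * U t y) ≤ 1 := Real.exp_le_one_iff.2 (by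
        have := mul_nonneg hε.le (hU0 t y)
        linarith)
      exact (mul_le_of_le_one_left (abs_nonneg _) h1).trans (hC y)
  rw [e1]
  field_simp
  ring

end IsApproxLimit

/-! ### Bayesian updates and path integrals as split-step schemes -/

/-- The potential seen by the hidden state, normalized by the lower bound `c` of `V`. The observed
path is frozen at negative times, which makes it continuous on the whole line. -/
noncomputable def shiftedPotential (V x : ℝ → ℝ) (c t q : ℝ) : ℝ := V (q - x (max t 0)) - c

lemma shiftedPotential_of_nonneg (V x : ℝ → ℝ) (c : ℝ) {t : ℝ} (ht : 0 ≤ t) (q : ℝ) :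
    shiftedPotential V x c t q = V (q - x t) - c := by
  rw [shiftedPotential, max_eq_left ht]

lemma continuous_frozen_path {x : ℝ → ℝ} (hx : ContinuousOn x (Set.Ici 0)) :
    Continuous fun t => x (max t 0) :=
  hx.comp_continuous (by fun_prop) fun _ => Set.mem_Ici.2 (le_max_right _ _)

lemma continuous_shiftedPotential {V x : ℝ → ℝ} (hV : Continuous V)
    (hx : ContinuousOn x (Set.Ici 0)) (c : ℝ) :
    Continuous (Function.uncurry (shiftedPotential V x c)) :=
  (hV.comp (continuous_snd.sub ((continuous_frozen_path hx).comp continuous_fst))).sub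
    continuous_const

lemma wienerTransition_eq_heatKernel {D ε : ℝ} (hε : 0 < ε) (q' q : ℝ) :
    wienerTransition D ε q' q = heatKernel D ε (q' - q) := by
  rw [wienerTransition, heatKernel_of_pos hε]

lemma predict_eq_heat {D ε : ℝ} (hD : 0 < D) (hε : 0 < ε) (f : ℝ → ℝ) :
    predict D ε f = heat D ε f := by
  ext q'
  rw [heat_eq_integral hD hε, predict]
  simp only [wienerTransition_eq_heatKernel hε]

lemma exp_action_eq {D ε : ℝ} (hD : 0 < D) (hε : 0 < ε) (q' q v : ℝ) :
    Real.exp (-ε * (1 / (2 * D) * ((q' - q) / ε) ^ 2 + v)) =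
      Real.sqrt (2 * Real.pi * D * ε) * (heatKernel D ε (q' - q) * Real.exp (-ε * v)) := by
  have h : Real.sqrt (2 * Real.pi * D * ε) ≠ 0 := by positivity
  rw [heatKernel_of_pos hε, mul_assoc (_)⁻¹, mul_inv_cancel_left₀ h, ← Real.exp_add]
  congr 1
  field_simp
  ring

lemma exp_neg_mul_eq_potentialFactor (V x : ℝ → ℝ) (c : ℝ) {ε : ℝ} (hε : 0 < ε) (n : ℕ) (q : ℝ) :
    Real.exp (-ε * V (q - x (n * ε))) =
      Real.exp (-c * ε) * potentialFactor (shiftedPotential V x c) ε n q := by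
  rw [potentialFactor, shiftedPotential_of_nonneg V x c (by positivity), ← Real.exp_add]
  congr 1
  ring

lemma pathPosterior_eq_splitStep {D ε : ℝ} (hD : 0 < D) (hε : 0 < ε) (V x p₀ : ℝ → ℝ) (c : ℝ)
    (n : ℕ) : pathPosterior D V x p₀ (Real.sqrt (2 * Real.pi * D * ε))⁻¹ ε n = fun q =>
      Real.exp (-c * (n * ε)) *
        splitStep D ε (potentialFactor (shiftedPotential V x c) ε) p₀ n q := by
  induction n with
  | zero => ext q; simp [pathPosterior, splitStep]
  | succ n ih =>
    ext q'
    have h : Real.sqrt (2 * Real.pi * D * ε) ≠ 0 := by positivity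
    rw [splitStep_succ, pathPosterior, ih, heat_eq_integral hD hε]
    simp only [exp_action_eq hD hε, exp_neg_mul_eq_potentialFactor V x c hε]
    rw [← integral_const_mul, ← integral_const_mul, ← integral_const_mul]
    refine integral_congr_ae (ae_of_all _ fun q => ?_)
    have e : Real.exp (-c * ((n + 1 : ℕ) * ε)) = Real.exp (-c * ε) * Real.exp (-c * (n * ε)) := by
      rw [← Real.exp_add]
      congr 1
      push_cast
      ring
    simp only [e]
    field_simp

lemma shortTimeStep_eq_heat {D ε : ℝ} (hD : 0 < D) (hε : 0 < ε) (V x f : ℝ → ℝ) (M c : ℝ) {t : ℝ}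
    (ht : 0 ≤ t) (q : ℝ) : shortTimeStep D V M ε (x t) f q =
      M * Real.sqrt (2 * Real.pi * D * ε) * Real.exp (-c * ε) *
        heat D ε (fun y => Real.exp (-ε * shiftedPotential V x c t y) * f y) q := by
  rw [shortTimeStep, heat_eq_integral hD hε]
  simp only [exp_action_eq hD hε, shiftedPotential_of_nonneg V x c ht]
  rw [← integral_const_mul, ← integral_const_mul]
  refine integral_congr_ae (ae_of_all _ fun y => ?_)
  have e : Real.exp (-ε * V (y - x t)) =
      Real.exp (-c * ε) * Real.exp (-ε * (V (y - x t) - c)) := by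
    rw [← Real.exp_add]
    congr 1
    ring
  simp only [e]
  ring

lemma integral_pos_of_forall_pos {f : ℝ → ℝ} (hf : Integrable f) (h : ∀ q, 0 < f q) :
    0 < ∫ q, f q := by
  rw [integral_pos_iff_support_of_nonneg (fun q => (h q).le) hf,
    Set.eq_univ_of_forall fun q => Function.mem_support.2 (h q).ne']
  simp

lemma integral_splitStep_pos {D ε : ℝ} (hD : 0 < D) (hε : 0 < ε) {a : ℕ → ℝ → ℝ}
    (ham : ∀ n, Measurable (a n)) (ha0 : ∀ n q, 0 < a n q) (ha1 : ∀ n q, a n q ≤ 1) {f : ℝ → ℝ}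
    (hf : Integrable f) (hf0 : ∀ q, 0 ≤ f q) (hf1 : 0 < ∫ q, f q) (n : ℕ) :
    0 < ∫ q, splitStep D ε a f n q := by
  have ha0' := fun n q => (ha0 n q).le
  induction n with
  | zero => exact hf1
  | succ n ih =>
    refine integral_pos_of_forall_pos (splitStep_integrable hD hε ham ha0' ha1 hf (n + 1))
      fun q => ?_
    rw [splitStep_succ]
    exact mul_pos (ha0 _ _) (heat_pos hD hε (splitStep_integrable hD hε ham ha0' ha1 hf n)
      (splitStep_nonneg ha0' hf0 n) ih q)

/-- The exact posterior is the normalized split-step scheme: constants cancel in every step. -/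
lemma bayesPosterior_eq_splitStep_div {D ε M c : ℝ} (hD : 0 < D) (hε : 0 < ε) (hM : 0 < M)
    {V x p₀ : ℝ → ℝ} (hU : Continuous (Function.uncurry (shiftedPotential V x c)))
    (hU0 : ∀ t q, 0 ≤ shiftedPotential V x c t q) (hp : Integrable p₀) (hp0 : ∀ q, 0 ≤ p₀ q)
    (hp1 : ∫ q, p₀ q = 1) (n : ℕ) :
    bayesPosterior D V x p₀ M ε n = fun q =>
      (∫ y, splitStep D ε (potentialFactor (shiftedPotential V x c) ε) p₀ n y)⁻¹ *
        splitStep D ε (potentialFactor (shiftedPotential V x c) ε) p₀ n q := by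
  induction n with
  | zero => ext q; simp [bayesPosterior, splitStep, hp1]
  | succ n ih =>
    set U := shiftedPotential V x c with hUdef
    have hI := integral_splitStep_pos hD hε (measurable_potentialFactor hU ε)
      (fun n q => Real.exp_pos _) (potentialFactor_le_one hU0 hε.le) hp hp0 (by rw [hp1]; exact one_pos) n
    set I := ∫ y, splitStep D ε (potentialFactor U ε) p₀ n y with hIdef
    set k := M * Real.exp (-c * ε) * I⁻¹ with hk
    have hk0 : k ≠ 0 := by positivity
    have e : ∀ q, likelihood V M ε (x ((n + 1 : ℕ) * ε)) q *
        predict D ε (bayesPosterior D V x p₀ M ε n) q =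
        k * splitStep D ε (potentialFactor U ε) p₀ (n + 1) q := by
      intro q
      rw [predict_eq_heat hD hε, ih, heat_const_mul, likelihood,
        exp_neg_mul_eq_potentialFactor V x c hε, splitStep_succ]
      ring
    ext q
    simp only [bayesPosterior]
    rw [div_mul_eq_mul_div, e q, evidence]
    simp only [e]
    rw [integral_const_mul, mul_div_mul_left _ _ hk0, div_eq_inv_mul]

lemma tendsto_integral_splitStep {D t : ℝ} (hD : 0 < D) (ht : 0 < t) {U : ℝ → ℝ → ℝ}
    (hU : Continuous (Function.uncurry U)) (hU0 : ∀ t q, 0 ≤ U t q) {p₀ g : ℝ → ℝ}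
    (hp : Integrable p₀)
    (hg : ∀ q, Tendsto (fun N : ℕ => splitStep D (t / N) (potentialFactor U (t / N)) p₀ N q) atTop
      (𝓝 (g q))) :
    Tendsto (fun N : ℕ => ∫ q, splitStep D (t / N) (potentialFactor U (t / N)) p₀ N q) atTop
      (𝓝 (∫ q, g q)) := by
  refine tendsto_integral_filter_of_dominated_convergence (heat D t fun q => |p₀ q|) ?_ ?_
    (integrable_heat hD ht.le hp.abs) (ae_of_all _ hg)
  all_goals
    filter_upwards [eventually_gt_atTop 0] with N hN
    have hN0 : (0 : ℝ) < N := by exact_mod_cast hN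
    have hε : 0 < t / N := by positivity
    have hNε : (N : ℝ) * (t / N) = t := by field_simp
    have m1 := measurable_potentialFactor hU (t / N)
    have m2 := potentialFactor_nonneg U (t / N)
    have m3 := potentialFactor_le_one hU0 hε.le
  · exact (splitStep_integrable hD hε m1 m2 m3 hp N).aestronglyMeasurable
  · refine ae_of_all _ fun q => ?_
    have := abs_splitStep_le_heat hD hε m1 m2 m3 hp N q
    rwa [hNε] at this

/-- A relative error `m ε - 1` in the normalization is visible at order `ε`, since the density is
positive. -/
lemma isLittleO_sub_mul_iff {f S m : ℝ → ℝ} {l : Filter ℝ} {a : ℝ} (ha : 0 < a)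
    (hS : Tendsto S l (𝓝 a)) (hf : (fun ε => f ε - S ε) =o[l] fun ε : ℝ => ε) :
    ((fun ε => f ε - m ε * S ε) =o[l] fun ε : ℝ => ε) ↔
      ((fun ε => m ε - 1) =o[l] fun ε : ℝ => ε) := by
  have e : (fun ε => f ε - m ε * S ε) = fun ε => (f ε - S ε) - (m ε - 1) * S ε := by
    ext ε; ring
  have h1 : ((fun ε => f ε - m ε * S ε) =o[l] fun ε : ℝ => ε) ↔
      ((fun ε => (m ε - 1) * S ε) =o[l] fun ε : ℝ => ε) := by
    rw [e]
    refine ⟨fun h => ?_, fun h => hf.sub h⟩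
    simpa using hf.sub h
  rw [h1]
  constructor
  · intro h
    have hinv : (fun ε => (S ε)⁻¹) =O[l] fun _ => (1 : ℝ) := (hS.inv₀ ha.ne').isBigO_one ℝ
    have h2 := h.mul_isBigO hinv
    simp only [mul_one] at h2
    refine h2.congr' ?_ EventuallyEq.rfl
    filter_upwards [hS.eventually_const_lt ha] with ε hε
    rw [mul_inv_cancel_right₀ hε.ne']
  · intro h
    simpa using h.mul_isBigO (hS.isBigO_one ℝ)

lemma contDiff_two_of_hasDerivAt {f f₁ f₂ : ℝ → ℝ} (h1 : ∀ y, HasDerivAt f (f₁ y) y)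
    (h2 : ∀ y, HasDerivAt f₁ (f₂ y) y) (hc : Continuous f₂) :
    ContDiff ℝ 2 f ∧ iteratedDeriv 2 f = f₂ := by
  have e1 : deriv f = f₁ := funext fun y => (h1 y).deriv
  have e2 : deriv f₁ = f₂ := funext fun y => (h2 y).deriv
  constructor
  · rw [show (2 : WithTop ℕ∞) = 1 + 1 by norm_num, contDiff_succ_iff_deriv, e1,
      contDiff_one_iff_deriv, e2]
    exact ⟨fun y => (h1 y).differentiableAt, by simp, fun y => (h2 y).differentiableAt, hc⟩
  · rw [iteratedDeriv_succ, iteratedDeriv_one, e1, e2]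

theorem mainTheorem1 (D : ℝ) (hD : 0 < D)
    (V : ℝ → ℝ) (hV : ContDiff ℝ 1 V) (hVbdd : BddBelow (Set.range V))
    (x : ℝ → ℝ) (hx : ContinuousOn x (Set.Ici 0))
    (p₀ : ℝ → ℝ) (hp₀ : Integrable p₀) (hp₀_nonneg : ∀ q, 0 ≤ p₀ q) (hp₀_one : ∫ q, p₀ q = 1) :
    ∃ p : ℝ → ℝ → ℝ,
      -- the continuous-time limit of the repeated updates, with `M = (2πDε)^(-1/2)`, `Nε = t`
      (∀ t > 0, ∀ q, Tendsto
        (fun N : ℕ => pathPosterior D V x p₀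
          (Real.sqrt (2 * Real.pi * D * (t / N)))⁻¹ (t / N) N q) atTop (𝓝 (p q t))) ∧
      -- `p` is the Bayesian posterior density up to a factor independent of `q`
      (∀ t > 0, (∀ q, 0 < p q t) ∧ Integrable (fun q => p q t) ∧
        ∀ M : ℝ → ℝ, (∀ ε > 0, 0 < M ε) → ∀ q, Tendsto
          (fun N : ℕ => bayesPosterior D V x p₀ (M (t / N)) (t / N) N q) atTop
          (𝓝 (p q t / ∫ y, p y t))) ∧
      -- the short-time evolution equation holds to first order exactly for `M = (2πDε)^(-1/2)`,
      -- up to a relative error `o(ε)`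
      (∀ t > 0, ∀ q, ∀ M : ℝ → ℝ,
        ((fun ε => p q (t + ε) - shortTimeStep D V (M ε) ε (x t) (fun y => p y t) q)
            =o[𝓝[>] 0] (fun ε : ℝ => ε)) ↔
          ((fun ε => M ε * Real.sqrt (2 * Real.pi * D * ε) - 1) =o[𝓝[>] 0] (fun ε : ℝ => ε))) ∧
      -- the imaginary-time Schrödinger equation
      (∀ t > 0, ∀ q,
        DifferentiableAt ℝ (fun s => p q s) t ∧ ContDiff ℝ 2 (fun y => p y t) ∧
        -deriv (fun s => p q s) t =
          -(D / 2) * iteratedDeriv 2 (fun y => p y t) q + V (q - x t) * p q t) := by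
  obtain ⟨c, hc⟩ := hVbdd
  set U := shiftedPotential V x c with hUdef
  have hU : Continuous (Function.uncurry U) := continuous_shiftedPotential hV.continuous hx c
  have hU0 : ∀ t q, 0 ≤ U t q := fun t q => sub_nonneg.2 (hc (Set.mem_range_self _))
  have hUd : ∀ t q, HasDerivAt (U t) (deriv V (q - x (max t 0))) q := fun t q =>
    ((hV.differentiable one_ne_zero _).hasDerivAt.comp_sub_const q (x (max t 0))).sub_const c
  have hU' : Continuous (Function.uncurry fun t q => deriv V (q - x (max t 0))) :=
    (hV.continuous_deriv le_rfl).comp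
      (continuous_snd.sub ((continuous_frozen_path hx).comp continuous_fst))
  obtain ⟨p, W, u, h1, h2, hlim, h3⟩ := exists_limit hD hU hU0 hp₀ hp₀_nonneg
  have h : IsApproxLimit D U p₀ p W u := ⟨h1, h2, h3⟩
  have hpos : ∀ t > 0, ∀ q, 0 < p t q := fun t ht q =>
    limit_splitStep_pos hD hU hU0 hp₀ hp₀_nonneg (by rw [hp₀_one]; exact one_pos) ht q (hlim t ht q)
  obtain ⟨p₁, p₂, hreg⟩ := h.exists_spatial_deriv hD hU hU0 hUd hU' hp₀
  have hc₂ := fun t ht q => (hreg t ht q).2.1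
  have hd₁ := fun t ht q => (hreg t ht q).2.2.1
  have hd₂ := fun t ht q => (hreg t ht q).2.2.2
  refine ⟨fun q t => Real.exp (-c * t) * p t q, fun t ht q => ?_, fun t ht => ⟨fun q => ?_, ?_, ?_⟩,
    fun t ht q M => ?_, fun t ht q => ?_⟩
  · refine ((hlim t ht q).const_mul (Real.exp (-c * t))).congr' ?_
    filter_upwards [eventually_gt_atTop 0] with N hN
    have hN0 : (0 : ℝ) < N := by exact_mod_cast hN
    have hNε : (N : ℝ) * (t / N) = t := by field_simp
    rw [pathPosterior_eq_splitStep hD (by positivity) V x p₀ c N, hNε]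
  · exact mul_pos (Real.exp_pos _) (hpos t ht q)
  · exact (h.integrable_slice hD hp₀ ht).const_mul _
  · intro M hM q
    have hI := integral_pos_of_forall_pos (h.integrable_slice hD hp₀ ht) (hpos t ht)
    rw [integral_const_mul, mul_div_mul_left _ _ (Real.exp_pos _).ne', div_eq_inv_mul]
    refine (((tendsto_integral_splitStep hD ht hU hU0 hp₀ (hlim t ht)).inv₀ hI.ne').mul
      (hlim t ht q)).congr' ?_
    filter_upwards [eventually_gt_atTop 0] with N hN
    have hN0 : (0 : ℝ) < N := by exact_mod_cast hN
    have hε : 0 < t / N := by positivity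
    rw [bayesPosterior_eq_splitStep_div hD hε (hM _ hε) hU hU0 hp₀ hp₀_nonneg hp₀_one N]
  · have hf := h.isLittleO_shortTime hD hU hU0 hp₀ hc₂ hd₁ hd₂ ht q
    set S : ℝ → ℝ := fun ε => heat D ε (fun y => Real.exp (-ε * U t y) * p t y) q with hS
    have hScont : Tendsto S (𝓝[>] 0) (𝓝 (p t q)) := by
      have a1 : Tendsto (fun ε => p (t + ε) q) (𝓝[>] 0) (𝓝 (p t q)) := by
        have := (h.hasDerivAt_time hD hU hU0 hp₀ hc₂ hd₁ hd₂ ht q).continuousAt.tendsto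
        refine this.comp ?_
        have a2 : Tendsto (fun ε : ℝ => t + ε) (𝓝 0) (𝓝 (t + 0)) := tendsto_id.const_add t
        rw [add_zero] at a2
        exact a2.mono_left nhdsWithin_le_nhds
      have a3 := a1.sub (hf.trans_tendsto (tendsto_id.mono_left nhdsWithin_le_nhds))
      simp only [sub_sub_cancel, sub_zero] at a3
      exact a3
    rw [← isLittleO_sub_mul_iff (hpos t ht q) hScont hf]
    have hE : (fun ε => Real.exp (-c * (t + ε)) *
        (p (t + ε) q - M ε * Real.sqrt (2 * Real.pi * D * ε) * S ε)) =ᶠ[𝓝[>] 0]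
        fun ε => Real.exp (-c * (t + ε)) * p (t + ε) q -
          shortTimeStep D V (M ε) ε (x t) (fun y => Real.exp (-c * t) * p t y) q := by
      filter_upwards [self_mem_nhdsWithin] with ε hε
      have hε : 0 < ε := hε
      rw [shortTimeStep_eq_heat hD hε V x _ (M ε) c ht.le]
      have e1 : heat D ε (fun y => Real.exp (-ε * shiftedPotential V x c t y) *
          (Real.exp (-c * t) * p t y)) q = Real.exp (-c * t) * S ε := by
        rw [hS, ← heat_const_mul]
        congr 1
        ext y
        simp only [hUdef]
        ring
      rw [e1, mul_add, Real.exp_add]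
      ring
    rw [← isLittleO_congr hE EventuallyEq.rfl]
    have hexp : ∀ k : ℝ, (fun ε => Real.exp (k * (t + ε))) =O[𝓝[>] 0] fun _ => (1 : ℝ) := by
      intro k
      have : Continuous fun ε => Real.exp (k * (t + ε)) := by fun_prop
      exact ((this.tendsto 0).mono_left nhdsWithin_le_nhds).isBigO_one ℝ
    constructor
    · intro ho
      have := (hexp c).mul_isLittleO ho
      simp only [one_mul] at this
      refine this.congr_left fun ε => ?_
      rw [← mul_assoc, ← Real.exp_add]
      simp
    · intro ho
      simpa using (hexp (-c)).mul_isLittleO ho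
  · have ht' := h.hasDerivAt_time hD hU hU0 hp₀ hc₂ hd₁ hd₂ ht q
    have hcont : Continuous (p₂ t) := continuous_iff_continuousAt.2 fun y =>
      ContinuousAt.comp (f := fun y : ℝ => (t, y)) (g := Function.uncurry p₂) (hc₂ t ht y)
        (by fun_prop)
    obtain ⟨s1, s2⟩ := contDiff_two_of_hasDerivAt
      (fun y => (hd₁ t ht y).const_mul (Real.exp (-c * t)))
      (fun y => (hd₂ t ht y).const_mul (Real.exp (-c * t))) (continuous_const.mul hcont)
    have hexp : HasDerivAt (fun s => Real.exp (-c * s)) (Real.exp (-c * t) * (-c * 1)) t :=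
      ((hasDerivAt_id t).const_mul (-c)).exp
    have hprod := hexp.mul ht'
    refine ⟨hprod.differentiableAt, s1, ?_⟩
    have hderiv := hprod.deriv
    change deriv (fun s => Real.exp (-c * s) * p s q) t = _ at hderiv
    rw [hderiv, s2, hUdef, shiftedPotential_of_nonneg V x c ht.le]
    ring
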